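/- Let $M$ be a smooth Hausdorff manifold of dimension $2n+1$ with a contact form $\lambda$; put $\xi=\ker\lambda$ and let $\phi^t$ be the flow of the Reeb vector field $R_\lambda$. Let $(R_0,\dots,R_k)$, $k\ge 1$, be a \emph{graded bridged Legendrian link}: Legendrian submanifolds $R_i\subset M$ together with, for all $i,j$, a path $\ell_{ij}:[0,1]\to M$ from $R_i$ to $R_j$ (a bridge) and a grading $\lambda_{ij}$ of it, that is, a continuous family of Lagrangian subspaces $\lambda_{ij}(t)\subset(\xi_{\ell_{ij}(t)},d\lambda)$ with $\lambda_{ij}(0)=T_{\ell_{ij}(0)}R_i$ and $\lambda_{ij}(1)=T_{\ell_{ij}(1)}R_j$. Let $\gamma_{i(i+1)}$ ($0\le i<k$) and $\gamma_{0k}$ be iso-speed Reeb chords from $R_i$ to $R_{i+1}$ and from $R_0$ to $R_k$ (for $k=1$ two chords $\gamma_{01}$ and $\gamma_{0k}$ from $R_0$ to $R_1$, which may differ). Here an iso-speed Reeb chord from $R$ to $R'$ is a path $\gamma$ with $\dot\gamma=T\,R_\lambda(\gamma)$, $T\in\mathbb R$, $\gamma(0)\in R$, $\gamma(1)\in R'$;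 the chords in question are assumed nondegenerate, i.e. $d\phi^{T}(T_{\gamma(0)}R)$ and $T_{\gamma(1)}R'$ are transversal in $\xi_{\gamma(1)}$. \emph{Lagrangian paths at a chord.} Put $\alpha_\gamma(t)=d\phi^{Tt}(T_{\gamma(0)}R)$, and let $\alpha_\gamma^-$ be a Lagrangian path in $\xi_{\gamma(1)}$ from $T_{\gamma(1)}R'$ to $\alpha_\gamma(1)$ which is transversal to $T_{\gamma(1)}R'$ for $t>0$ and leaves $T_{\gamma(1)}R'$ in the negative direction at $t=0$ (the quadratic form $v\mapsto \frac{d}{dt}|_{0}\,d\lambda(v,v(t))$, $v(t)\in\alpha^-_\gamma(t)$, $v(0)=v$, on $T_{\gamma(1)}R'$ is negative definite). \emph{Bounding squares.} A bounding square of a chord $\gamma$ from $R_i$ to $R_j$ is a continuous map $w:[0,1]^2\to M$ with $w(0,t)=\ell_{ij}(t)$, $w(1,t)=\gamma(t)$, $w(\tau,0)\in R_i$, $w(\tau,1)\in R_j$; $[\gamma,w]$ is its homotopy class through such maps. Its Maslov index $\mu([\gamma,w];\lambda_{ij})\in\mathbb Z$ is the Maslov index, in a symplectic trivialization of $w^*\xi$,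 of the Lagrangian loop obtained by running counterclockwise along $\partial[0,1]^2$: $\lambda_{ij}$ reversed, $TR_i$ along $w(\tau,0)$, $\alpha_\gamma$, $\alpha_\gamma^-$ reversed, and $TR_j$ along $w(1-\tau,1)$. \emph{Polygons.} Let $B$ be a homotopy class of continuous maps $u:P\to M$, where $P$ is a $(2k+2)$-gon (the disc with $k+1$ boundary punctures, each compactified by an interval): $u$ maps alternate sides of $P$ to $R_0,\dots,R_k$ and is given on the remaining sides by the chords, $P$ being drawn as a rectangle with bottom side mapped to $R_0$, top side to $R_k$, right side $\gamma_{0k}$ (run upwards), and left side, from bottom to top, consisting of $\gamma_{01}$, an edge in $R_1$, $\gamma_{12}$, an edge in $R_2$, $\dots$, $\gamma_{(k-1)k}$. The polygonal Maslov index $\mu(\mathcal E,\vec\gamma;B)$ is the Maslov index, in a symplectic trivialization of $u^*\xi$, of the Lagrangian loop obtained by running counterclockwise along $\partial P$: the tangent spaces $TR_i$ along the edges in $R_i$; $\alpha_{\gamma_{0k}}$ followed by $\alpha^-_{\gamma_{0k}}$ reversed at the right side; and $\alpha^-_{\gamma_{i(i+1)}}$ followed by $\alpha_{\gamma_{i(i+1)}}$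 reversed at each chord on the left side. \emph{Gluing.} Let $[\gamma_{i(i+1)},w_{i(i+1)}]$, $0\le i<k$, be classes of bounding squares, and glue the squares $w_{i(i+1)}$ to a polygon $u$ in class $B$ along the chords $\gamma_{i(i+1)}$. The left side of the result is the concatenation of the bridges $\ell_{01},\ell_{12},\dots,\ell_{(k-1)k}$ with intermediate paths $c_i$ in $R_i$ ($0<i<k$), each $c_i$ homotopic in $R_i$ rel end points to the path formed by $w_{(i-1)i}(\tau,1)$, the edge of $u$ in $R_i$, and $w_{i(i+1)}(1-\tau,0)$. Assume that $(\ell_{0k},\lambda_{0k})$ is this concatenation, graded by the $\lambda_{i(i+1)}$ and by $TR_i$ along $c_i$, up to a homotopy of graded paths from $R_0$ to $R_k$, and let $[\gamma_{0k},w_{0k}]$ be the class of the resulting bounding square of $\gamma_{0k}$ (homotopy of graded bridges, attached squares, polygon). Then $$\mu([\gamma_{0k},w_{0k}];\lambda_{0k})=\mu(\mathcal E,\vec\gamma;B)+\sum_{i=0}^{k-1}\mu\big([\gamma_{i(i+1)},w_{i(i+1)}];\lambda_{i(i+1)}\big).$$ More precisely: whenever integers $\mu_B$ and $\mu_i$ are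 Maslov indices, as described, of $B$ and of the $[\gamma_{i(i+1)},w_{i(i+1)}]$ (for any choices of representatives, trivializations and paths $\alpha^-$), then $\mu_B+\sum_i\mu_i$ is a Maslov index of $[\gamma_{0k},w_{0k}]$, and it is the only one. -/

import Mathlib

open scoped Manifold ContDiff Topology
open Set

noncomputable section

namespace ContactLink

universe u

/-! ## Contact manifolds and the Reeb flow -/

section Contact

variable {n : ℕ} {M : Type u} [TopologicalSpace M]
  [ChartedSpace (EuclideanSpace ℝ (Fin (2 * n + 1))) M]

/-- The coordinate expression of the 1-form `lam` in the preferred chart at `x`: the pull-back of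
`lam` under the inverse of that chart. -/
def oneFormInChart (lam : ∀ x : M, TangentSpace (𝓡 (2 * n + 1)) x →L[ℝ] ℝ) (x : M)
    (y : EuclideanSpace ℝ (Fin (2 * n + 1))) : EuclideanSpace ℝ (Fin (2 * n + 1)) →L[ℝ] ℝ :=
  (lam ((extChartAt (𝓡 (2 * n + 1)) x).symm y)).comp
    (mfderiv 𝓘(ℝ, EuclideanSpace ℝ (Fin (2 * n + 1))) (𝓡 (2 * n + 1))
      (extChartAt (𝓡 (2 * n + 1)) x).symm y)

/-- The exterior derivative `dlam` at `x`, that is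
`dlam(v, w) = ∑ (∂ᵢ lamⱼ - ∂ⱼ lamᵢ) vⁱ wʲ`, computed in the preferred chart at `x`, through which
Mathlib identifies `T_x M` with the model space. -/
def extDerivOneForm (lam : ∀ x : M, TangentSpace (𝓡 (2 * n + 1)) x →L[ℝ] ℝ) (x : M) :
    TangentSpace (𝓡 (2 * n + 1)) x →L[ℝ] TangentSpace (𝓡 (2 * n + 1)) x →L[ℝ] ℝ :=
  let D : EuclideanSpace ℝ (Fin (2 * n + 1)) →L[ℝ] EuclideanSpace ℝ (Fin (2 * n + 1)) →L[ℝ] ℝ :=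
    fderiv ℝ (oneFormInChart lam x) (extChartAt (𝓡 (2 * n + 1)) x x)
  D - D.flip

variable (n M) in
/-- A (smooth) contact form on the `(2n+1)`-manifold `M`: a smooth 1-form `lam`, nowhere zero, with
`dlam` nondegenerate on `ξ = ker lam`; equivalently `lam ∧ (dlam)ⁿ` vanishes nowhere. -/
structure ContactForm [IsManifold (𝓡 (2 * n + 1)) ∞ M] where
  form : ∀ x : M, TangentSpace (𝓡 (2 * n + 1)) x →L[ℝ] ℝ
  smooth : ContMDiff (𝓡 (2 * n + 1))
    ((𝓡 (2 * n + 1)).prod 𝓘(ℝ, EuclideanSpace ℝ (Fin (2 * n + 1)) →L[ℝ] ℝ)) ∞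
    (fun x => Bundle.TotalSpace.mk' (EuclideanSpace ℝ (Fin (2 * n + 1)) →L[ℝ] ℝ)
      (E := fun x : M => TangentSpace (𝓡 (2 * n + 1)) x →L[ℝ] Bundle.Trivial M ℝ x) x (form x))
  ne_zero : ∀ x, form x ≠ 0
  nondegenerate : ∀ (x : M) (v : TangentSpace (𝓡 (2 * n + 1)) x), form x v = 0 →
    (∀ w : TangentSpace (𝓡 (2 * n + 1)) x, form x w = 0 → extDerivOneForm form x v w = 0) → v = 0

variable [IsManifold (𝓡 (2 * n + 1)) ∞ M]

namespace ContactForm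

variable (C : ContactForm n M)

/-- The 2-form `dlam`. -/
def d (x : M) :
    TangentSpace (𝓡 (2 * n + 1)) x →L[ℝ] TangentSpace (𝓡 (2 * n + 1)) x →L[ℝ] ℝ :=
  extDerivOneForm C.form x

/-- The contact hyperplane `ξ_x = ker lam_x`. -/
def xi (x : M) : Submodule ℝ (TangentSpace (𝓡 (2 * n + 1)) x) :=
  LinearMap.ker (C.form x : TangentSpace (𝓡 (2 * n + 1)) x →ₗ[ℝ] ℝ)

/-- The Reeb vector field: the unique `X` with `lam(X) = 1` and `dlam(X, ·) = 0`. -/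
def reeb (x : M) : TangentSpace (𝓡 (2 * n + 1)) x :=
  Classical.epsilon fun X => C.form x X = 1 ∧ ∀ w, C.d x X w = 0

open Classical in
/-- The Reeb flow `φᵗ(x)`: the value at time `t` of the integral curve of the Reeb vector field
that starts at `x`. (If that curve does not live until time `t`, the value is irrelevant; the set
of `x` for which it does is open.) -/
def reebFlow (t : ℝ) (x : M) : M :=
  if h : ∃ c : ℝ → M, c 0 = x ∧
      ∃ ε > 0, IsMIntegralCurveOn (I := 𝓡 (2 * n + 1)) c C.reeb
        (Ioo (min 0 t - ε) (max 0 t + ε)) then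
    h.choose t
  else x

end ContactForm

/-! ## Lagrangian subspaces of the contact distribution -/

variable (n M) in
/-- Points of `M` together with a linear subspace of the tangent space at that point. -/
abbrev TangentSubspace := Σ x : M, Submodule ℝ (TangentSpace (𝓡 (2 * n + 1)) x)

/-- `(x, L)` belongs to the Lagrangian Grassmannian bundle of `(ξ, dlam)`: `L ⊂ ξ_x` has
dimension `n` and `dlam` vanishes on it. -/
def IsLagrangian (C : ContactForm n M) (A : TangentSubspace n M) : Prop :=
  Module.finrank ℝ A.2 = n ∧ A.2 ≤ C.xi A.1 ∧ ∀ v ∈ A.2, ∀ w ∈ A.2, C.d A.1 v w = 0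

/-- `e` is a basis of the subspace `A.2` of `T_{A.1} M`. -/
def IsFrameOf (A : TangentSubspace n M) (e : Fin n → TangentBundle (𝓡 (2 * n + 1)) M) : Prop :=
  ∃ v : Fin n → TangentSpace (𝓡 (2 * n + 1)) A.1, (∀ j, e j = ⟨A.1, v j⟩) ∧
    LinearIndependent ℝ v ∧ Submodule.span ℝ (range v) = A.2

/-- `A` is, over the set `S`, a continuous section of the pull-back under `f` of the Lagrangian
Grassmannian bundle of `(ξ, dlam)`. Continuity in a Grassmannian bundle means that there are
continuous frames near every point. -/
def IsLagrangianSection (C : ContactForm n M) {X : Type*} [TopologicalSpace X] (S : Set X)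
    (f : X → M) (A : X → TangentSubspace n M) : Prop :=
  (∀ x ∈ S, (A x).1 = f x) ∧ (∀ x ∈ S, IsLagrangian C (A x)) ∧
    ∀ x ∈ S, ∃ U ∈ 𝓝[S] x, ∃ e : X → Fin n → TangentBundle (𝓡 (2 * n + 1)) M,
      ContinuousOn e U ∧ ∀ y ∈ U, IsFrameOf (A y) (e y)

/-! ## The Maslov index -/

/-- A symplectic trivialization of the bundle `(w^*ξ, dlam)` over the planar set `D`, given by
continuous sections `p₁, …, pₙ, q₁, …, qₙ` forming a symplectic basis at every point; it identifies
`∑ xᵢ pᵢ + yᵢ qᵢ` with the point `x + i y` of `ℂⁿ = ℝ²ⁿ` with `ω₀ = ∑ dxᵢ ∧ dyᵢ`. -/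
structure SymplecticFrame (C : ContactForm n M) (D : Set (ℝ × ℝ)) (w : ℝ × ℝ → M) where
  p : ∀ z, Fin n → TangentSpace (𝓡 (2 * n + 1)) (w z)
  q : ∀ z, Fin n → TangentSpace (𝓡 (2 * n + 1)) (w z)
  continuousOn_p : ∀ i,
    ContinuousOn (fun z => (⟨w z, p z i⟩ : TangentBundle (𝓡 (2 * n + 1)) M)) D
  continuousOn_q : ∀ i,
    ContinuousOn (fun z => (⟨w z, q z i⟩ : TangentBundle (𝓡 (2 * n + 1)) M)) D
  p_mem : ∀ z ∈ D, ∀ i, p z i ∈ C.xi (w z)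
  q_mem : ∀ z ∈ D, ∀ i, q z i ∈ C.xi (w z)
  d_p_p : ∀ z ∈ D, ∀ i j, C.d (w z) (p z i) (p z j) = 0
  d_q_q : ∀ z ∈ D, ∀ i j, C.d (w z) (q z i) (q z j) = 0
  d_p_q : ∀ z ∈ D, ∀ i j, C.d (w z) (p z i) (q z j) = if i = j then 1 else 0

/-- In the trivialization `F`, the subspace `A ⊂ ξ_{w z}` becomes a subspace of `ℂⁿ` spanned over
`ℝ` by the columns of a matrix `Z`, and `ζ = det(Z)² / |det(Z)|²`. For Lagrangian `A` this is the
classical map `det² : Lag(n) = U(n)/O(n) → S¹`; it does not depend on the basis chosen. -/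
def SymplecticFrame.IsPhase {C : ContactForm n M} {D : Set (ℝ × ℝ)} {w : ℝ × ℝ → M}
    (F : SymplecticFrame C D w) (z : ℝ × ℝ) (A : TangentSubspace n M) (ζ : ℂ) : Prop :=
  ∃ v : Fin n → TangentSpace (𝓡 (2 * n + 1)) (w z), LinearIndependent ℝ v ∧
    A = ⟨w z, Submodule.span ℝ (range v)⟩ ∧
    ∃ Z : Matrix (Fin n) (Fin n) ℂ,
      (∀ i j, Z i j = (C.d (w z) (v j) (F.q z i) : ℂ) + (C.d (w z) (F.p z i) (v j) : ℂ) * Complex.I) ∧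
      ζ = Z.det ^ 2 / ((‖Z.det‖ ^ 2 : ℝ) : ℂ)

variable (n M) in
/-- A path in a planar domain together with a subspace of a tangent space of `M` at each time;
only times in `[0, 1]` matter. -/
structure Arc where
  base : ℝ → ℝ × ℝ
  sub : ℝ → TangentSubspace n M

/-- The same arc run backwards. -/
def Arc.rev (a : Arc n M) : Arc n M := ⟨fun s => a.base (1 - s), fun s => a.sub (1 - s)⟩

/-- `m` is the Maslov index of the symplectic bundle pair over `D` formed by `w^*ξ` and the
Lagrangian loop which is the concatenation of the given arcs: all arcs are continuous Lagrangian
paths in `w^*ξ`, and, in some symplectic trivialization over `D`, the map `det²` has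
degree `m` along the concatenated loop, the `j`-th arc being run over the time interval
`[j, j + 1]`. -/
def IsMaslovIndexOfLoop (C : ContactForm n M) (D : Set (ℝ × ℝ)) (w : ℝ × ℝ → M)
    (arcs : List (Arc n M)) (m : ℤ) : Prop :=
  (∀ a ∈ arcs, ContinuousOn a.base (Icc 0 1) ∧ MapsTo a.base (Icc 0 1) D ∧
    IsLagrangianSection C (Icc (0 : ℝ) 1) (fun s => w (a.base s)) a.sub) ∧
  ∃ F : SymplecticFrame C D w, ∃ θ : ℝ → ℝ,
    ContinuousOn θ (Icc 0 (arcs.length : ℝ)) ∧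
    (∀ j : Fin arcs.length, ∀ s ∈ Icc (0 : ℝ) 1,
      F.IsPhase ((arcs.get j).base s) ((arcs.get j).sub s)
        (Complex.exp (θ ((j : ℕ) + s) * Complex.I))) ∧
    θ arcs.length - θ 0 = 2 * Real.pi * m

/-! ## Legendrian links, bridges and Reeb chords -/

/-- A Legendrian submanifold: an embedded `n`-dimensional submanifold tangent to `ξ`. -/
structure LegendrianSubmanifold (C : ContactForm n M) where
  Carrier : Type u
  [top : TopologicalSpace Carrier]
  [charted : ChartedSpace (EuclideanSpace ℝ (Fin n)) Carrier]
  [manifold : IsManifold (𝓡 n) ∞ Carrier]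
  incl : Carrier → M
  embedding : Manifold.IsSmoothEmbedding (𝓡 n) (𝓡 (2 * n + 1)) ∞ incl
  tangent_xi : ∀ (p : Carrier) (v : TangentSpace (𝓡 n) p),
    mfderiv (𝓡 n) (𝓡 (2 * n + 1)) incl p v ∈ C.xi (incl p)

attribute [instance] LegendrianSubmanifold.top LegendrianSubmanifold.charted
  LegendrianSubmanifold.manifold

variable {C : ContactForm n M}

/-- The underlying subset of `M`. -/
def LegendrianSubmanifold.points (R : LegendrianSubmanifold C) : Set M := range R.incl

/-- The tangent space `T_x R ⊂ T_x M` of `R` at its point `x`. -/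
def LegendrianSubmanifold.tangentAt (R : LegendrianSubmanifold C) (x : M) :
    Submodule ℝ (TangentSpace (𝓡 (2 * n + 1)) x) :=
  Submodule.span ℝ {v | (⟨x, v⟩ : TangentBundle (𝓡 (2 * n + 1)) M) ∈
    range (tangentMap (𝓡 n) (𝓡 (2 * n + 1)) R.incl)}

/-- The point `(x, T_x R)`. -/
def LegendrianSubmanifold.gauss (R : LegendrianSubmanifold C) (x : M) : TangentSubspace n M :=
  ⟨x, R.tangentAt x⟩

/-- A graded bridge from `R` to `R'`: a path from `R` to `R'` together with a section `grading` of
the Lagrangian Grassmannian bundle along it which starts at the tangent space of `R` and ends at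
the tangent space of `R'`. -/
structure GradedBridge (R R' : LegendrianSubmanifold C) where
  path : ℝ → M
  continuousOn_path : ContinuousOn path (Icc 0 1)
  path_zero : path 0 ∈ R.points
  path_one : path 1 ∈ R'.points
  grading : ℝ → TangentSubspace n M
  isSection : IsLagrangianSection C (Icc (0 : ℝ) 1) path grading
  grading_zero : grading 0 = R.gauss (path 0)
  grading_one : grading 1 = R'.gauss (path 1)

/-- A graded bridged Legendrian link `(R₀, …, R_k)`. -/
structure GradedBridgedLink (C : ContactForm n M) (k : ℕ) where
  R : Fin (k + 1) → LegendrianSubmanifold C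
  bridge : ∀ i j, GradedBridge (R i) (R j)

/-- An iso-speed Reeb chord `(γ, T)` from `R` to `R'`: `γ' = T · Reeb(γ)` on `[0, 1]`. -/
structure ReebChord (R R' : LegendrianSubmanifold C) where
  path : ℝ → M
  period : ℝ
  isChord : IsMIntegralCurveOn (I := 𝓡 (2 * n + 1)) path (fun x => period • C.reeb x) (Icc 0 1)
  path_zero : path 0 ∈ R.points
  path_one : path 1 ∈ R'.points

namespace ReebChord

variable {R R' : LegendrianSubmanifold C}

/-- The path `t ↦ dφ^{Tt}(T_{γ(0)} R)`, a subspace of the tangent space at `γ(t) = φ^{Tt}(γ(0))`. -/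
def transport (γ : ReebChord R R') (t : ℝ) : TangentSubspace n M :=
  ⟨C.reebFlow (γ.period * t) (γ.path 0),
    (R.tangentAt (γ.path 0)).map
      (mfderiv (𝓡 (2 * n + 1)) (𝓡 (2 * n + 1)) (C.reebFlow (γ.period * t)) (γ.path 0) :
        TangentSpace (𝓡 (2 * n + 1)) (γ.path 0) →ₗ[ℝ] _)⟩

/-- Nondegeneracy: `dφ^T(T_{γ(0)} R)` and `T_{γ(1)} R'` are transversal in `ξ_{γ(1)}`. -/
def Nondegenerate (γ : ReebChord R R') : Prop :=
  ∃ V : Submodule ℝ (TangentSpace (𝓡 (2 * n + 1)) (γ.path 1)),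
    γ.transport 1 = ⟨γ.path 1, V⟩ ∧ V ⊔ R'.tangentAt (γ.path 1) = C.xi (γ.path 1)

/-- `a` is a Lagrangian path in `ξ_{γ(1)}` from `T_{γ(1)} R'` to `dφ^T(T_{γ(0)} R)` which is
transversal to `T_{γ(1)} R'` at all times `t > 0` and which departs from `T_{γ(1)} R'` in the
negative direction: its velocity at `t = 0`, that is the quadratic form
`v ↦ d/dt|₀ dlam(v, v(t))` on `T_{γ(1)} R'` (where `v(t) ∈ a(t)`, `v(0) = v`), is negative
definite. -/
structure IsCornerPath (γ : ReebChord R R')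
    (a : ℝ → Submodule ℝ (TangentSpace (𝓡 (2 * n + 1)) (γ.path 1))) : Prop where
  isSection : IsLagrangianSection C (Icc (0 : ℝ) 1) (fun _ => γ.path 1)
    (fun t => ⟨γ.path 1, a t⟩)
  start : a 0 = R'.tangentAt (γ.path 1)
  finish : (⟨γ.path 1, a 1⟩ : TangentSubspace n M) = γ.transport 1
  transversal : ∀ t ∈ Ioc (0 : ℝ) 1, a t ⊓ R'.tangentAt (γ.path 1) = ⊥
  directed : ∃ (e : ℝ → Fin n → TangentSpace (𝓡 (2 * n + 1)) (γ.path 1))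
      (f : Fin n → TangentSpace (𝓡 (2 * n + 1)) (γ.path 1)),
    (∀ᶠ t in 𝓝[≥] (0 : ℝ), LinearIndependent ℝ (e t) ∧ Submodule.span ℝ (range (e t)) = a t) ∧
    (∀ j, HasDerivWithinAt (fun t => e t j) (f j) (Ici 0) 0) ∧
    ∀ c : Fin n → ℝ, c ≠ 0 → C.d (γ.path 1) (∑ j, c j • e 0 j) (∑ j, c j • f j) < 0

end ReebChord

/-! ## Bounding squares -/

/-- The unit square. -/
def unitSquare : Set (ℝ × ℝ) := Icc 0 1 ×ˢ Icc 0 1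

/-- A bounding square of the chord `γ` relative to the bridge `ℓ`. Only its values on
`[0, 1]²` matter. -/
structure BoundingSquare {R R' : LegendrianSubmanifold C} (ℓ : GradedBridge R R')
    (γ : ReebChord R R') where
  map : ℝ × ℝ → M
  continuousOn_map : ContinuousOn map unitSquare
  left : ∀ t ∈ Icc (0 : ℝ) 1, map (0, t) = ℓ.path t
  right : ∀ t ∈ Icc (0 : ℝ) 1, map (1, t) = γ.path t
  bottom : ∀ τ ∈ Icc (0 : ℝ) 1, map (τ, 0) ∈ R.points
  top : ∀ τ ∈ Icc (0 : ℝ) 1, map (τ, 1) ∈ R'.points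

section Square

variable {R R' : LegendrianSubmanifold C} {ℓ : GradedBridge R R'} {γ : ReebChord R R'}

/-- Homotopy through bounding squares. -/
def BoundingSquare.Homotopic (w w' : BoundingSquare ℓ γ) : Prop :=
  ∃ K : ℝ × (ℝ × ℝ) → M, ContinuousOn K (Icc 0 1 ×ˢ unitSquare) ∧
    (∀ z ∈ unitSquare, K (0, z) = w.map z) ∧ (∀ z ∈ unitSquare, K (1, z) = w'.map z) ∧
    ∀ r ∈ Icc (0 : ℝ) 1, ∃ v : BoundingSquare ℓ γ, ∀ z ∈ unitSquare, K (r, z) = v.map z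

variable (ℓ γ) in
/-- The set of homotopy classes `[γ, w]` of bounding squares. -/
def SquareClass : Type u := Quot (BoundingSquare.Homotopic (ℓ := ℓ) (γ := γ))

/-- The Lagrangian loop along the boundary of the square, run counterclockwise: the bridge
backwards with its grading, the tangent spaces of `R` along the bottom, the transported tangent
spaces along the chord, the corner path backwards (at the corner `(1, 1)`), and the tangent spaces
of `R'` along the top, backwards. -/
def BoundingSquare.loop (w : BoundingSquare ℓ γ)
    (a : ℝ → Submodule ℝ (TangentSpace (𝓡 (2 * n + 1)) (γ.path 1))) : List (Arc n M) :=
  [ Arc.rev ⟨fun t => (0, t), fun t => ℓ.grading t⟩,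
    ⟨fun τ => (τ, 0), fun τ => R.gauss (w.map (τ, 0))⟩,
    ⟨fun t => (1, t), fun t => γ.transport t⟩,
    Arc.rev ⟨fun _ => (1, 1), fun t => ⟨γ.path 1, a t⟩⟩,
    Arc.rev ⟨fun τ => (τ, 1), fun τ => R'.gauss (w.map (τ, 1))⟩ ]

/-- `m` is the Maslov index of the class `[γ, w]`. -/
def SquareClass.IsMaslovIndex (c : SquareClass ℓ γ) (m : ℤ) : Prop :=
  ∃ w : BoundingSquare ℓ γ, Quot.mk _ w = c ∧
    ∃ a, γ.IsCornerPath a ∧ IsMaslovIndexOfLoop C unitSquare w.map (w.loop a) m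

end Square

/-! ## Polygons -/

/-- The disc with `k + 1` boundary punctures, each compactified by an interval, is a
`(2k + 2)`-gon. It is modelled on the rectangle `[0, 1] × [0, 2k - 1]`. Its right side is the
interval at the outgoing puncture, and its left side is subdivided into `2k - 1` unit intervals:
`[2i, 2i + 1]` is the interval at the `i`-th incoming puncture, and between them
`[2i - 1, 2i]`, `0 < i < k`, is the boundary edge mapped to `R_i`. The bottom and the top are the
boundary edges mapped to `R_0` and `R_k`. -/
def polygonDomain (k : ℕ) : Set (ℝ × ℝ) := Icc 0 1 ×ˢ Icc 0 (2 * (k : ℝ) - 1)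

/-- An (off-shell) polygon with boundary on the link and asymptotic to the incoming chords `γ i`
and the outgoing chord `γ₀`, compactified. -/
structure Polygon {k : ℕ} (R : Fin (k + 1) → LegendrianSubmanifold C)
    (γ : ∀ i : Fin k, ReebChord (R i.castSucc) (R i.succ))
    (γ₀ : ReebChord (R 0) (R (Fin.last k))) where
  map : ℝ × ℝ → M
  continuousOn_map : ContinuousOn map (polygonDomain k)
  bottom : ∀ τ ∈ Icc (0 : ℝ) 1, map (τ, 0) ∈ (R 0).points
  top : ∀ τ ∈ Icc (0 : ℝ) 1, map (τ, 2 * (k : ℝ) - 1) ∈ (R (Fin.last k)).points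
  right : ∀ s ∈ Icc (0 : ℝ) 1, map (1, (2 * (k : ℝ) - 1) * s) = γ₀.path s
  left_chord : ∀ i : Fin k, ∀ s ∈ Icc (0 : ℝ) 1,
    map (0, 2 * ((i : ℕ) : ℝ) + s) = (γ i).path s
  left_edge : ∀ i : Fin k, 0 < (i : ℕ) → ∀ s ∈ Icc (0 : ℝ) 1,
    map (0, 2 * ((i : ℕ) : ℝ) - 1 + s) ∈ (R i.castSucc).points

section Poly

variable {k : ℕ} {R : Fin (k + 1) → LegendrianSubmanifold C}
  {γ : ∀ i : Fin k, ReebChord (R i.castSucc) (R i.succ)}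
  {γ₀ : ReebChord (R 0) (R (Fin.last k))}

/-- Homotopy through polygons. -/
def Polygon.Homotopic (u u' : Polygon R γ γ₀) : Prop :=
  ∃ K : ℝ × (ℝ × ℝ) → M, ContinuousOn K (Icc 0 1 ×ˢ polygonDomain k) ∧
    (∀ z ∈ polygonDomain k, K (0, z) = u.map z) ∧
    (∀ z ∈ polygonDomain k, K (1, z) = u'.map z) ∧
    ∀ r ∈ Icc (0 : ℝ) 1, ∃ v : Polygon R γ γ₀, ∀ z ∈ polygonDomain k, K (r, z) = v.map z

variable (R γ γ₀) in
/-- The set of homotopy classes of polygons. -/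
def PolygonClass : Type u := Quot (Polygon.Homotopic (R := R) (γ := γ) (γ₀ := γ₀))

/-- The Lagrangian loop along the boundary of the polygon, run counterclockwise: the tangent
spaces of `R_0` along the bottom; at the outgoing chord, the transported tangent spaces along the
chord and then the corner path backwards; the tangent spaces of `R_k` along the top, backwards;
then down the left side, for `i = k - 1, …, 0`: at the chord `γ i`, the corner path forwards and
the transported tangent spaces along the chord backwards, and, if `i > 0`, the tangent spaces of
`R_i` along the next edge, backwards. -/
def Polygon.loop (u : Polygon R γ γ₀)
    (a : ∀ i, ℝ → Submodule ℝ (TangentSpace (𝓡 (2 * n + 1)) ((γ i).path 1)))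
    (a₀ : ℝ → Submodule ℝ (TangentSpace (𝓡 (2 * n + 1)) (γ₀.path 1))) : List (Arc n M) :=
  [ ⟨fun τ => (τ, 0), fun τ => (R 0).gauss (u.map (τ, 0))⟩,
    ⟨fun s => (1, (2 * (k : ℝ) - 1) * s), fun s => γ₀.transport s⟩,
    Arc.rev ⟨fun _ => (1, 2 * (k : ℝ) - 1), fun s => ⟨γ₀.path 1, a₀ s⟩⟩,
    Arc.rev ⟨fun τ => (τ, 2 * (k : ℝ) - 1),
      fun τ => (R (Fin.last k)).gauss (u.map (τ, 2 * (k : ℝ) - 1))⟩ ] ++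
  (List.ofFn fun i : Fin k =>
    [ (⟨fun _ => (0, 2 * ((i : ℕ) : ℝ) + 1), fun s => ⟨(γ i).path 1, a i s⟩⟩ : Arc n M),
      Arc.rev ⟨fun s => (0, 2 * ((i : ℕ) : ℝ) + s), fun s => (γ i).transport s⟩ ] ++
    if 0 < (i : ℕ) then
      [ Arc.rev ⟨fun s => (0, 2 * ((i : ℕ) : ℝ) - 1 + s),
          fun s => (R i.castSucc).gauss (u.map (0, 2 * ((i : ℕ) : ℝ) - 1 + s))⟩ ]
    else []).reverse.flatten

/-- `m` is the polygonal Maslov index of the class `B`. -/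
def PolygonClass.IsMaslovIndex (B : PolygonClass R γ γ₀) (m : ℤ) : Prop :=
  ∃ u : Polygon R γ γ₀, Quot.mk _ u = B ∧
    ∃ (a : ∀ i, ℝ → Submodule ℝ (TangentSpace (𝓡 (2 * n + 1)) ((γ i).path 1)))
      (a₀ : ℝ → Submodule ℝ (TangentSpace (𝓡 (2 * n + 1)) (γ₀.path 1))),
      (∀ i, (γ i).IsCornerPath (a i)) ∧ γ₀.IsCornerPath a₀ ∧
      IsMaslovIndexOfLoop C (polygonDomain k) u.map (u.loop a a₀) m

end Poly

/-! ## Gluing -/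

/-- `V` attaches the squares `w i` to the left side of the polygon `u`: on
`[0, 1] × [2i, 2i + 1]` it is the square `w i`, which is glued to `u` along the chord `γ i`,
and on `[0, 1] × [2i - 1, 2i]` it is a map into `R_i`. The left side of `V` is then the
concatenation `ℓ_{01} # c_1 # ℓ_{12} # ⋯ # c_{k-1} # ℓ_{(k-1)k}` of the bridges with paths `c_i`
in `R_i`, where `c_i` is homotopic in `R_i`, rel end points, to the path running along the top of
`w (i - 1)`, the edge of `u` on `R_i` and (backwards) the bottom of `w i`. -/
structure IsAttachment {k : ℕ} (E : GradedBridgedLink C k)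
    {γ : ∀ i : Fin k, ReebChord (E.R i.castSucc) (E.R i.succ)}
    {γ₀ : ReebChord (E.R 0) (E.R (Fin.last k))}
    (w : ∀ i : Fin k, BoundingSquare (E.bridge i.castSucc i.succ) (γ i))
    (u : Polygon E.R γ γ₀) (V : ℝ × ℝ → M) : Prop where
  continuousOn : ContinuousOn V (polygonDomain k)
  on_square : ∀ i : Fin k, ∀ σ ∈ Icc (0 : ℝ) 1, ∀ s ∈ Icc (0 : ℝ) 1,
    V (σ, 2 * ((i : ℕ) : ℝ) + s) = (w i).map (σ, s)
  on_edge : ∀ i : Fin k, 0 < (i : ℕ) → ∀ σ ∈ Icc (0 : ℝ) 1, ∀ s ∈ Icc (0 : ℝ) 1,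
    V (σ, 2 * ((i : ℕ) : ℝ) - 1 + s) ∈ (E.R i.castSucc).points
  right : ∀ t ∈ Icc (0 : ℝ) (2 * (k : ℝ) - 1), V (1, t) = u.map (0, t)

/-- `(H, A)` is a homotopy of graded paths from `R_0` to `R_k`, from the graded bridge `ℓ_{0k}`
of the link to the left side of `V`, graded by the gradings of the bridges `ℓ_{i(i+1)}` and by the
tangent spaces of the `R_i` along the paths `c_i`. -/
structure IsGradedHomotopy {k : ℕ} (E : GradedBridgedLink C k) (V : ℝ × ℝ → M)
    (H : ℝ × ℝ → M) (A : ℝ × ℝ → TangentSubspace n M) : Prop where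
  continuousOn : ContinuousOn H (polygonDomain k)
  isSection : IsLagrangianSection C (polygonDomain k) H A
  left : ∀ s ∈ Icc (0 : ℝ) 1,
    H (0, (2 * (k : ℝ) - 1) * s) = (E.bridge 0 (Fin.last k)).path s ∧
    A (0, (2 * (k : ℝ) - 1) * s) = (E.bridge 0 (Fin.last k)).grading s
  right : ∀ t ∈ Icc (0 : ℝ) (2 * (k : ℝ) - 1), H (1, t) = V (0, t)
  right_bridge : ∀ i : Fin k, ∀ s ∈ Icc (0 : ℝ) 1,
    A (1, 2 * ((i : ℕ) : ℝ) + s) = (E.bridge i.castSucc i.succ).grading s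
  right_edge : ∀ i : Fin k, 0 < (i : ℕ) → ∀ s ∈ Icc (0 : ℝ) 1,
    A (1, 2 * ((i : ℕ) : ℝ) - 1 + s) =
      (E.R i.castSucc).gauss (V (0, 2 * ((i : ℕ) : ℝ) - 1 + s))
  bottom : ∀ σ ∈ Icc (0 : ℝ) 1, H (σ, 0) ∈ (E.R 0).points ∧
    A (σ, 0) = (E.R 0).gauss (H (σ, 0))
  top : ∀ σ ∈ Icc (0 : ℝ) 1, H (σ, 2 * (k : ℝ) - 1) ∈ (E.R (Fin.last k)).points ∧
    A (σ, 2 * (k : ℝ) - 1) = (E.R (Fin.last k)).gauss (H (σ, 2 * (k : ℝ) - 1))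

/-- `c₀ = (c_0 # ⋯ # c_{k-1}) # B`: up to homotopy, the graded bridge `ℓ_{0k}` is the
concatenation of the graded bridges `ℓ_{i(i+1)}`, and `c₀` is the class of the square obtained by
putting next to each other, from left to right, such a homotopy, the squares (attached along the
chords `γ i`) and the polygon. -/
def IsGluing {k : ℕ} (E : GradedBridgedLink C k)
    {γ : ∀ i : Fin k, ReebChord (E.R i.castSucc) (E.R i.succ)}
    {γ₀ : ReebChord (E.R 0) (E.R (Fin.last k))}
    (c : ∀ i : Fin k, SquareClass (E.bridge i.castSucc i.succ) (γ i))
    (B : PolygonClass E.R γ γ₀)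
    (c₀ : SquareClass (E.bridge 0 (Fin.last k)) γ₀) : Prop :=
  ∃ (w : ∀ i : Fin k, BoundingSquare (E.bridge i.castSucc i.succ) (γ i)) (u : Polygon E.R γ γ₀)
    (g : BoundingSquare (E.bridge 0 (Fin.last k)) γ₀)
    (V H : ℝ × ℝ → M) (A : ℝ × ℝ → TangentSubspace n M),
    (∀ i, Quot.mk _ (w i) = c i) ∧ Quot.mk _ u = B ∧ Quot.mk _ g = c₀ ∧
    IsAttachment E w u V ∧ IsGradedHomotopy E V H A ∧
    ∀ σ ∈ Icc (0 : ℝ) 1, ∀ s ∈ Icc (0 : ℝ) 1,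
      g.map (σ / 3, s) = H (σ, (2 * (k : ℝ) - 1) * s) ∧
      g.map ((σ + 1) / 3, s) = V (σ, (2 * (k : ℝ) - 1) * s) ∧
      g.map ((σ + 2) / 3, s) = u.map (σ, (2 * (k : ℝ) - 1) * s)

end Contact

end ContactLink

end

open ContactLink

/-!
The Maslov index of a loop of Lagrangian subspaces over a square or polygon is, up to the factor
`2π`, the total variation of the argument of the phase `det²` along the loop, computed in a
symplectic frame of the pulled back contact distribution. The variation along a single arc depends
on the frame, and is not a multiple of `2π`, but it is additive under subdivision of the arc and
changes sign with the direction. So the formula is proved in two steps: the total variation is an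
invariant of the classes, and for the squares `w i`, the polygon `u` and the glued square it can be
computed in restrictions of one and the same frame, where it is additive.

*Frames.* Symplectic frames exist locally (`exists_isFrame_local`) and can be glued along closed
sets which retract onto their intersection (`HasFrame.union`), hence they exist over cubes and
rectangles (`hasFrame_unitCube`). The continuity of `dlam` on vector fields and the fact that the
tangent spaces of a Legendrian submanifold are Lagrangian subspaces which vary continuously come
from a computation in charts (`eventually_dForm_eq_chart`,
`LegendrianSubmanifold.isLagrangianSection_gauss`).

*Invariance.* In complex coordinates `z`, a change of frame has the form `z' = α z + β z̄`, where
`α α* - β β* = 1`. The functionals `α z + s β z̄` with `0 ≤ s ≤ 1` remain complex coordinates on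
every Lagrangian subspace, so the variation of the phase along an arc differs from that in the other
frame by the variation of the phase of `det α`, which has an argument over the whole rectangle, and
by a term at either end which depends only on the Lagrangian subspace there
(`exists_phaseVar_frameChange`). Along a homotopy of squares or polygons, only such terms at the
ends of the arcs occur as well (`exists_phaseVar_homotopy`), and around a loop they cancel. The
corner paths enter through their variations only, and all corner paths of a chord have the same one
(`ReebChord.IsCornerPath.argVar_eq`): in a symplectic basis adapted to its two ends, such a path
consists of graphs of symmetric matrices `B` with phase `det (B + i)²` up to a positive factor, it
ends at `B = 0`, and the negative direction at the start means that `B⁻¹` is negative definite and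
tends to zero. As symmetric matrices form a vector space, on which `det (B + i)` has no zero, this
determines the variation (`argVar_corner`).

*Additivity.* Fix a frame over the glued square (`phaseSum_glue`). The chords and corner paths of
the squares `w i` are run in opposite directions in the loops of `w i` and of the polygon, so their
contributions cancel. In the strips between the squares, the tangent spaces of `R_i` form a
Lagrangian section over a rectangle, and the total variation along the boundary of a rectangle
vanishes (`argVar_rectangle`). The same holds over the homotopy of graded paths. What remains is the
loop of the glued square.
-/

namespace ContactLink

universe u

/-! ### Variation of the argument of circle-valued functions -/

/-- A continuous function with values of modulus one on a set. -/
def CircleOn {X : Type*} [TopologicalSpace X] (ζ : X → ℂ) (S : Set X) : Prop :=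
  ContinuousOn ζ S ∧ ∀ x ∈ S, ‖ζ x‖ = 1

theorem CircleOn.comp {X Y : Type*} [TopologicalSpace X] [TopologicalSpace Y] {ζ : X → ℂ}
    {S : Set X} (h : CircleOn ζ S) {φ : Y → X} {T : Set Y} (hφ : ContinuousOn φ T)
    (hm : MapsTo φ T S) : CircleOn (fun y => ζ (φ y)) T :=
  ⟨h.1.comp hφ hm, fun _ hy => h.2 _ (hm hy)⟩

theorem CircleOn.mono {X : Type*} [TopologicalSpace X] {ζ : X → ℂ}
    {S T : Set X} (h : CircleOn ζ S) (hT : T ⊆ S) : CircleOn ζ T :=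
  ⟨h.1.mono hT, fun _ hy => h.2 _ (hT hy)⟩

/-- Logarithms exist on normed spaces, which are simply connected. -/
theorem exists_angle_of_continuous {E : Type*} [NormedAddCommGroup E] [NormedSpace ℝ E]
    {g : E → ℂ} (hg : Continuous g) (h0 : ∀ x, g x ≠ 0) :
    ∃ θ : E → ℝ, Continuous θ ∧ ∀ x, g x = ‖g x‖ * Complex.exp (θ x * Complex.I) := by
  obtain ⟨f, hf, hfg⟩ := Complex.exists_continuousOn_eqOn_exp_comp (U := (univ : Set E))
    (by
      have : ContractibleSpace (univ : Set E) := convex_univ.contractibleSpace ⟨0, mem_univ 0⟩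
      exact inferInstanceAs (SimplyConnectedSpace (univ : Set E)))
    isOpen_univ (continuousOn_univ.2 hg) (by rintro ⟨x, -, hx⟩; exact h0 x hx)
  refine ⟨fun x => (f x).im, Complex.continuous_im.comp (continuousOn_univ.1 hf), fun x => ?_⟩
  have h1 : Complex.exp (f x) = g x := hfg (mem_univ x)
  rw [← h1, Complex.norm_exp, Complex.ofReal_exp, ← Complex.exp_add, Complex.re_add_im]

theorem exists_angle_on_rectangle {a b c d : ℝ} (hab : a ≤ b) (hcd : c ≤ d) {ζ : ℝ × ℝ → ℂ}
    (h : CircleOn ζ (Icc a b ×ˢ Icc c d)) :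
    ∃ θ : ℝ × ℝ → ℝ, ContinuousOn θ (Icc a b ×ˢ Icc c d) ∧
      ∀ z ∈ Icc a b ×ˢ Icc c d, ζ z = Complex.exp (θ z * Complex.I) := by
  -- extend to the plane by clamping both coordinates
  let ρ : ℝ × ℝ → ℝ × ℝ := fun z => (projIcc a b hab z.1, projIcc c d hcd z.2)
  have hρ : Continuous ρ := by
    apply Continuous.prodMk
    · exact continuous_subtype_val.comp (continuous_projIcc.comp continuous_fst)
    · exact continuous_subtype_val.comp (continuous_projIcc.comp continuous_snd)
  have hm : ∀ z, ρ z ∈ Icc a b ×ˢ Icc c d := fun z => ⟨Subtype.prop _, Subtype.prop _⟩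
  have hid : ∀ z ∈ Icc a b ×ˢ Icc c d, ρ z = z := by
    rintro ⟨x, y⟩ ⟨hx, hy⟩
    simp only [ρ]
    rw [projIcc_of_mem hab hx, projIcc_of_mem hcd hy]
  have hc : Continuous (fun z => ζ (ρ z)) := h.1.comp_continuous hρ hm
  have h1 : ∀ z, ‖ζ (ρ z)‖ = 1 := fun z => h.2 _ (hm z)
  obtain ⟨θ, hθ, hz⟩ := exists_angle_of_continuous hc
    (fun z => norm_ne_zero_iff.1 (by rw [h1 z]; exact one_ne_zero))
  refine ⟨θ, hθ.continuousOn, fun z hz' => ?_⟩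
  have := hz z
  rwa [h1, Complex.ofReal_one, one_mul, hid z hz'] at this

/-- `θ` is a continuous argument of `ζ` on `[a, b]`. -/
def IsAngle (ζ : ℝ → ℂ) (a b : ℝ) (θ : ℝ → ℝ) : Prop :=
  ContinuousOn θ (Icc a b) ∧ ∀ s ∈ Icc a b, ζ s = Complex.exp (θ s * Complex.I)

theorem exists_isAngle {a b : ℝ} (hab : a ≤ b) {ζ : ℝ → ℂ} (h : CircleOn ζ (Icc a b)) :
    ∃ θ, IsAngle ζ a b θ := by
  obtain ⟨θ, hθ, hz⟩ := exists_angle_on_rectangle hab (le_refl (0 : ℝ))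
    (h.comp (φ := fun z : ℝ × ℝ => z.1) (T := Icc a b ×ˢ Icc (0 : ℝ) 0)
      continuous_fst.continuousOn (fun z hz => hz.1))
  refine ⟨fun s => θ (s, 0), hθ.comp (by fun_prop) (fun s hs => ⟨hs, by simp⟩), fun s hs => ?_⟩
  exact hz (s, 0) ⟨hs, by simp⟩

/-- A continuous real function on an interval whose values are multiples of `2π` is constant. -/
theorem eq_of_exp_eq_one {f : ℝ → ℝ} {a b : ℝ} (hab : a ≤ b) (hf : ContinuousOn f (Icc a b))
    (h : ∀ s ∈ Icc a b, Complex.exp (f s * Complex.I) = 1) : f a = f b := by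
  have hm : MapsTo f (Icc a b) (AddSubgroup.zmultiples (2 * Real.pi) : Set ℝ) := by
    intro s hs
    obtain ⟨m, hm⟩ := Complex.exp_eq_one_iff.1 (h s hs)
    refine ⟨m, ?_⟩
    have h2 : ((f s : ℝ) : ℂ) * Complex.I = ((m * (2 * Real.pi) : ℝ) : ℂ) * Complex.I := by
      rw [hm]; push_cast; ring
    have h3 := mul_right_cancel₀ Complex.I_ne_zero h2
    simpa using (Complex.ofReal_injective h3).symm
  exact (isPreconnected_Icc (a := a) (b := b)).constant_of_mapsTo
    (isDiscrete_iff_discreteTopology.mpr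
      (inferInstanceAs (DiscreteTopology (AddSubgroup.zmultiples (2 * Real.pi)))))
      hf hm (left_mem_Icc.2 hab)
    (right_mem_Icc.2 hab)

open Classical in
/-- The variation over `[a, b]` of a continuous argument of `ζ` (zero if there is none). -/
noncomputable def argVar (ζ : ℝ → ℂ) (a b : ℝ) : ℝ :=
  if h : ∃ θ, IsAngle ζ a b θ then h.choose b - h.choose a else 0

theorem IsAngle.argVar_eq {ζ : ℝ → ℂ} {a b : ℝ} {θ : ℝ → ℝ} (h : IsAngle ζ a b θ)
    (hab : a ≤ b) : argVar ζ a b = θ b - θ a := by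
  have hex : ∃ θ, IsAngle ζ a b θ := ⟨θ, h⟩
  rw [argVar, dif_pos hex]
  have h' := hex.choose_spec
  have := eq_of_exp_eq_one (f := fun s => hex.choose s - θ s) hab (h'.1.sub h.1) (fun s hs => by
    push_cast
    rw [sub_mul, Complex.exp_sub, ← h'.2 s hs, ← h.2 s hs, div_self]
    rw [h.2 s hs]
    exact Complex.exp_ne_zero _)
  linarith

theorem argVar_congr {ζ η : ℝ → ℂ} {a b : ℝ} (h : ∀ s ∈ Icc a b, ζ s = η s) :
    argVar ζ a b = argVar η a b := by
  have : ∀ θ, IsAngle ζ a b θ ↔ IsAngle η a b θ := fun θ =>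
    ⟨fun H => ⟨H.1, fun s hs => by rw [← h s hs, H.2 s hs]⟩,
      fun H => ⟨H.1, fun s hs => by rw [h s hs, H.2 s hs]⟩⟩
  have h2 : IsAngle ζ a b = IsAngle η a b := funext fun θ => propext (this θ)
  unfold argVar
  rw [h2]

theorem argVar_mul {ζ η : ℝ → ℂ} {a b : ℝ} (hab : a ≤ b) (h : CircleOn ζ (Icc a b))
    (h' : CircleOn η (Icc a b)) :
    argVar (fun s => ζ s * η s) a b = argVar ζ a b + argVar η a b := by
  obtain ⟨θ, hθ⟩ := exists_isAngle hab h
  obtain ⟨ψ, hψ⟩ := exists_isAngle hab h'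
  have : IsAngle (fun s => ζ s * η s) a b (fun s => θ s + ψ s) :=
    ⟨hθ.1.add hψ.1, fun s hs => by
      beta_reduce
      rw [hθ.2 s hs, hψ.2 s hs, ← Complex.exp_add]; push_cast; ring_nf⟩
  rw [this.argVar_eq hab, hθ.argVar_eq hab, hψ.argVar_eq hab]
  ring

theorem argVar_add {ζ : ℝ → ℂ} {a b c : ℝ} (hab : a ≤ b) (hbc : b ≤ c)
    (h : CircleOn ζ (Icc a c)) : argVar ζ a c = argVar ζ a b + argVar ζ b c := by
  obtain ⟨θ, hθ⟩ := exists_isAngle (hab.trans hbc) h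
  have h1 : IsAngle ζ a b θ := ⟨hθ.1.mono (Icc_subset_Icc_right hbc),
    fun s hs => hθ.2 s (Icc_subset_Icc_right hbc hs)⟩
  have h2 : IsAngle ζ b c θ := ⟨hθ.1.mono (Icc_subset_Icc_left hab),
    fun s hs => hθ.2 s (Icc_subset_Icc_left hab hs)⟩
  rw [hθ.argVar_eq (hab.trans hbc), h1.argVar_eq hab, h2.argVar_eq hbc]
  ring

theorem argVar_comp_affine {ζ : ℝ → ℂ} {a b c d : ℝ} (hab : a ≤ b) (hc : 0 ≤ c)
    (h : CircleOn ζ (Icc (c * a + d) (c * b + d))) :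
    argVar (fun s => ζ (c * s + d)) a b = argVar ζ (c * a + d) (c * b + d) := by
  have hle : c * a + d ≤ c * b + d := by gcongr
  obtain ⟨θ, hθ⟩ := exists_isAngle hle h
  have hm : MapsTo (fun s => c * s + d) (Icc a b) (Icc (c * a + d) (c * b + d)) :=
    fun s hs => ⟨by beta_reduce; gcongr; exact hs.1, by beta_reduce; gcongr; exact hs.2⟩
  have h1 : IsAngle (fun s => ζ (c * s + d)) a b (fun s => θ (c * s + d)) :=
    ⟨hθ.1.comp (by fun_prop) hm, fun s hs => hθ.2 _ (hm hs)⟩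
  rw [h1.argVar_eq hab, hθ.argVar_eq hle]

theorem argVar_rev {ζ : ℝ → ℂ} (h : CircleOn ζ (Icc 0 1)) :
    argVar (fun s => ζ (1 - s)) 0 1 = - argVar ζ 0 1 := by
  obtain ⟨θ, hθ⟩ := exists_isAngle zero_le_one h
  have hm : MapsTo (fun s : ℝ => 1 - s) (Icc 0 1) (Icc 0 1) :=
    fun s hs => ⟨by linarith [hs.2], by linarith [hs.1]⟩
  have h1 : IsAngle (fun s => ζ (1 - s)) 0 1 (fun s => θ (1 - s)) :=
    ⟨hθ.1.comp (by fun_prop) hm, fun s hs => hθ.2 _ (hm hs)⟩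
  rw [h1.argVar_eq zero_le_one, hθ.argVar_eq zero_le_one]
  simp

/-- The variation of the argument along the boundary of a rectangle vanishes. -/
theorem argVar_rectangle {a b c d : ℝ} (hab : a ≤ b) (hcd : c ≤ d) {ζ : ℝ × ℝ → ℂ}
    (h : CircleOn ζ (Icc a b ×ˢ Icc c d)) :
    argVar (fun σ => ζ (σ, c)) a b + argVar (fun t => ζ (b, t)) c d =
      argVar (fun t => ζ (a, t)) c d + argVar (fun σ => ζ (σ, d)) a b := by
  obtain ⟨θ, hθ, hz⟩ := exists_angle_on_rectangle hab hcd h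
  have h1 : ∀ t ∈ Icc c d, IsAngle (fun σ => ζ (σ, t)) a b (fun σ => θ (σ, t)) := fun t ht =>
    ⟨hθ.comp (by fun_prop) (fun σ hσ => ⟨hσ, ht⟩), fun σ hσ => hz _ ⟨hσ, ht⟩⟩
  have h2 : ∀ σ ∈ Icc a b, IsAngle (fun t => ζ (σ, t)) c d (fun t => θ (σ, t)) := fun σ hσ =>
    ⟨hθ.comp (by fun_prop) (fun t ht => ⟨hσ, ht⟩), fun t ht => hz _ ⟨hσ, ht⟩⟩
  rw [(h1 c (left_mem_Icc.2 hcd)).argVar_eq hab, (h1 d (right_mem_Icc.2 hcd)).argVar_eq hab,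
    (h2 a (left_mem_Icc.2 hab)).argVar_eq hcd, (h2 b (right_mem_Icc.2 hab)).argVar_eq hcd]
  ring

/-! ### Symplectic linear algebra and the phase of a Lagrangian subspace -/

section LinearAlgebra

variable {V : Type*} [AddCommGroup V] [Module ℝ V] {n : ℕ}

/-- `Ω` restricts to a symplectic form on the `2n`-dimensional subspace `W`. -/
structure IsSymplecticOn (n : ℕ) (Ω : V →ₗ[ℝ] V →ₗ[ℝ] ℝ) (W : Submodule ℝ V) : Prop where
  skew : ∀ v w, Ω v w = -Ω w v
  finrank_eq : Module.finrank ℝ W = 2 * n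
  nondegenerate : ∀ v ∈ W, (∀ w ∈ W, Ω v w = 0) → v = 0

/-- `p, q` is a symplectic basis of a subspace `W` of dimension twice their number. -/
structure IsSymplecticBasis {m : ℕ} (Ω : V →ₗ[ℝ] V →ₗ[ℝ] ℝ) (W : Submodule ℝ V)
    (p q : Fin m → V) : Prop where
  p_mem : ∀ i, p i ∈ W
  q_mem : ∀ i, q i ∈ W
  p_p : ∀ i j, Ω (p i) (p j) = 0
  q_q : ∀ i j, Ω (q i) (q j) = 0
  p_q : ∀ i j, Ω (p i) (q j) = if i = j then 1 else 0

/-- A basis of the subspace `L`, indexed by `Fin n`. -/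
def IsBasisOf (v : Fin n → V) (L : Submodule ℝ V) : Prop :=
  LinearIndependent ℝ v ∧ Submodule.span ℝ (range v) = L

/-- Lagrangian subspaces of `(W, Ω)`. -/
structure IsLagrangianIn (n : ℕ) (Ω : V →ₗ[ℝ] V →ₗ[ℝ] ℝ) (W L : Submodule ℝ V) : Prop where
  finrank_eq : Module.finrank ℝ L = n
  le : L ≤ W
  isotropic : ∀ v ∈ L, ∀ w ∈ L, Ω v w = 0

variable {Ω : V →ₗ[ℝ] V →ₗ[ℝ] ℝ} {W L : Submodule ℝ V} {p q : Fin n → V}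

theorem IsBasisOf.mem {v : Fin n → V} (hv : IsBasisOf v L) (i : Fin n) : v i ∈ L := by
  rw [← hv.2]; exact Submodule.subset_span (mem_range_self i)

theorem IsLagrangianIn.exists_basis [FiniteDimensional ℝ V] (hL : IsLagrangianIn n Ω W L) :
    ∃ v : Fin n → V, IsBasisOf v L := by
  let b := Module.finBasisOfFinrankEq ℝ L hL.finrank_eq
  refine ⟨fun i => b i, b.linearIndependent.map' L.subtype (Submodule.ker_subtype L), ?_⟩
  have : range (fun i => (b i : V)) = L.subtype '' range b := by
    rw [← range_comp]; rfl
  rw [this, Submodule.span_image, b.span_eq, Submodule.map_top, Submodule.range_subtype]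

theorem IsSymplecticBasis.linearIndependent {m : ℕ} {p q : Fin m → V}
    (h : IsSymplecticBasis Ω W p q) :
    LinearIndependent ℝ (Sum.elim p q) := by
  rw [Fintype.linearIndependent_iff]
  intro g hg
  rw [Fintype.sum_sum_type] at hg
  simp only [Sum.elim_inl, Sum.elim_inr] at hg
  have hq : ∀ j, g (Sum.inl j) = 0 := fun j => by
    have := congrArg (fun v => Ω v (q j)) hg
    simpa [h.p_q, h.q_q] using this
  have hp : ∀ j, g (Sum.inr j) = 0 := fun j => by
    have := congrArg (fun v => Ω (p j) v) hg
    simpa [h.p_q, h.p_p] using this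
  rintro (j | j)
  exacts [hq j, hp j]

theorem IsSymplecticBasis.expand [FiniteDimensional ℝ V] (hΩ : IsSymplecticOn n Ω W)
    (h : IsSymplecticBasis Ω W p q) {v : V} (hv : v ∈ W) :
    v = ∑ i, (Ω v (q i) • p i + Ω (p i) v • q i) := by
  have hli := h.linearIndependent
  have hle : Submodule.span ℝ (range (Sum.elim p q)) ≤ W := by
    rw [Submodule.span_le]
    rintro _ ⟨i | i, rfl⟩
    exacts [h.p_mem i, h.q_mem i]
  have hspan : Submodule.span ℝ (range (Sum.elim p q)) = W := by
    apply Submodule.eq_of_le_of_finrank_eq hle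
    rw [finrank_span_eq_card hli, hΩ.finrank_eq]
    simp [two_mul]
  rw [← hspan] at hv
  induction hv using Submodule.span_induction with
  | mem x hx =>
    obtain ⟨i | i, rfl⟩ := hx
    · simp [h.p_q, h.p_p]
    · simp [h.p_q, h.q_q]
  | zero => simp
  | add x y _ _ hx hy =>
    conv_lhs => rw [hx, hy]
    rw [← Finset.sum_add_distrib]
    refine Finset.sum_congr rfl fun i _ => ?_
    simp only [map_add, LinearMap.add_apply, add_smul]
    abel
  | smul a x _ hx =>
    conv_lhs => rw [hx]
    rw [Finset.smul_sum]
    refine Finset.sum_congr rfl fun i _ => ?_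
    simp only [map_smul, LinearMap.smul_apply, smul_add, smul_smul, smul_eq_mul]

theorem IsSymplecticBasis.form_eq [FiniteDimensional ℝ V] (hΩ : IsSymplecticOn n Ω W)
    (h : IsSymplecticBasis Ω W p q) {v w : V} (hv : v ∈ W) :
    Ω v w = ∑ j, (Ω (p j) v * Ω (q j) w - Ω (q j) v * Ω (p j) w) := by
  conv_lhs => rw [h.expand hΩ hv]
  simp only [map_sum, map_add, LinearMap.sum_apply, LinearMap.add_apply, map_smul,
    LinearMap.smul_apply, smul_eq_mul]
  refine Finset.sum_congr rfl fun j _ => ?_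
  rw [hΩ.skew v (q j)]
  ring

/-- The complex coordinates `z_i = x_i + i y_i` with respect to a symplectic basis. -/
noncomputable def complexCoord (Ω : V →ₗ[ℝ] V →ₗ[ℝ] ℝ) (p q : Fin n → V) (i : Fin n) : V →ₗ[ℝ] ℂ :=
  Complex.ofRealCLM.toLinearMap ∘ₗ (Ω.flip (q i)) +
    (LinearMap.toSpanSingleton ℝ ℂ Complex.I) ∘ₗ (Ω (p i))

theorem complexCoord_apply (i : Fin n) (v : V) :
    complexCoord Ω p q i v = (Ω v (q i) : ℂ) + (Ω (p i) v : ℂ) * Complex.I := by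
  simp [complexCoord, LinearMap.toSpanSingleton_apply]

/-- The matrix whose columns are the values of the functionals `Φ` on the vectors `v`. -/
noncomputable def valueMatrix (Φ : Fin n → V →ₗ[ℝ] ℂ) (v : Fin n → V) : Matrix (Fin n) (Fin n) ℂ :=
  Matrix.of fun i j => Φ i (v j)

/-- `d² / |d|²`. -/
noncomputable def sqPhase (d : ℂ) : ℂ := d ^ 2 / ((‖d‖ ^ 2 : ℝ) : ℂ)

theorem norm_sqPhase {d : ℂ} (hd : d ≠ 0) : ‖sqPhase d‖ = 1 := by
  have : ‖d‖ ≠ 0 := norm_ne_zero_iff.2 hd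
  rw [sqPhase, norm_div, norm_pow, Complex.norm_real, norm_pow, norm_norm, div_self]
  positivity

theorem sqPhase_mul (d e : ℂ) : sqPhase (d * e) = sqPhase d * sqPhase e := by
  simp only [sqPhase, norm_mul, mul_pow, Complex.ofReal_mul]
  rw [mul_div_mul_comm]

theorem sqPhase_real {r : ℝ} (hr : r ≠ 0) : sqPhase (r : ℂ) = 1 := by
  rw [sqPhase, Complex.norm_real, Real.norm_eq_abs, sq_abs]
  push_cast
  exact div_self (by simpa using hr)

theorem continuousAt_sqPhase {d : ℂ} (hd : d ≠ 0) : ContinuousAt sqPhase d := by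
  have : ((‖d‖ ^ 2 : ℝ) : ℂ) ≠ 0 := by
    simpa using hd
  unfold sqPhase
  exact ContinuousAt.div (by fun_prop) (by fun_prop) this

theorem IsBasisOf.exists_matrix {v v' : Fin n → V} (hv : IsBasisOf v L) (hv' : IsBasisOf v' L) :
    ∃ g : Matrix (Fin n) (Fin n) ℝ, g.det ≠ 0 ∧ v = fun j => ∑ i, g i j • v' i := by
  let b : Module.Basis (Fin n) ℝ L := (Module.Basis.span hv.1).map (LinearEquiv.ofEq _ _ hv.2)
  let b' : Module.Basis (Fin n) ℝ L := (Module.Basis.span hv'.1).map (LinearEquiv.ofEq _ _ hv'.2)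
  have hb : ∀ i, ((b i : L) : V) = v i := fun i => by
    simp only [b, Module.Basis.map_apply, LinearEquiv.coe_ofEq_apply]
    exact congrArg Subtype.val (Module.Basis.span_apply hv.1 i)
  have hb' : ∀ i, ((b' i : L) : V) = v' i := fun i => by
    simp only [b', Module.Basis.map_apply, LinearEquiv.coe_ofEq_apply]
    exact congrArg Subtype.val (Module.Basis.span_apply hv'.1 i)
  refine ⟨b'.toMatrix b, fun h0 => ?_, ?_⟩
  · have := congrArg Matrix.det (b'.toMatrix_mul_toMatrix_flip b)
    rw [Matrix.det_mul, h0, zero_mul, Matrix.det_one] at this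
    exact zero_ne_one this
  · funext j
    rw [← hb j, ← b'.sum_toMatrix_smul_self b j]
    push_cast
    simp only [hb']

/-- Changing the basis of a real subspace multiplies the determinant by a real number. -/
theorem sqPhase_det_valueMatrix_congr (Φ : Fin n → V →ₗ[ℝ] ℂ) {v v' : Fin n → V}
    (hv : IsBasisOf v L) (hv' : IsBasisOf v' L) :
    sqPhase (valueMatrix Φ v).det = sqPhase (valueMatrix Φ v').det := by
  obtain ⟨g, hg0, hg⟩ := hv.exists_matrix hv'
  have hmul : valueMatrix Φ v = valueMatrix Φ v' * g.map (algebraMap ℝ ℂ) := by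
    ext i j
    conv_lhs => rw [hg]
    simp only [valueMatrix, Matrix.of_apply, map_sum, map_smul, Matrix.mul_apply, Matrix.map_apply,
      Complex.real_smul]
    exact Finset.sum_congr rfl fun _ _ => mul_comm _ _
  have hdet : (g.map (algebraMap ℝ ℂ)).det = ((g.det : ℝ) : ℂ) := by
    rw [← RingHom.mapMatrix_apply, ← RingHom.map_det]; rfl
  rw [hmul, Matrix.det_mul, hdet, sqPhase_mul, sqPhase_real hg0, mul_one]

open Classical in
/-- The squared phase of the determinant of the functionals `Φ` on a basis of `L`. It does not
depend on the basis. -/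
noncomputable def phaseOf (Φ : Fin n → V →ₗ[ℝ] ℂ) (L : Submodule ℝ V) : ℂ :=
  if h : ∃ v : Fin n → V, IsBasisOf v L then sqPhase (valueMatrix Φ h.choose).det else 1

theorem IsBasisOf.phaseOf_eq {v : Fin n → V} (hv : IsBasisOf v L) (Φ : Fin n → V →ₗ[ℝ] ℂ) :
    phaseOf Φ L = sqPhase (valueMatrix Φ v).det := by
  have h : ∃ v : Fin n → V, IsBasisOf v L := ⟨v, hv⟩
  rw [phaseOf, dif_pos h]
  exact sqPhase_det_valueMatrix_congr Φ h.choose_spec hv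

/-- The imaginary part of the Hermitian product in complex coordinates is the symplectic form. -/
theorem im_hermitian [FiniteDimensional ℝ V] (hΩ : IsSymplecticOn n Ω W)
    (h : IsSymplecticBasis Ω W p q) {v w : V} (hv : v ∈ W) :
    (∑ i, (starRingEnd ℂ) (complexCoord Ω p q i v) * complexCoord Ω p q i w).im = Ω v w := by
  rw [h.form_eq hΩ hv, Complex.im_sum]
  refine Finset.sum_congr rfl fun j _ => ?_
  rw [complexCoord_apply, complexCoord_apply, hΩ.skew v (q j), hΩ.skew w (q j)]
  simp
  ring

theorem eq_zero_of_complexCoord [FiniteDimensional ℝ V] (hΩ : IsSymplecticOn n Ω W)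
    (h : IsSymplecticBasis Ω W p q) {v : V} (hv : v ∈ W)
    (h0 : ∀ i, complexCoord Ω p q i v = 0) : v = 0 := by
  have h1 : ∀ i, Ω v (q i) = 0 ∧ Ω (p i) v = 0 := fun i => by
    have := h0 i
    rw [complexCoord_apply] at this
    have hr := congrArg Complex.re this
    have hi := congrArg Complex.im this
    simp at hr hi
    exact ⟨hr, hi⟩
  rw [h.expand hΩ hv]
  simp [h1]

/-- Lagrangian subspaces are totally real in complex coordinates. -/
theorem det_complexCoord_ne_zero [FiniteDimensional ℝ V] (hΩ : IsSymplecticOn n Ω W)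
    (h : IsSymplecticBasis Ω W p q) (hL : IsLagrangianIn n Ω W L) {v : Fin n → V}
    (hv : IsBasisOf v L) : (valueMatrix (complexCoord Ω p q) v).det ≠ 0 := by
  intro hdet
  obtain ⟨c, hc, hc0⟩ := Matrix.exists_mulVec_eq_zero_iff.2 hdet
  apply hc
  -- the real and the imaginary part of a kernel vector give vectors `u`, `w` of `L`
  -- with `z(u) = -i z(w)`
  let u : V := ∑ j, (c j).re • v j
  let w : V := ∑ j, (c j).im • v j
  have hu : u ∈ L := Submodule.sum_mem _ fun j _ => Submodule.smul_mem _ _ (hv.mem j)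
  have hw : w ∈ L := Submodule.sum_mem _ fun j _ => Submodule.smul_mem _ _ (hv.mem j)
  have hz : ∀ i, complexCoord Ω p q i u = - (Complex.I * complexCoord Ω p q i w) := fun i => by
    have h1 := congrFun hc0 i
    simp only [Matrix.mulVec, dotProduct, valueMatrix, Matrix.of_apply, Pi.zero_apply] at h1
    rw [← add_eq_zero_iff_eq_neg, ← h1]
    simp only [u, w, map_sum, map_smul, Complex.real_smul, Finset.mul_sum,
      ← Finset.sum_add_distrib]
    refine Finset.sum_congr rfl fun j _ => ?_
    conv_rhs => rw [← Complex.re_add_im (c j)]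
    ring
  have hw0 : ∀ i, complexCoord Ω p q i w = 0 := by
    have h1 := im_hermitian hΩ h (hL.le hw) (w := u)
    rw [hL.isotropic w hw u hu] at h1
    have h2 : ∑ i, Complex.normSq (complexCoord Ω p q i w) = 0 := by
      rw [← neg_eq_zero, ← h1, Complex.im_sum, ← Finset.sum_neg_distrib]
      refine Finset.sum_congr rfl fun i _ => ?_
      rw [hz i, Complex.normSq_apply]
      simp
    intro i
    have := (Finset.sum_eq_zero_iff_of_nonneg (fun i _ => Complex.normSq_nonneg _)).1 h2 i
      (Finset.mem_univ i)
    exact Complex.normSq_eq_zero.1 this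
  have hw1 : w = 0 := eq_zero_of_complexCoord hΩ h (hL.le hw) hw0
  have hu1 : u = 0 := eq_zero_of_complexCoord hΩ h (hL.le hu) fun i => by
    rw [hz i, hw0 i, mul_zero, neg_zero]
  funext j
  have hre := Fintype.linearIndependent_iff.1 hv.1 _ hu1 j
  have him := Fintype.linearIndependent_iff.1 hv.1 _ hw1 j
  exact Complex.ext hre him

/-! The change from one symplectic basis to another one has the form `z' = α z + β z̄` in complex
coordinates, and `α α* - β β* = 1`. -/

section FrameChange

variable (Ω) (p q) (p' q' : Fin n → V)

/-- The complex linear part of the change of coordinates. -/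
noncomputable def linearPart : Matrix (Fin n) (Fin n) ℂ :=
  Matrix.of fun i j => (complexCoord Ω p' q' i (p j) - Complex.I * complexCoord Ω p' q' i (q j)) / 2

/-- The complex antilinear part of the change of coordinates. -/
noncomputable def antilinearPart : Matrix (Fin n) (Fin n) ℂ :=
  Matrix.of fun i j => (complexCoord Ω p' q' i (p j) + Complex.I * complexCoord Ω p' q' i (q j)) / 2

/-- The functionals `α z + s β z̄`, which for `s = 1` are the new complex coordinates. -/
noncomputable def interpolatedCoord (s : ℝ) (i : Fin n) : V →ₗ[ℝ] ℂ :=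
  ∑ j, (LinearMap.mulLeft ℝ (linearPart Ω p q p' q' i j) ∘ₗ complexCoord Ω p q j +
    LinearMap.mulLeft ℝ (s * antilinearPart Ω p q p' q' i j) ∘ₗ
      Complex.conjAe.toLinearMap ∘ₗ complexCoord Ω p q j)

variable {Ω p q p' q'}

theorem interpolatedCoord_apply (s : ℝ) (i : Fin n) (v : V) :
    interpolatedCoord Ω p q p' q' s i v =
      ∑ j, (linearPart Ω p q p' q' i j * complexCoord Ω p q j v +
      s * antilinearPart Ω p q p' q' i j * (starRingEnd ℂ) (complexCoord Ω p q j v)) := by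
  simp [interpolatedCoord, LinearMap.sum_apply, mul_assoc]

theorem interpolatedCoord_one [FiniteDimensional ℝ V] (hΩ : IsSymplecticOn n Ω W)
    (h : IsSymplecticBasis Ω W p q) {v : V} (hv : v ∈ W) (i : Fin n) :
    interpolatedCoord Ω p q p' q' 1 i v = complexCoord Ω p' q' i v := by
  rw [interpolatedCoord_apply]
  conv_rhs => rw [h.expand hΩ hv]
  rw [map_sum]
  refine Finset.sum_congr rfl fun j _ => ?_
  simp only [linearPart, antilinearPart, Matrix.of_apply, complexCoord_apply (p := p) (q := q),
    map_add, map_smul, Complex.real_smul, map_mul, Complex.conj_ofReal, Complex.conj_I]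
  generalize complexCoord Ω p' q' i (p j) = A
  generalize complexCoord Ω p' q' i (q j) = B
  push_cast
  linear_combination (-(B * (Ω (p j) v : ℂ))) * Complex.I_sq

theorem valueMatrix_interpolatedCoord (s : ℝ) (v : Fin n → V) :
    valueMatrix (interpolatedCoord Ω p q p' q' s) v =
      linearPart Ω p q p' q' * valueMatrix (complexCoord Ω p q) v +
      (s : ℂ) • (antilinearPart Ω p q p' q' *
        (valueMatrix (complexCoord Ω p q) v).map (starRingEnd ℂ)) := by
  ext i j
  simp only [valueMatrix, Matrix.of_apply, interpolatedCoord_apply, Matrix.add_apply,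
    Matrix.mul_apply, Matrix.smul_apply, Matrix.map_apply, smul_eq_mul, Finset.mul_sum,
    ← Finset.sum_add_distrib]
  exact Finset.sum_congr rfl fun _ _ => by ring

/-- The identity `α α* - β β* = 1` expresses that the new basis is symplectic. -/
theorem linearPart_mul_conjTranspose_sub [FiniteDimensional ℝ V] (hΩ : IsSymplecticOn n Ω W)
    (h : IsSymplecticBasis Ω W p q) (h' : IsSymplecticBasis Ω W p' q') :
    linearPart Ω p q p' q' * (linearPart Ω p q p' q').conjTranspose -
      antilinearPart Ω p q p' q' * (antilinearPart Ω p q p' q').conjTranspose = 1 := by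
  ext i k
  have hsum : ∀ {v w : V}, v ∈ W → Ω v w =
      ∑ j, (Ω (p j) v * Ω (q j) w - Ω (q j) v * Ω (p j) w) := fun hv => h.form_eq hΩ hv
  have e1 := hsum (w := q' k) (h'.q_mem i)
  have e2 := hsum (w := p' k) (h'.p_mem i)
  have e3 := hsum (w := q' k) (h'.p_mem i)
  have e4 := hsum (w := p' k) (h'.q_mem i)
  rw [h'.q_q] at e1
  rw [h'.p_p] at e2
  rw [h'.p_q] at e3
  rw [hΩ.skew, h'.p_q] at e4
  simp only [Matrix.sub_apply, Matrix.mul_apply, Matrix.conjTranspose_apply,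
    ← Finset.sum_sub_distrib, Matrix.one_apply]
  have key : ∀ j, linearPart Ω p q p' q' i j * star (linearPart Ω p q p' q' k j) -
      antilinearPart Ω p q p' q' i j * star (antilinearPart Ω p q p' q' k j) =
      (((Ω (p j) (p' i) * Ω (q j) (q' k) - Ω (q j) (p' i) * Ω (p j) (q' k)) / 2 -
        (Ω (p j) (q' i) * Ω (q j) (p' k) - Ω (q j) (q' i) * Ω (p j) (p' k)) / 2 : ℝ) : ℂ) +
      (((Ω (p j) (q' i) * Ω (q j) (q' k) - Ω (q j) (q' i) * Ω (p j) (q' k)) / 2 +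
        (Ω (p j) (p' i) * Ω (q j) (p' k) - Ω (q j) (p' i) * Ω (p j) (p' k)) / 2 : ℝ) : ℂ) *
        Complex.I := by
    intro j
    simp only [linearPart, antilinearPart, Matrix.of_apply, complexCoord_apply,
      hΩ.skew (p' i) (p j), hΩ.skew (p' i) (q j), hΩ.skew (p' k) (p j), hΩ.skew (p' k) (q j)]
    apply Complex.ext
    · simp
      ring
    · simp
      ring
  rw [Finset.sum_congr rfl fun j _ => key j, Finset.sum_add_distrib, ← Finset.sum_mul,
    ← Complex.ofReal_sum, ← Complex.ofReal_sum, Finset.sum_sub_distrib, Finset.sum_add_distrib,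
    ← Finset.sum_div, ← Finset.sum_div, ← Finset.sum_div, ← Finset.sum_div, ← e1, ← e2, ← e3, ← e4]
  by_cases hik : i = k
  · subst hik; simp; norm_num
  · simp [hik, Ne.symm hik]

/-- For `s ≤ 1` the functionals `α z + s β z̄` stay nondegenerate on Lagrangian subspaces: with
`Z` the matrix of a Lagrangian subspace, `Z̄ Z⁻¹` is unitary, while `α` dominates `β`. -/
theorem det_interpolatedCoord_ne_zero [FiniteDimensional ℝ V] (hΩ : IsSymplecticOn n Ω W)
    (h : IsSymplecticBasis Ω W p q) (h' : IsSymplecticBasis Ω W p' q')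
    (hL : IsLagrangianIn n Ω W L) {v : Fin n → V} (hv : IsBasisOf v L) {s : ℝ}
    (hs : s ∈ Icc (0 : ℝ) 1) :
    (valueMatrix (interpolatedCoord Ω p q p' q' s) v).det ≠ 0 := by
  intro hdet
  obtain ⟨y, hy, hy0⟩ := Matrix.exists_vecMul_eq_zero_iff.2 hdet
  apply hy
  rw [valueMatrix_interpolatedCoord] at hy0
  have hZdet := det_complexCoord_ne_zero hΩ h hL hv
  set Z := valueMatrix (complexCoord Ω p q) v with hZ
  set α := linearPart Ω p q p' q'
  set β := antilinearPart Ω p q p' q'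
  have hZu : IsUnit Z.det := isUnit_iff_ne_zero.2 hZdet
  -- `Z* Z` is real, because its imaginary part is the matrix of `Ω` on a Lagrangian subspace
  have hreal : Z.conjTranspose * Z = Z.transpose * Z.map (starRingEnd ℂ) := by
    ext j k
    have him := im_hermitian hΩ h (hL.le (hv.mem j)) (w := v k)
    rw [hL.isotropic _ (hv.mem j) _ (hv.mem k)] at him
    have h1 := Complex.conj_eq_iff_im.2 him
    simp only [Matrix.mul_apply, Matrix.conjTranspose_apply, Matrix.transpose_apply,
      Matrix.map_apply, hZ, valueMatrix, Matrix.of_apply]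
    rw [map_sum] at h1
    rw [show (∑ i, star (complexCoord Ω p q i (v j)) * complexCoord Ω p q i (v k)) =
      ∑ i, (starRingEnd ℂ) (complexCoord Ω p q i (v j)) * complexCoord Ω p q i (v k) from rfl, ← h1]
    refine Finset.sum_congr rfl fun i _ => ?_
    rw [map_mul, Complex.conj_conj]
  let N := Z.map (starRingEnd ℂ) * Z⁻¹
  have hNN : N.conjTranspose * N = 1 := by
    have e1 : (Z.map (starRingEnd ℂ)).conjTranspose = Z.transpose := by
      ext i j; simp [Matrix.conjTranspose_apply]
    calc N.conjTranspose * N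
        = (Z⁻¹).conjTranspose * (Z.transpose * Z.map (starRingEnd ℂ)) * Z⁻¹ := by
          simp only [N, Matrix.conjTranspose_mul, e1, Matrix.mul_assoc]
      _ = (Z⁻¹).conjTranspose * Z.conjTranspose * (Z * Z⁻¹) := by
          rw [← hreal]; simp only [Matrix.mul_assoc]
      _ = 1 := by
          rw [← Matrix.conjTranspose_mul, Matrix.mul_nonsing_inv Z hZu]; simp
  have hNN' : N * N.conjTranspose = 1 := mul_eq_one_comm.1 hNN
  let Y : Matrix (Fin 1) (Fin n) ℂ := Matrix.of fun _ j => y j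
  have hY0 : Y * (α * Z + (s : ℂ) • (β * Z.map (starRingEnd ℂ))) = 0 := by
    ext i j
    have := congrFun hy0 j
    simpa [Matrix.vecMul, dotProduct, Matrix.mul_apply, Y] using this
  -- `y α = -s y β N` with `N` unitary, so `|y α| = s |y β|`
  have hR : Y * α = -((s : ℂ) • (Y * β * N)) := by
    have := congrArg (fun A => A * Z⁻¹) hY0
    simp only [Matrix.mul_add, Matrix.add_mul, Matrix.zero_mul, Matrix.mul_smul,
      Matrix.smul_mul] at this
    rw [← Matrix.mul_assoc Y α Z, Matrix.mul_nonsing_inv_cancel_right _ _ hZu] at this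
    rw [← add_eq_zero_iff_eq_neg, ← this]
    simp only [N, Matrix.mul_assoc]
  have hRR : (Y * α) * (Y * α).conjTranspose =
      ((s ^ 2 : ℝ) : ℂ) • ((Y * β) * (Y * β).conjTranspose) := by
    have hN : Y * β * N * (N.conjTranspose * (β.conjTranspose * Y.conjTranspose)) =
        Y * β * (β.conjTranspose * Y.conjTranspose) := by
      rw [Matrix.mul_assoc (Y * β) N, ← Matrix.mul_assoc N, hNN', Matrix.one_mul]
    rw [hR]
    simp only [Matrix.conjTranspose_neg, Matrix.conjTranspose_smul, Matrix.neg_mul, Matrix.mul_neg,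
      Matrix.smul_mul, Matrix.mul_smul, Matrix.conjTranspose_mul, hN]
    ext i j
    simp [pow_two, mul_assoc]
  -- on the other hand `|y α|² - |y β|² = |y|²`, which forces `y = 0`
  have hYY : (Y * α) * (Y * α).conjTranspose - (Y * β) * (Y * β).conjTranspose =
      Y * Y.conjTranspose := by
    have := linearPart_mul_conjTranspose_sub hΩ h h'
    calc _ = Y * (α * α.conjTranspose - β * β.conjTranspose) * Y.conjTranspose := by
          simp only [Matrix.conjTranspose_mul, Matrix.mul_sub, Matrix.sub_mul, Matrix.mul_assoc]
      _ = _ := by rw [this, Matrix.mul_one]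
  have hnorm : ∀ A : Matrix (Fin 1) (Fin n) ℂ,
      (A * A.conjTranspose) 0 0 = ((∑ j, Complex.normSq (A 0 j) : ℝ) : ℂ) := fun A => by
    rw [Matrix.mul_apply]
    push_cast
    refine Finset.sum_congr rfl fun j _ => ?_
    rw [Matrix.conjTranspose_apply, Complex.normSq_eq_conj_mul_self, mul_comm]
    rfl
  have h00 := congrFun (congrFun hYY 0) 0
  rw [hRR, Matrix.sub_apply, Matrix.smul_apply, hnorm, hnorm, smul_eq_mul, ← Complex.ofReal_mul,
    ← Complex.ofReal_sub] at h00
  have h01 := Complex.ofReal_injective h00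
  have hb : 0 ≤ ∑ j, Complex.normSq ((Y * β) 0 j) :=
    Finset.sum_nonneg fun j _ => Complex.normSq_nonneg _
  have hs2 : s ^ 2 ≤ 1 := pow_le_one₀ hs.1 hs.2
  have hle : ∑ j, Complex.normSq (Y 0 j) ≤ 0 := by
    rw [← h01]; nlinarith
  have hz := (Finset.sum_eq_zero_iff_of_nonneg (fun j _ => Complex.normSq_nonneg (Y 0 j))).1
    (le_antisymm hle (Finset.sum_nonneg fun j _ => Complex.normSq_nonneg _))
  funext j
  exact Complex.normSq_eq_zero.1 (hz j (Finset.mem_univ j))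

end FrameChange

end LinearAlgebra

/-! ### The exterior derivative in charts -/

/-- The model space of a `(2n+1)`-manifold. -/
abbrev Model (n : ℕ) := EuclideanSpace ℝ (Fin (2 * n + 1))

/-- The exterior derivative is natural: the derivative of the pulled back form, antisymmetrized, is
the pull-back of the antisymmetrized derivative, because second derivatives are symmetric. -/
theorem fderiv_pullback_sub_flip {E F : Type*} [NormedAddCommGroup E] [NormedSpace ℝ E]
    [NormedAddCommGroup F] [NormedSpace ℝ F] {η : F → F →L[ℝ] ℝ} {f : E → F} {y : E}
    (hη : DifferentiableAt ℝ η (f y)) (hf : ContDiffAt ℝ 2 f y) (v w : E) :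
    fderiv ℝ (fun z => (η (f z)).comp (fderiv ℝ f z)) y v w -
      fderiv ℝ (fun z => (η (f z)).comp (fderiv ℝ f z)) y w v =
    fderiv ℝ η (f y) (fderiv ℝ f y v) (fderiv ℝ f y w) -
      fderiv ℝ η (f y) (fderiv ℝ f y w) (fderiv ℝ f y v) := by
  have hf1 : DifferentiableAt ℝ f y := hf.differentiableAt (by norm_num)
  have hf2 : DifferentiableAt ℝ (fderiv ℝ f) y :=
    (hf.fderiv_right (m := 1) (by norm_num)).differentiableAt (by norm_num)
  have hsymm : IsSymmSndFDerivAt ℝ f y := hf.isSymmSndFDerivAt (by simp)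
  have h1 := (hη.hasFDerivAt.comp y hf1.hasFDerivAt).clm_comp hf2.hasFDerivAt
  have h2 : fderiv ℝ (fun z => (η (f z)).comp (fderiv ℝ f z)) y = _ := h1.fderiv
  rw [h2]
  have := hsymm.eq v w
  simp [this]

section Chart

variable {n : ℕ} {M : Type u} [TopologicalSpace M] [ChartedSpace (Model n) M]
  [IsManifold (𝓡 (2 * n + 1)) ∞ M]

theorem one_manifold : IsManifold (𝓡 (2 * n + 1)) 1 M :=
  IsManifold.of_le (n := ∞) (by simp)

/-- Coordinates of a tangent vector at `x` in the preferred chart at `x₀`. -/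
noncomputable def coordAt (x₀ x : M) : Model n →L[ℝ] Model n :=
  haveI : IsManifold (𝓡 (2 * n + 1)) 1 M := one_manifold
  tangentCoordChange (𝓡 (2 * n + 1)) x x₀ x

/-- The tangent vector at `x` with given coordinates in the preferred chart at `x₀`. -/
noncomputable def vecAt (x₀ x : M) : Model n →L[ℝ] Model n :=
  haveI : IsManifold (𝓡 (2 * n + 1)) 1 M := one_manifold
  tangentCoordChange (𝓡 (2 * n + 1)) x₀ x x

theorem vecAt_coordAt {x₀ x : M} (hx : x ∈ (extChartAt (𝓡 (2 * n + 1)) x₀).source) (v : Model n) :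
    vecAt x₀ x (coordAt x₀ x v) = v := by
  have : IsManifold (𝓡 (2 * n + 1)) 1 M := one_manifold
  rw [coordAt, vecAt, tangentCoordChange_comp
    ⟨⟨mem_extChartAt_source x, hx⟩, mem_extChartAt_source x⟩,
    tangentCoordChange_self (mem_extChartAt_source x)]

/-- Continuity of a vector field along `f` at `z₀`, in terms of its coordinates in the preferred
chart at `f z₀`. -/
theorem continuousWithinAt_tangent_iff {X : Type*} [TopologicalSpace X] {S : Set X} {z₀ : X}
    {f : X → M} {v : X → Model n} :
    ContinuousWithinAt (fun z => (⟨f z, v z⟩ : TangentBundle (𝓡 (2 * n + 1)) M)) S z₀ ↔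
      ContinuousWithinAt f S z₀ ∧
        ContinuousWithinAt (fun z => coordAt (f z₀) (f z) (v z)) S z₀ := by
  have : IsManifold (𝓡 (2 * n + 1)) 1 M := one_manifold
  rw [FiberBundle.continuousWithinAt_totalSpace]
  exact Iff.rfl

theorem oneFormInChart_apply (lam : ∀ x : M, TangentSpace (𝓡 (2 * n + 1)) x →L[ℝ] ℝ) (x₀ : M)
    {y : Model n} (hy : y ∈ (extChartAt (𝓡 (2 * n + 1)) x₀).target) (v : Model n) :
    oneFormInChart lam x₀ y v =
      lam ((extChartAt (𝓡 (2 * n + 1)) x₀).symm y)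
        (vecAt x₀ ((extChartAt (𝓡 (2 * n + 1)) x₀).symm y) v) := by
  have : IsManifold (𝓡 (2 * n + 1)) 1 M := one_manifold
  have hmd : MDifferentiableAt 𝓘(ℝ, Model n) (𝓡 (2 * n + 1))
      (extChartAt (𝓡 (2 * n + 1)) x₀).symm y := by
    rw [← mdifferentiableWithinAt_univ]
    have := mdifferentiableWithinAt_extChartAt_symm (I := 𝓡 (2 * n + 1)) hy
    rwa [ModelWithCorners.range_eq_univ] at this
  have key : (mfderiv 𝓘(ℝ, Model n) (𝓡 (2 * n + 1)) (extChartAt (𝓡 (2 * n + 1)) x₀).symm y :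
      Model n →L[ℝ] Model n) = vecAt x₀ ((extChartAt (𝓡 (2 * n + 1)) x₀).symm y) := by
    refine hmd.mfderiv.trans ?_
    rw [vecAt, tangentCoordChange_def,
      (extChartAt (𝓡 (2 * n + 1)) x₀).right_inv hy]
    simp only [writtenInExtChartAt, extChartAt_model_space_eq_id, ModelWithCorners.range_eq_univ]
    rfl
  exact congrArg (fun L : Model n →L[ℝ] Model n =>
    lam ((extChartAt (𝓡 (2 * n + 1)) x₀).symm y) (L v)) key

theorem coordAt_eq_fderiv {x₀ x : M} :
    coordAt x₀ x = fderiv ℝ (extChartAt (𝓡 (2 * n + 1)) x₀ ∘ (extChartAt (𝓡 (2 * n + 1)) x).symm)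
      (extChartAt (𝓡 (2 * n + 1)) x x) := by
  have : IsManifold (𝓡 (2 * n + 1)) 1 M := one_manifold
  rw [coordAt, tangentCoordChange_def, ModelWithCorners.range_eq_univ, fderivWithin_univ]

variable (C : ContactForm n M)

theorem contDiffAt_oneFormInChart (x₀ : M) :
    ContDiffAt ℝ 2 (oneFormInChart C.form x₀) (extChartAt (𝓡 (2 * n + 1)) x₀ x₀) := by
  have : IsManifold (𝓡 (2 * n + 1)) 1 M := one_manifold
  have h1 := C.smooth x₀
  rw [contMDiffAt_hom_bundle] at h1
  have h2 := h1.2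
  rw [contMDiffAt_iff] at h2
  have h3 := h2.2
  rw [ModelWithCorners.range_eq_univ, contDiffWithinAt_univ] at h3
  refine (h3.of_le (by norm_cast)).congr_of_eventuallyEq ?_
  have hev := extChartAt_target_mem_nhds (I := 𝓡 (2 * n + 1)) x₀
  filter_upwards [hev] with y hy
  have hsrc := (extChartAt (𝓡 (2 * n + 1)) x₀).map_target hy
  rw [extChartAt_source] at hsrc
  ext v
  rw [oneFormInChart_apply C.form x₀ hy]
  simp only [Function.comp_apply, ContinuousLinearMap.inCoordinates]
  refine Eq.trans ?_ (DFunLike.congr_fun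
    (Bundle.Trivial.continuousLinearMapAt_trivialization ℝ M ℝ
      ((extChartAt (𝓡 (2 * n + 1)) x₀).symm y)) _).symm
  exact congrArg (fun L : Model n →L[ℝ] Model n =>
    C.form ((extChartAt (𝓡 (2 * n + 1)) x₀).symm y) (L v))
    (TangentBundle.symmL_trivializationAt_eq_core hsrc).symm

end Chart

section Chart

variable {n : ℕ} {M : Type u} [TopologicalSpace M] [ChartedSpace (Model n) M]
  [IsManifold (𝓡 (2 * n + 1)) ∞ M] (C : ContactForm n M)

/-- The bilinear form `dlam` at `x` on the model space, which is the tangent space at `x`. -/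
noncomputable def dForm (x : M) : Model n →ₗ[ℝ] Model n →ₗ[ℝ] ℝ :=
  LinearMap.mk₂ ℝ (fun v w => C.d x v w)
    (fun v v' w => DFunLike.congr_fun (map_add (C.d x) v v') w)
    (fun c v w => DFunLike.congr_fun (map_smul (C.d x) c v) w)
    (fun v w w' => map_add (C.d x v) w w') (fun c v w => map_smul (C.d x v) c w)

/-- The contact hyperplane at `x` as a subspace of the model space. -/
noncomputable def xiSpace (x : M) : Submodule ℝ (Model n) := C.xi x

theorem dForm_eq_fderiv (x : M) (v w : Model n) : dForm C x v w =
    fderiv ℝ (oneFormInChart C.form x) (extChartAt (𝓡 (2 * n + 1)) x x) v w -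
      fderiv ℝ (oneFormInChart C.form x) (extChartAt (𝓡 (2 * n + 1)) x x) w v := rfl

theorem mem_xiSpace {x : M} {v : Model n} : v ∈ xiSpace C x ↔ C.form x v = 0 := Iff.rfl

theorem isSymplecticOn_xiSpace (x : M) : IsSymplecticOn n (dForm C x) (xiSpace C x) where
  skew v w := by
    rw [dForm_eq_fderiv, dForm_eq_fderiv]
    ring
  finrank_eq := by
    have h := Module.Dual.finrank_ker_add_one_of_ne_zero (K := ℝ) (V₁ := Model n)
      (f := (show Model n →L[ℝ] ℝ from C.form x).toLinearMap) (fun h0 => C.ne_zero x (by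
        ext v
        exact DFunLike.congr_fun h0 v))
    have h2 : Module.finrank ℝ (Model n) = 2 * n + 1 := by simp [Model]
    have h3 : Module.finrank ℝ (xiSpace C x) + 1 = 2 * n + 1 := h.trans h2
    omega
  nondegenerate v hv h := C.nondegenerate x v hv h

theorem mfderiv_extChartAt_eq_coordAt {x₀ x : M}
    (hx : x ∈ (extChartAt (𝓡 (2 * n + 1)) x₀).source) :
    (mfderiv (𝓡 (2 * n + 1)) 𝓘(ℝ, Model n) (extChartAt (𝓡 (2 * n + 1)) x₀) x :
      Model n →L[ℝ] Model n) = coordAt x₀ x := by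
  have : IsManifold (𝓡 (2 * n + 1)) 1 M := one_manifold
  rw [extChartAt_source] at hx
  exact (TangentBundle.continuousLinearMapAt_trivializationAt hx).symm.trans
    (TangentBundle.continuousLinearMapAt_trivializationAt_eq_core hx)

theorem form_eq_chart {x₀ x : M} (hx : x ∈ (extChartAt (𝓡 (2 * n + 1)) x₀).source) (v : Model n) :
    C.form x v =
      oneFormInChart C.form x₀ (extChartAt (𝓡 (2 * n + 1)) x₀ x) (coordAt x₀ x v) := by
  rw [oneFormInChart_apply C.form x₀ ((extChartAt (𝓡 (2 * n + 1)) x₀).map_source hx),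
    (extChartAt (𝓡 (2 * n + 1)) x₀).left_inv hx, vecAt_coordAt hx]

/-- The expression of `dlam` in the preferred chart at a nearby point. -/
theorem eventually_dForm_eq_chart (x₀ : M) : ∀ᶠ x in 𝓝 x₀, ∀ v w : Model n, dForm C x v w =
    fderiv ℝ (oneFormInChart C.form x₀) (extChartAt (𝓡 (2 * n + 1)) x₀ x)
      (coordAt x₀ x v) (coordAt x₀ x w) -
    fderiv ℝ (oneFormInChart C.form x₀) (extChartAt (𝓡 (2 * n + 1)) x₀ x)
      (coordAt x₀ x w) (coordAt x₀ x v) := by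
  have : IsManifold (𝓡 (2 * n + 1)) 1 M := one_manifold
  have h2 : ∀ᶠ x in 𝓝 x₀, ContDiffAt ℝ 2 (oneFormInChart C.form x₀)
      (extChartAt (𝓡 (2 * n + 1)) x₀ x) :=
    (continuousAt_extChartAt x₀).eventually
      ((contDiffAt_oneFormInChart C x₀).eventually (by simp))
  filter_upwards [h2, extChartAt_source_mem_nhds (I := 𝓡 (2 * n + 1)) x₀] with x hx hsrc v w
  have hxx := mem_extChartAt_source (I := 𝓡 (2 * n + 1)) x
  have hxy : extChartAt (𝓡 (2 * n + 1)) x₀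
      ((extChartAt (𝓡 (2 * n + 1)) x).symm (extChartAt (𝓡 (2 * n + 1)) x x)) =
      extChartAt (𝓡 (2 * n + 1)) x₀ x := by rw [(extChartAt (𝓡 (2 * n + 1)) x).left_inv hxx]
  have hτ : ContDiffAt ℝ 2 (extChartAt (𝓡 (2 * n + 1)) x₀ ∘ (extChartAt (𝓡 (2 * n + 1)) x).symm)
      (extChartAt (𝓡 (2 * n + 1)) x x) := by
    have h' : extChartAt (𝓡 (2 * n + 1)) x x ∈ ((extChartAt (𝓡 (2 * n + 1)) x).symm ≫
        (extChartAt (𝓡 (2 * n + 1)) x₀)).source := by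
      rw [PartialEquiv.trans_source'', PartialEquiv.symm_symm, PartialEquiv.symm_target]
      exact mem_image_of_mem _ ⟨hxx, hsrc⟩
    have := contDiffWithinAt_ext_coord_change (I := 𝓡 (2 * n + 1)) (n := ∞) x₀ x h'
    rw [ModelWithCorners.range_eq_univ, contDiffWithinAt_univ] at this
    exact this.of_le (by norm_cast)
  -- near `x`, the coordinate expressions of `lam` differ by the pull-back under the transition map
  have hev : oneFormInChart C.form x =ᶠ[𝓝 (extChartAt (𝓡 (2 * n + 1)) x x)] fun y =>
      (oneFormInChart C.form x₀
        ((extChartAt (𝓡 (2 * n + 1)) x₀ ∘ (extChartAt (𝓡 (2 * n + 1)) x).symm) y)).comp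
      (fderiv ℝ (extChartAt (𝓡 (2 * n + 1)) x₀ ∘ (extChartAt (𝓡 (2 * n + 1)) x).symm) y) := by
    have hsymm := (continuousAt_extChartAt_symm (I := 𝓡 (2 * n + 1)) x)
    have hnear : ∀ᶠ y in 𝓝 (extChartAt (𝓡 (2 * n + 1)) x x),
        (extChartAt (𝓡 (2 * n + 1)) x).symm y ∈ (extChartAt (𝓡 (2 * n + 1)) x₀).source := by
      apply hsymm.eventually_mem
      rw [(extChartAt (𝓡 (2 * n + 1)) x).left_inv hxx]
      exact (isOpen_extChartAt_source x₀).mem_nhds hsrc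
    filter_upwards [hnear, extChartAt_target_mem_nhds (I := 𝓡 (2 * n + 1)) x] with y hy hyt
    ext u
    have hys := (extChartAt (𝓡 (2 * n + 1)) x).map_target hyt
    have e1 : fderiv ℝ (extChartAt (𝓡 (2 * n + 1)) x₀ ∘ (extChartAt (𝓡 (2 * n + 1)) x).symm) y =
        tangentCoordChange (𝓡 (2 * n + 1)) x x₀ ((extChartAt (𝓡 (2 * n + 1)) x).symm y) := by
      rw [tangentCoordChange_def, ModelWithCorners.range_eq_univ, fderivWithin_univ,
        (extChartAt (𝓡 (2 * n + 1)) x).right_inv hyt]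
    rw [ContinuousLinearMap.comp_apply, oneFormInChart_apply C.form x hyt, e1, Function.comp_apply,
      oneFormInChart_apply C.form x₀ ((extChartAt (𝓡 (2 * n + 1)) x₀).map_source hy),
      (extChartAt (𝓡 (2 * n + 1)) x₀).left_inv hy, vecAt, vecAt,
      tangentCoordChange_comp ⟨⟨hys, hy⟩, mem_extChartAt_source _⟩]
  rw [dForm_eq_fderiv, hev.fderiv_eq, coordAt_eq_fderiv, ← hxy]
  refine fderiv_pullback_sub_flip (η := oneFormInChart C.form x₀) ?_ hτ v w
  rw [Function.comp_apply, hxy]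
  exact hx.differentiableAt (by norm_num)

variable {X : Type*} [TopologicalSpace X] {S : Set X} {f : X → M}

/-- Continuity over `S` of a vector field along `f`. -/
def ContSection (S : Set X) (f : X → M) (v : X → Model n) : Prop :=
  ContinuousOn (fun z => (⟨f z, v z⟩ : TangentBundle (𝓡 (2 * n + 1)) M)) S

theorem ContSection.base {v : X → Model n} (hv : ContSection S f v) : ContinuousOn f S :=
  fun z hz => (continuousWithinAt_tangent_iff.1 (hv z hz)).1

theorem ContSection.mono {v : X → Model n} (hv : ContSection S f v) {T : Set X} (h : T ⊆ S) :
    ContSection T f v := ContinuousOn.mono hv h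

theorem ContSection.congr {v w : X → Model n} {g : X → M} (hv : ContSection S f v)
    (hfg : ∀ z ∈ S, g z = f z) (hvw : ∀ z ∈ S, w z = v z) : ContSection S g w :=
  ContinuousOn.congr hv fun z hz => by
    rw [hfg z hz, hvw z hz]

theorem ContSection.comp {v : X → Model n} (hv : ContSection S f v) {Y : Type*}
    [TopologicalSpace Y] {T : Set Y} {φ : Y → X} (hφ : ContinuousOn φ T) (hm : MapsTo φ T S) :
    ContSection T (fun y => f (φ y)) (fun y => v (φ y)) := ContinuousOn.comp hv hφ hm

theorem ContSection.add {v w : X → Model n} (hv : ContSection S f v) (hw : ContSection S f w) :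
    ContSection S f (fun z => v z + w z) := fun z hz => by
  refine continuousWithinAt_tangent_iff.2 ⟨hv.base z hz, ?_⟩
  simp only [map_add]
  exact (continuousWithinAt_tangent_iff.1 (hv z hz)).2.add
    (continuousWithinAt_tangent_iff.1 (hw z hz)).2

theorem ContSection.smul {c : X → ℝ} {v : X → Model n} (hc : ContinuousOn c S)
    (hv : ContSection S f v) : ContSection S f (fun z => c z • v z) := fun z hz => by
  refine continuousWithinAt_tangent_iff.2 ⟨hv.base z hz, ?_⟩
  simp only [map_smul]
  exact (hc z hz).smul (continuousWithinAt_tangent_iff.1 (hv z hz)).2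

theorem contSection_zero (hf : ContinuousOn f S) : ContSection S f (fun _ => (0 : Model n)) :=
  fun z hz => by
    refine continuousWithinAt_tangent_iff.2 ⟨hf z hz, ?_⟩
    simp only [map_zero]
    exact continuousWithinAt_const

theorem ContSection.sum {ι : Type*} (s : Finset ι) {v : ι → X → Model n} (hf : ContinuousOn f S)
    (hv : ∀ i ∈ s, ContSection S f (v i)) : ContSection S f (fun z => ∑ i ∈ s, v i z) := by
  classical
  induction s using Finset.induction_on with
  | empty => simpa using contSection_zero hf
  | insert a s ha ih =>
    simp only [Finset.sum_insert ha]
    exact (hv a (Finset.mem_insert_self a s)).add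
      (ih fun i hi => hv i (Finset.mem_insert_of_mem hi))

theorem ContSection.sub {v w : X → Model n} (hv : ContSection S f v) (hw : ContSection S f w) :
    ContSection S f (fun z => v z - w z) := by
  have := hv.add (hw.smul (c := fun _ => -1) continuousOn_const)
  simpa [sub_eq_add_neg] using this

theorem ContSection.form {v : X → Model n} (hv : ContSection S f v) :
    ContinuousOn (fun z => C.form (f z) (v z)) S := fun z hz => by
  obtain ⟨hf, hc⟩ := continuousWithinAt_tangent_iff.1 (hv z hz)
  have hη : ContinuousAt (oneFormInChart C.form (f z)) (extChartAt (𝓡 (2 * n + 1)) (f z) (f z)) :=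
    (contDiffAt_oneFormInChart C (f z)).continuousAt
  have hφ : ContinuousWithinAt (fun y => extChartAt (𝓡 (2 * n + 1)) (f z) (f y)) S z :=
    ContinuousAt.comp_continuousWithinAt (f := f) (continuousAt_extChartAt (f z)) hf
  have h1 : ContinuousWithinAt (fun y => oneFormInChart C.form (f z)
      (extChartAt (𝓡 (2 * n + 1)) (f z) (f y)) (coordAt (f z) (f y) (v y))) S z :=
    (ContinuousAt.comp_continuousWithinAt (f := fun y => extChartAt (𝓡 (2 * n + 1)) (f z) (f y))
      hη hφ).clm_apply hc
  have hsrc : ∀ᶠ y in 𝓝[S] z, f y ∈ (extChartAt (𝓡 (2 * n + 1)) (f z)).source :=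
    hf.eventually_mem (extChartAt_source_mem_nhds (f z))
  refine h1.congr_of_eventuallyEq ?_ ?_
  · filter_upwards [hsrc] with y hy using form_eq_chart C hy (v y)
  · exact form_eq_chart C (mem_extChartAt_source (f z)) (v z)

theorem ContSection.dForm {v w : X → Model n} (hv : ContSection S f v) (hw : ContSection S f w) :
    ContinuousOn (fun z => dForm C (f z) (v z) (w z)) S := fun z hz => by
  obtain ⟨hf, hc⟩ := continuousWithinAt_tangent_iff.1 (hv z hz)
  obtain ⟨-, hc'⟩ := continuousWithinAt_tangent_iff.1 (hw z hz)
  have hη : ContinuousAt (fderiv ℝ (oneFormInChart C.form (f z)))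
      (extChartAt (𝓡 (2 * n + 1)) (f z) (f z)) :=
    ((contDiffAt_oneFormInChart C (f z)).fderiv_right (m := 1) (by norm_num)).continuousAt
  have hφ : ContinuousWithinAt (fun y => extChartAt (𝓡 (2 * n + 1)) (f z) (f y)) S z :=
    ContinuousAt.comp_continuousWithinAt (f := f) (continuousAt_extChartAt (f z)) hf
  have hD : ContinuousWithinAt (fun y => fderiv ℝ (oneFormInChart C.form (f z))
      (extChartAt (𝓡 (2 * n + 1)) (f z) (f y))) S z :=
    ContinuousAt.comp_continuousWithinAt (f := fun y => extChartAt (𝓡 (2 * n + 1)) (f z) (f y))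
      hη hφ
  have h1 := ((hD.clm_apply hc).clm_apply hc').sub ((hD.clm_apply hc').clm_apply hc)
  have hev := eventually_dForm_eq_chart C (f z)
  refine h1.congr_of_eventuallyEq ?_ ?_
  · filter_upwards [hf.eventually hev] with y hy using hy (v y) (w y)
  · exact hev.self_of_nhds (v z) (w z)

/-- Every tangent vector extends to a continuous vector field along `f`, locally. -/
theorem exists_contSection_extend (hf : ContinuousOn f S) {z₀ : X} (hz₀ : z₀ ∈ S) (v : Model n) :
    ∃ U ∈ 𝓝[S] z₀, U ⊆ S ∧ ∃ s : X → Model n, ContSection U f s ∧ s z₀ = v := by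
  have : IsManifold (𝓡 (2 * n + 1)) 1 M := one_manifold
  let x₀ := f z₀
  have hnear : S ∩ f ⁻¹' (extChartAt (𝓡 (2 * n + 1)) x₀).source ∈ 𝓝[S] z₀ :=
    Filter.inter_mem self_mem_nhdsWithin
      ((hf z₀ hz₀).preimage_mem_nhdsWithin (extChartAt_source_mem_nhds (I := 𝓡 (2 * n + 1)) x₀))
  refine ⟨_, hnear, inter_subset_left, fun z => vecAt x₀ (f z) (coordAt x₀ x₀ v), ?_, ?_⟩
  · intro z hz
    have hfz := (hf z hz.1).mono
      (inter_subset_left (t := f ⁻¹' (extChartAt (𝓡 (2 * n + 1)) x₀).source))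
    refine continuousWithinAt_tangent_iff.2 ⟨hfz, ?_⟩
    have hcc := (continuousOn_tangentCoordChange (I := 𝓡 (2 * n + 1)) x₀ (f z)).continuousAt
      (((isOpen_extChartAt_source x₀).inter (isOpen_extChartAt_source (f z))).mem_nhds
        ⟨hz.2, mem_extChartAt_source (f z)⟩)
    have h1 : ContinuousWithinAt (fun y => tangentCoordChange (𝓡 (2 * n + 1)) x₀ (f z) (f y)
        (coordAt x₀ x₀ v)) (S ∩ f ⁻¹' (extChartAt (𝓡 (2 * n + 1)) x₀).source) z :=
      (ContinuousAt.comp_continuousWithinAt (f := f) hcc hfz).clm_apply continuousWithinAt_const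
    have key : ∀ y, f y ∈ (extChartAt (𝓡 (2 * n + 1)) x₀).source →
        f y ∈ (extChartAt (𝓡 (2 * n + 1)) (f z)).source →
        coordAt (f z) (f y) (vecAt x₀ (f y) (coordAt x₀ x₀ v)) =
          tangentCoordChange (𝓡 (2 * n + 1)) x₀ (f z) (f y) (coordAt x₀ x₀ v) := fun y h1 h2 => by
      rw [coordAt, vecAt, tangentCoordChange_comp ⟨⟨h1, mem_extChartAt_source _⟩, h2⟩]
    refine h1.congr_of_eventuallyEq ?_ (key z hz.2 (mem_extChartAt_source _))
    filter_upwards [self_mem_nhdsWithin,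
      hfz.eventually_mem (extChartAt_source_mem_nhds (I := 𝓡 (2 * n + 1)) (f z))]
      with y hy hy' using key y hy.2 hy'
  · exact vecAt_coordAt (mem_extChartAt_source _) v

end Chart

/-! ### Tangent spaces of Legendrian submanifolds -/

/-- An immersion has injective differential, because in suitable charts it has a left inverse. -/
theorem mfderiv_injective_of_isImmersionAt {E : Type*} {E'' : Type u} [NormedAddCommGroup E]
    [NormedSpace ℝ E] [NormedAddCommGroup E'']
    [NormedSpace ℝ E''] {H G : Type*} [TopologicalSpace H] [TopologicalSpace G]
    {I : ModelWithCorners ℝ E H} {J : ModelWithCorners ℝ E'' G} [I.Boundaryless]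
    {P N : Type*} [TopologicalSpace P] [ChartedSpace H P] [IsManifold I ∞ P]
    [TopologicalSpace N] [ChartedSpace G N] [IsManifold J ∞ N] {f : P → N} {x : P}
    (h : Manifold.IsImmersionAt I J ∞ f x) : Function.Injective (mfderiv I J f x) := by
  let φ := h.domChart.extend I
  let ψ := h.codChart.extend J
  let r : N → E := fun y => (h.equiv.symm (ψ y)).1
  have hxs := h.mem_domChart_source
  have hxφ : x ∈ φ.source := by rw [OpenPartialHomeomorph.extend_source]; exact hxs
  have hcomp : φ.symm ∘ r ∘ f =ᶠ[𝓝 x] id := by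
    filter_upwards [h.domChart.open_source.mem_nhds hxs] with y hy
    have hyφ : y ∈ φ.source := by rw [OpenPartialHomeomorph.extend_source]; exact hy
    have := h.writtenInCharts (φ.map_source hyφ)
    simp only [Function.comp_apply] at this
    rw [show (h.domChart.extend I).symm (φ y) = y from φ.left_inv hyφ] at this
    simp only [Function.comp_apply, r, ψ, id]
    rw [this, h.equiv.symm_apply_apply]
    exact φ.left_inv hyφ
  have hf : MDifferentiableAt I J f x := h.contMDiffAt.mdifferentiableAt (by simp)
  have hψ : MDifferentiableAt J 𝓘(ℝ, E'') ψ (f x) :=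
    (h.codChart.contMDiffAt_extend h.codChart_mem_maximalAtlas
      h.mem_codChart_source).mdifferentiableAt (by simp)
  have hr : MDifferentiableAt J 𝓘(ℝ, E) r (f x) := by
    have h1 : MDifferentiableAt 𝓘(ℝ, E'') 𝓘(ℝ, E) (fun y => (h.equiv.symm y).1) (ψ (f x)) := by
      apply DifferentiableAt.mdifferentiableAt
      fun_prop
    exact h1.comp (f x) hψ
  have hrf : r (f x) = φ x := by
    have := h.writtenInCharts (φ.map_source hxφ)
    simp only [Function.comp_apply] at this
    rw [show (h.domChart.extend I).symm (φ x) = x from φ.left_inv hxφ] at this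
    simp only [r, ψ]
    rw [this, h.equiv.symm_apply_apply]
  have hφ : MDifferentiableAt 𝓘(ℝ, E) I φ.symm (r (f x)) := by
    have h1 := (contMDiffOn_extend_symm h.domChart_mem_maximalAtlas).contMDiffAt (x := φ x) (by
      rw [I.image_eq]
      refine Filter.inter_mem ?_ (by rw [I.range_eq_univ]; exact Filter.univ_mem)
      apply I.continuous_symm.continuousAt.preimage_mem_nhds
      apply h.domChart.open_target.mem_nhds
      simp [φ, hxs])
    rw [hrf]
    exact h1.mdifferentiableAt (by simp)
  have hchain : HasMFDerivAt I I (φ.symm ∘ r ∘ f) x _ :=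
    hφ.hasMFDerivAt.comp x (hr.hasMFDerivAt.comp x hf.hasMFDerivAt)
  have hid := (hasMFDerivAt_id (I := I) x).congr_of_eventuallyEq hcomp
  have heq := hasMFDerivAt_unique hchain hid
  intro v w hvw
  have h1 := DFunLike.congr_fun heq v
  have h2 := DFunLike.congr_fun heq w
  refine h1.symm.trans (Eq.trans ?_ h2)
  exact congrArg (fun u => mfderiv 𝓘(ℝ, E) I φ.symm (r (f x)) (mfderiv J 𝓘(ℝ, E) r (f x) u)) hvw

section Legendrian

variable {n : ℕ} {M : Type u} [TopologicalSpace M] [ChartedSpace (Model n) M]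
  [IsManifold (𝓡 (2 * n + 1)) ∞ M] {C : ContactForm n M}

namespace LegendrianSubmanifold

variable (R : LegendrianSubmanifold C)

/-- The differential of the inclusion. -/
noncomputable def differential (p : R.Carrier) : EuclideanSpace ℝ (Fin n) →L[ℝ] Model n :=
  mfderiv (𝓡 n) (𝓡 (2 * n + 1)) R.incl p

theorem differential_injective (p : R.Carrier) : Function.Injective (R.differential p) :=
  mfderiv_injective_of_isImmersionAt (R.embedding.isImmersion.isImmersionAt p)

theorem form_differential (p : R.Carrier) (v : EuclideanSpace ℝ (Fin n)) :
    C.form (R.incl p) (R.differential p v) = 0 := R.tangent_xi p v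

/-- Since `lam` restricts to zero on a Legendrian submanifold, so does `dlam`. -/
theorem dForm_differential (p : R.Carrier) (v w : EuclideanSpace ℝ (Fin n)) :
    dForm C (R.incl p) (R.differential p v) (R.differential p w) = 0 := by
  have : IsManifold (𝓡 (2 * n + 1)) 1 M := one_manifold
  have : IsManifold (𝓡 n) 1 R.Carrier := IsManifold.of_le (n := ∞) (by simp)
  have hsm := R.embedding.contMDiff
  let φ := extChartAt (𝓡 (2 * n + 1)) (R.incl p)
  let ψ := extChartAt (𝓡 n) p
  let F : EuclideanSpace ℝ (Fin n) → Model n := φ ∘ R.incl ∘ ψ.symm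
  have hps : p ∈ ψ.source := mem_extChartAt_source p
  have hF : ContDiffAt ℝ 2 F (ψ p) := by
    have h1 := (contMDiffAt_iff.1 (hsm p)).2
    rw [ModelWithCorners.range_eq_univ, contDiffWithinAt_univ] at h1
    exact h1.of_le (by norm_cast)
  have hFp : F (ψ p) = φ (R.incl p) := by
    simp only [F, Function.comp_apply, ψ.left_inv hps]
  have hD : R.differential p = fderiv ℝ F (ψ p) := by
    refine ((hsm p).mdifferentiableAt (by simp)).mfderiv.trans ?_
    rw [ModelWithCorners.range_eq_univ, fderivWithin_univ]
    rfl
  -- the pull-back of `lam` to `R` vanishes in a neighbourhood of the point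
  have hzero : (fun y => (oneFormInChart C.form (R.incl p) (F y)).comp (fderiv ℝ F y)) =ᶠ[𝓝 (ψ p)]
      fun _ => 0 := by
    have hc : ContinuousAt (fun y => R.incl (ψ.symm y)) (ψ p) := by
      refine ContinuousAt.comp (g := R.incl) hsm.continuous.continuousAt ?_
      exact continuousAt_extChartAt_symm (I := 𝓡 n) p
    have hnear : ∀ᶠ y in 𝓝 (ψ p), R.incl (ψ.symm y) ∈ φ.source := by
      apply hc.eventually_mem
      rw [ψ.left_inv hps]
      exact extChartAt_source_mem_nhds (I := 𝓡 (2 * n + 1)) (R.incl p)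
    filter_upwards [hnear, extChartAt_target_mem_nhds (I := 𝓡 n) p] with y hy hyt
    ext u
    have h3 : MDifferentiableAt 𝓘(ℝ, EuclideanSpace ℝ (Fin n)) (𝓡 n) ψ.symm y := by
      rw [← mdifferentiableWithinAt_univ]
      have := mdifferentiableWithinAt_extChartAt_symm (I := 𝓡 n) hyt
      rwa [ModelWithCorners.range_eq_univ] at this
    have h2 : MDifferentiableAt (𝓡 n) (𝓡 (2 * n + 1)) R.incl (ψ.symm y) :=
      (hsm _).mdifferentiableAt (by simp)
    have h1 : MDifferentiableAt (𝓡 (2 * n + 1)) 𝓘(ℝ, Model n) φ (R.incl (ψ.symm y)) := by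
      apply mdifferentiableAt_extChartAt
      rw [← extChartAt_source (𝓡 (2 * n + 1))]
      exact hy
    have hch : HasMFDerivAt 𝓘(ℝ, EuclideanSpace ℝ (Fin n)) 𝓘(ℝ, Model n) F y _ :=
      h1.hasMFDerivAt.comp y (h2.hasMFDerivAt.comp y h3.hasMFDerivAt)
    have hch2 : fderiv ℝ F y u = coordAt (R.incl p) (R.incl (ψ.symm y))
        (R.differential (ψ.symm y)
          (mfderiv 𝓘(ℝ, EuclideanSpace ℝ (Fin n)) (𝓡 n) ψ.symm y u)) := by
      have e1 := DFunLike.congr_fun (mfderiv_eq_fderiv.symm.trans hch.mfderiv) u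
      refine e1.trans ?_
      exact DFunLike.congr_fun (mfderiv_extChartAt_eq_coordAt hy) _
    rw [ContinuousLinearMap.comp_apply, hch2]
    refine (form_eq_chart C hy _).symm.trans ?_
    exact R.form_differential _ _
  have h1 := fderiv_pullback_sub_flip (η := oneFormInChart C.form (R.incl p)) (f := F) (y := ψ p)
    (by rw [hFp]; exact (contDiffAt_oneFormInChart C (R.incl p)).differentiableAt (by norm_num))
    hF v w
  rw [hzero.fderiv_eq, hFp, ← hD] at h1
  rw [dForm_eq_fderiv]
  refine h1.symm.trans ?_
  simp

theorem tangentAt_incl (p : R.Carrier) :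
    (R.tangentAt (R.incl p) : Submodule ℝ (Model n)) =
      LinearMap.range (R.differential p).toLinearMap := by
  have hset : {v : Model n | (⟨R.incl p, v⟩ : TangentBundle (𝓡 (2 * n + 1)) M) ∈
      range (tangentMap (𝓡 n) (𝓡 (2 * n + 1)) R.incl)} =
      (LinearMap.range (R.differential p).toLinearMap : Set (Model n)) := by
    ext v
    constructor
    · rintro ⟨⟨p', u⟩, hu⟩
      have h1 : R.incl p' = R.incl p := congrArg (fun z => z.1) hu
      obtain rfl := R.embedding.isEmbedding.injective h1
      refine ⟨u, ?_⟩
      exact eq_of_heq (Bundle.TotalSpace.mk.inj hu).2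
    · rintro ⟨u, hu⟩
      exact ⟨⟨p, u⟩, congrArg (fun z : Model n =>
        (⟨R.incl p, z⟩ : TangentBundle (𝓡 (2 * n + 1)) M)) hu⟩
  refine Eq.trans (congrArg (Submodule.span ℝ (M := Model n)) hset) ?_
  exact Submodule.span_eq _

theorem finrank_range_differential (p : R.Carrier) :
    Module.finrank ℝ (LinearMap.range (R.differential p).toLinearMap) = n := by
  rw [LinearMap.finrank_range_of_inj (R.differential_injective p)]
  simp

theorem isLagrangian_gauss (p : R.Carrier) : IsLagrangian C (R.gauss (R.incl p)) := by
  have h := R.tangentAt_incl p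
  refine ⟨?_, ?_, ?_⟩
  · change Module.finrank ℝ (R.tangentAt (R.incl p) : Submodule ℝ (Model n)) = n
    rw [h]
    exact R.finrank_range_differential p
  · change (R.tangentAt (R.incl p) : Submodule ℝ (Model n)) ≤ xiSpace C (R.incl p)
    rw [h]
    rintro _ ⟨v, rfl⟩
    exact R.form_differential p v
  · change ∀ v ∈ (R.tangentAt (R.incl p) : Submodule ℝ (Model n)),
      ∀ w ∈ (R.tangentAt (R.incl p) : Submodule ℝ (Model n)), dForm C (R.incl p) v w = 0
    rw [h]
    rintro _ ⟨v, rfl⟩ _ ⟨w, rfl⟩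
    exact R.dForm_differential p v w

/-- The tangent spaces of a Legendrian submanifold form a continuous Lagrangian section along any
continuous map into it. -/
theorem isLagrangianSection_gauss {X : Type*} [TopologicalSpace X] {S : Set X} {f : X → M}
    (hf : ContinuousOn f S) (hR : ∀ z ∈ S, f z ∈ R.points) :
    IsLagrangianSection C S f (fun z => R.gauss (f z)) := by
  have : IsManifold (𝓡 (2 * n + 1)) 1 M := one_manifold
  have : IsManifold (𝓡 n) 1 R.Carrier := IsManifold.of_le (n := ∞) (by simp)
  refine ⟨fun _ _ => rfl, fun z hz => ?_, fun z₀ hz₀ => ?_⟩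
  · obtain ⟨p, hp⟩ := hR z hz
    beta_reduce
    rw [← hp]
    exact R.isLagrangian_gauss p
  · obtain ⟨p₀, hp₀⟩ := hR z₀ hz₀
    classical
    -- as the inclusion is an embedding, the map lifts to `R`, where `TR` has local frames
    let g : X → R.Carrier := fun z => if h : f z ∈ range R.incl then h.choose else p₀
    have hg : ∀ z ∈ S, R.incl (g z) = f z := fun z hz => by
      have h : f z ∈ range R.incl := hR z hz
      simp only [g, dif_pos h]
      exact h.choose_spec
    have hgc : ContinuousOn g S := by
      rw [R.embedding.isEmbedding.continuousOn_iff]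
      exact hf.congr hg
    have hg0 : g z₀ = p₀ := R.embedding.isEmbedding.injective ((hg z₀ hz₀).trans hp₀.symm)
    let e := trivializationAt (EuclideanSpace ℝ (Fin n))
      (TangentSpace (𝓡 n) : R.Carrier → Type _) p₀
    let b := (EuclideanSpace.basisFun (Fin n) ℝ).toBasis
    have hU : S ∩ g ⁻¹' e.baseSet ∈ 𝓝[S] z₀ := Filter.inter_mem self_mem_nhdsWithin
      ((hgc z₀ hz₀).preimage_mem_nhdsWithin (e.open_baseSet.mem_nhds (by
        rw [hg0]; exact mem_baseSet_trivializationAt _ _ _)))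
    refine ⟨S ∩ g ⁻¹' e.baseSet, hU, fun z j => tangentMap (𝓡 n) (𝓡 (2 * n + 1)) R.incl
      ⟨g z, e.symm (g z) (b j)⟩, ?_, ?_⟩
    · refine continuousOn_pi.2 fun j => ?_
      have h1 : ContinuousOn (fun p => (⟨p, e.symm p (b j)⟩ : TangentBundle (𝓡 n) R.Carrier))
          e.baseSet := by
        refine ContinuousOn.congr (f := fun p => e.toOpenPartialHomeomorph.symm (p, b j)) ?_
          fun p hp => e.mk_symm hp (b j)
        exact e.toOpenPartialHomeomorph.continuousOn_symm.comp (by fun_prop)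
          fun p hp => by simpa [e.target_eq] using hp
      exact (R.embedding.contMDiff.continuous_tangentMap (by simp)).comp_continuousOn
        (h1.comp (hgc.mono inter_subset_left) fun z hz => hz.2)
    · rintro z ⟨hzS, hz⟩
      change IsFrameOf (R.gauss (f z)) _
      rw [← hg z hzS]
      let L := e.continuousLinearEquivAt ℝ (g z) hz
      let v : Fin n → Model n := fun j => R.differential (g z) (L.symm (b j))
      have hv : LinearIndependent ℝ v := by
        have h1 : LinearIndependent ℝ (fun j => (L.symm (b j) : EuclideanSpace ℝ (Fin n))) :=
          b.linearIndependent.map' L.symm.toLinearEquiv.toLinearMap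
            (LinearMap.ker_eq_bot.2 L.symm.injective)
        exact h1.map' (R.differential (g z)).toLinearMap
          (LinearMap.ker_eq_bot.2 (R.differential_injective (g z)))
      refine ⟨v, fun j => rfl, hv, ?_⟩
      change Submodule.span ℝ (range v) = (R.tangentAt (R.incl (g z)) : Submodule ℝ (Model n))
      rw [R.tangentAt_incl]
      apply Submodule.eq_of_le_of_finrank_eq
      · rw [Submodule.span_le]
        rintro _ ⟨j, rfl⟩
        exact ⟨_, rfl⟩
      · rw [finrank_span_eq_card hv, R.finrank_range_differential]
        simp

end LegendrianSubmanifold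

end Legendrian

/-! ### Symplectic frames over cubes -/

section LinearAlgebra

variable {V : Type*} [AddCommGroup V] [Module ℝ V] {n m : ℕ}
  {Ω : V →ₗ[ℝ] V →ₗ[ℝ] ℝ} {W : Submodule ℝ V}

/-- The component of `v` which is orthogonal to the partial symplectic basis `p, q`. -/
def symplecticComplement (Ω : V →ₗ[ℝ] V →ₗ[ℝ] ℝ) (p q : Fin m → V) (v : V) : V :=
  v - ∑ i, (Ω v (q i) • p i + Ω (p i) v • q i)

theorem symplecticComplement_mem {p q : Fin m → V} (h : IsSymplecticBasis Ω W p q) {v : V}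
    (hv : v ∈ W) : symplecticComplement Ω p q v ∈ W :=
  W.sub_mem hv (W.sum_mem fun i _ =>
    W.add_mem (W.smul_mem _ (h.p_mem i)) (W.smul_mem _ (h.q_mem i)))

theorem symplecticComplement_p {p q : Fin m → V}
    (h : IsSymplecticBasis Ω W p q) (v : V) (j : Fin m) :
    Ω (p j) (symplecticComplement Ω p q v) = 0 := by
  simp [symplecticComplement, h.p_p, h.p_q]

theorem symplecticComplement_q {p q : Fin m → V}
    (h : IsSymplecticBasis Ω W p q) (v : V) (j : Fin m) :
    Ω (symplecticComplement Ω p q v) (q j) = 0 := by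
  simp [symplecticComplement, h.q_q, h.p_q]

/-- Adjoining a pair of vectors which is orthogonal to a partial symplectic basis. -/
theorem IsSymplecticBasis.snoc (hskew : ∀ v w, Ω v w = -Ω w v) {p q : Fin m → V}
    (h : IsSymplecticBasis Ω W p q) {v w : V} (hv : v ∈ W) (hw : w ∈ W) (hvw : Ω v w = 1)
    (hvp : ∀ j, Ω (p j) v = 0) (hvq : ∀ j, Ω v (q j) = 0)
    (hwp : ∀ j, Ω (p j) w = 0) (hwq : ∀ j, Ω w (q j) = 0) :
    IsSymplecticBasis Ω W (Fin.snoc (α := fun _ => V) p v) (Fin.snoc (α := fun _ => V) q w) := by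
  have hself : ∀ u, Ω u u = 0 := fun u => by linarith [hskew u u]
  constructor
  · intro i
    refine Fin.lastCases ?_ (fun i => ?_) i
    · simpa using hv
    · simpa using h.p_mem i
  · intro i
    refine Fin.lastCases ?_ (fun i => ?_) i
    · simpa using hw
    · simpa using h.q_mem i
  · intro i j
    refine Fin.lastCases ?_ (fun i => ?_) i <;> refine Fin.lastCases ?_ (fun j => ?_) j
    · simpa using hself v
    · simp [hskew v (p j), hvp]
    · simpa using hvp i
    · simpa using h.p_p i j
  · intro i j
    refine Fin.lastCases ?_ (fun i => ?_) i <;> refine Fin.lastCases ?_ (fun j => ?_) j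
    · simpa using hself w
    · simpa using hwq j
    · simp [hskew (q i) w, hwq]
    · simpa using h.q_q i j
  · intro i j
    refine Fin.lastCases ?_ (fun i => ?_) i <;> refine Fin.lastCases ?_ (fun j => ?_) j
    · simpa using hvw
    · simpa [(Fin.castSucc_lt_last j).ne'] using hvq j
    · simpa [(Fin.castSucc_lt_last i).ne] using hwp i
    · simpa using h.p_q i j

/-- The vector which has with respect to `p', q'` the coordinates of `u` with respect to `p, q`. -/
def transferVec (Ω : V →ₗ[ℝ] V →ₗ[ℝ] ℝ) (p q p' q' : Fin n → V) (u : V) : V :=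
  ∑ j, (Ω u (q j) • p' j + Ω (p j) u • q' j)

/-- Vectors with the same coordinates in two symplectic bases have the same pairings. -/
theorem transferVec_form [FiniteDimensional ℝ V] {Ω' : V →ₗ[ℝ] V →ₗ[ℝ] ℝ} {W' : Submodule ℝ V}
    {p q p' q' : Fin n → V} (hΩ : IsSymplecticOn n Ω W) (h : IsSymplecticBasis Ω W p q)
    (hskew : ∀ v w, Ω' v w = -Ω' w v) (h' : IsSymplecticBasis Ω' W' p' q') {u v : V} (hu : u ∈ W) :
    Ω' (transferVec Ω p q p' q' u) (transferVec Ω p q p' q' v) = Ω u v := by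
  have hqp : ∀ i j, Ω' (q' i) (p' j) = if j = i then -1 else 0 := fun i j => by
    rw [hskew, h'.p_q]; split_ifs <;> simp
  rw [h.form_eq hΩ hu]
  simp only [transferVec, map_sum, map_add, LinearMap.sum_apply, LinearMap.add_apply, map_smul,
    LinearMap.smul_apply, smul_eq_mul, h'.p_p, h'.q_q, h'.p_q, hqp, mul_zero, zero_add, add_zero]
  simp only [mul_ite, mul_one, mul_zero, mul_neg, Finset.sum_add_distrib, Finset.sum_ite_eq,
    Finset.sum_ite_eq', Finset.mem_univ, if_true, Finset.sum_sub_distrib]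
  simp only [← Finset.sum_add_distrib, ← Finset.sum_sub_distrib]
  refine Finset.sum_congr rfl fun j _ => ?_
  rw [hΩ.skew (q j) v, hΩ.skew (q j) u]
  ring

end LinearAlgebra

section Frames

variable {n : ℕ} {M : Type u} [TopologicalSpace M] [ChartedSpace (Model n) M]
  [IsManifold (𝓡 (2 * n + 1)) ∞ M] (C : ContactForm n M) {X : Type*} [TopologicalSpace X]

/-- `p, q` is over `S` a continuous frame of `f^*ξ` (for `m = n`; in general of a subbundle),
symplectic at every point. -/
structure IsFrame {m : ℕ} (S : Set X) (f : X → M) (p q : X → Fin m → Model n) : Prop where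
  cont_p : ∀ i, ContSection S f (fun z => p z i)
  cont_q : ∀ i, ContSection S f (fun z => q z i)
  basis : ∀ z ∈ S, IsSymplecticBasis (dForm C (f z)) (xiSpace C (f z)) (p z) (q z)

variable {C} {S : Set X} {f : X → M}

theorem IsFrame.mono {m : ℕ} {p q : X → Fin m → Model n} (h : IsFrame C S f p q) {T : Set X}
    (hT : T ⊆ S) : IsFrame C T f p q :=
  ⟨fun i => (h.cont_p i).mono hT, fun i => (h.cont_q i).mono hT, fun z hz => h.basis z (hT hz)⟩

theorem IsFrame.comp {m : ℕ} {p q : X → Fin m → Model n} (h : IsFrame C S f p q) {Y : Type*}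
    [TopologicalSpace Y] {T : Set Y} {φ : Y → X} (hφ : ContinuousOn φ T) (hm : MapsTo φ T S) :
    IsFrame C T (fun y => f (φ y)) (fun y => p (φ y)) (fun y => q (φ y)) :=
  ⟨fun i => (h.cont_p i).comp hφ hm, fun i => (h.cont_q i).comp hφ hm,
    fun _ hz => h.basis _ (hm hz)⟩

theorem IsFrame.congr {m : ℕ} {p q : X → Fin m → Model n} (h : IsFrame C S f p q) {g : X → M}
    (hg : ∀ z ∈ S, g z = f z) : IsFrame C S g p q :=
  ⟨fun i => (h.cont_p i).congr hg fun _ _ => rfl, fun i => (h.cont_q i).congr hg fun _ _ => rfl,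
    fun z hz => by rw [hg z hz]; exact h.basis z hz⟩

theorem contSection_symplecticComplement {m : ℕ} {p q : X → Fin m → Model n}
    (h : IsFrame C S f p q) (hf : ContinuousOn f S) {v : X → Model n} (hv : ContSection S f v) :
    ContSection S f (fun z => symplecticComplement (dForm C (f z)) (p z) (q z) (v z)) :=
  hv.sub (ContSection.sum _ hf fun i _ =>
    (ContSection.smul (hv.dForm C (h.cont_q i)) (h.cont_p i)).add
      (ContSection.smul ((h.cont_p i).dForm C hv) (h.cont_q i)))

/-- A vector of `ξ` extends locally to a continuous section of `f^*ξ`. -/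
theorem exists_contSection_xiSpace (hf : ContinuousOn f S) {z₀ : X} (hz₀ : z₀ ∈ S) {v : Model n}
    (hv : v ∈ xiSpace C (f z₀)) :
    ∃ U ∈ 𝓝[S] z₀, U ⊆ S ∧ ∃ s : X → Model n, ContSection U f s ∧
      (∀ z ∈ U, s z ∈ xiSpace C (f z)) ∧ s z₀ = v := by
  obtain ⟨x, hx⟩ : ∃ x : Model n, C.form (f z₀) x ≠ 0 := by
    by_contra hcon
    push Not at hcon
    exact C.ne_zero (f z₀) (ContinuousLinearMap.ext hcon)
  obtain ⟨U₁, hU₁, hUS₁, s, hs, hs0⟩ := exists_contSection_extend hf hz₀ v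
  obtain ⟨U₂, hU₂, hUS₂, r, hr, hr0⟩ := exists_contSection_extend hf hz₀ x
  have hz₂ : z₀ ∈ U₂ := mem_of_mem_nhdsWithin hz₀ hU₂
  have hz₁ : z₀ ∈ U₁ := mem_of_mem_nhdsWithin hz₀ hU₁
  have hne : ∀ᶠ z in 𝓝[S] z₀, C.form (f z) (r z) ≠ 0 := by
    have h1 : ContinuousWithinAt (fun z => C.form (f z) (r z)) S z₀ :=
      (hr.form C z₀ hz₂).mono_of_mem_nhdsWithin hU₂
    have h2 : C.form (f z₀) (r z₀) = C.form (f z₀) x :=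
      congrArg (fun t : Model n => C.form (f z₀) t) hr0
    exact h1.eventually_ne (h2.trans_ne hx)
  let U := U₁ ∩ U₂ ∩ {z | C.form (f z) (r z) ≠ 0}
  have hU : U ∈ 𝓝[S] z₀ := Filter.inter_mem (Filter.inter_mem hU₁ hU₂) hne
  have hs' : ContSection U f s := hs.mono fun z hz => hz.1.1
  have hr' : ContSection U f r := hr.mono fun z hz => hz.1.2
  refine ⟨U, hU, fun z hz => hUS₁ hz.1.1,
    fun z => s z - (C.form (f z) (s z) / C.form (f z) (r z)) • r z, ?_, ?_, ?_⟩
  · exact hs'.sub (hr'.smul ((hs'.form C).div (hr'.form C) fun z hz => hz.2))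
  · intro z hz
    have h1 : C.form (f z) (r z) ≠ 0 := hz.2
    rw [mem_xiSpace]
    refine (map_sub (C.form (f z)) (s z) _).trans ?_
    have h2 : C.form (f z) ((C.form (f z) (s z) / C.form (f z) (r z)) • r z) =
        (C.form (f z) (s z) / C.form (f z) (r z)) * C.form (f z) (r z) :=
      map_smul (C.form (f z)) _ (r z)
    refine (congrArg (fun t => C.form (f z) (s z) - t) h2).trans ?_
    rw [div_mul_cancel₀ _ h1, sub_self]
  · have h0 : C.form (f z₀) (s z₀) = 0 :=
      (congrArg (fun t : Model n => C.form (f z₀) t) hs0).trans hv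
    have h1 : C.form (f z₀) (s z₀) / C.form (f z₀) (r z₀) = 0 := by
      refine (congrArg (fun t : ℝ => t / C.form (f z₀) (r z₀)) h0).trans (zero_div _)
    refine (congrArg (fun t : ℝ => s z₀ - t • r z₀) h1).trans ?_
    beta_reduce
    rw [zero_smul, sub_zero, hs0]

/-- Symplectic frames exist locally: a partial symplectic basis is extended one pair at a time. -/
theorem exists_isFrame_local (hf : ContinuousOn f S) {z₀ : X} (hz₀ : z₀ ∈ S) (m : ℕ) (hm : m ≤ n) :
    ∃ U ∈ 𝓝[S] z₀, U ⊆ S ∧ ∃ p q : X → Fin m → Model n, IsFrame C U f p q := by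
  induction m with
  | zero =>
    exact ⟨S, self_mem_nhdsWithin, subset_rfl, fun _ i => i.elim0, fun _ i => i.elim0,
      fun i => i.elim0, fun i => i.elim0, fun z _ => ⟨fun i => i.elim0, fun i => i.elim0,
        fun i => i.elim0, fun i => i.elim0, fun i => i.elim0⟩⟩
  | succ m ih =>
    obtain ⟨U, hU, hUS, p, q, hpq⟩ := ih (by omega)
    have hzU : z₀ ∈ U := mem_of_mem_nhdsWithin hz₀ hU
    have hb := hpq.basis z₀ hzU
    have hΩ := isSymplecticOn_xiSpace C (f z₀)
    -- by dimension, some vector of `ξ` at `z₀` is not in the span of the partial basis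
    obtain ⟨v₀, hv₀, hv₀n⟩ : ∃ v ∈ xiSpace C (f z₀),
        v ∉ Submodule.span ℝ (range (Sum.elim (p z₀) (q z₀))) := by
      by_contra hcon
      push Not at hcon
      have h1 := Submodule.finrank_mono (R := ℝ) (M := Model n) (s := xiSpace C (f z₀)) hcon
      rw [hΩ.finrank_eq, finrank_span_eq_card hb.linearIndependent] at h1
      simp at h1
      omega
    obtain ⟨U₁, hU₁, hUS₁, v, hvc, hvξ, hv0⟩ := exists_contSection_xiSpace (C := C) hf hz₀ hv₀
    let v' : X → Model n := fun z => symplecticComplement (dForm C (f z)) (p z) (q z) (v z)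
    have hv'0 : v' z₀ ≠ 0 := by
      intro h0
      apply hv₀n
      have h1 : v z₀ = ∑ i, (dForm C (f z₀) (v z₀) (q z₀ i) • p z₀ i +
          dForm C (f z₀) (p z₀ i) (v z₀) • q z₀ i) := sub_eq_zero.1 h0
      rw [← hv0, h1]
      refine Submodule.sum_mem _ fun i _ => Submodule.add_mem _ (Submodule.smul_mem _ _ ?_)
        (Submodule.smul_mem _ _ ?_)
      · exact Submodule.subset_span ⟨Sum.inl i, rfl⟩
      · exact Submodule.subset_span ⟨Sum.inr i, rfl⟩
    have hz₁ : z₀ ∈ U₁ := mem_of_mem_nhdsWithin hz₀ hU₁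
    -- its complement pairs nontrivially with some `w₀`; nearby, the pairing can be normalized
    obtain ⟨w₀, hw₀, hw₀n⟩ : ∃ w ∈ xiSpace C (f z₀), dForm C (f z₀) (v' z₀) w ≠ 0 := by
      by_contra hcon
      push Not at hcon
      exact hv'0 (hΩ.nondegenerate _ (symplecticComplement_mem hb (hvξ z₀ hz₁)) hcon)
    obtain ⟨U₂, hU₂, hUS₂, w, hwc, hwξ, hw0⟩ := exists_contSection_xiSpace (C := C) hf hz₀ hw₀
    have hz₂ : z₀ ∈ U₂ := mem_of_mem_nhdsWithin hz₀ hU₂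
    let w' : X → Model n := fun z => symplecticComplement (dForm C (f z)) (p z) (q z) (w z)
    let T := U ∩ U₁ ∩ U₂
    have hT : T ∈ 𝓝[S] z₀ := Filter.inter_mem (Filter.inter_mem hU hU₁) hU₂
    have hzT : z₀ ∈ T := ⟨⟨hzU, hz₁⟩, hz₂⟩
    have hpqT : IsFrame C T f p q := hpq.mono fun z hz => hz.1.1
    have hfT : ContinuousOn f T := hf.mono fun z hz => hUS hz.1.1
    have hv'c : ContSection T f v' := contSection_symplecticComplement hpqT hfT
      (hvc.mono fun z hz => hz.1.2)
    have hw'c : ContSection T f w' := contSection_symplecticComplement hpqT hfT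
      (hwc.mono fun z hz => hz.2)
    have hpair : dForm C (f z₀) (v' z₀) (w' z₀) ≠ 0 := by
      have h1 : dForm C (f z₀) (v' z₀) (w' z₀) = dForm C (f z₀) (v' z₀) (w z₀) := by
        have e1 := symplecticComplement_q hb (v z₀)
        have e2 := symplecticComplement_p hb (v z₀)
        have e3 : ∀ i, dForm C (f z₀) (v' z₀) (p z₀ i) = 0 := fun i => by
          rw [hΩ.skew, e2, neg_zero]
        have e4 : ∀ i, dForm C (f z₀) (v' z₀) (q z₀ i) = 0 := e1
        change dForm C (f z₀) (v' z₀) (w z₀ - _) = _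
        simp [map_sum, e3, e4]
      rw [h1, hw0]
      exact hw₀n
    have hne : ∀ᶠ z in 𝓝[S] z₀, dForm C (f z) (v' z) (w' z) ≠ 0 := by
      have h1 : ContinuousWithinAt (fun z => dForm C (f z) (v' z) (w' z)) S z₀ :=
        (hv'c.dForm C hw'c z₀ hzT).mono_of_mem_nhdsWithin hT
      exact h1.eventually_ne hpair
    let U' := T ∩ {z | dForm C (f z) (v' z) (w' z) ≠ 0}
    have hsub : U' ⊆ T := inter_subset_left
    let w'' : X → Model n := fun z => (dForm C (f z) (v' z) (w' z))⁻¹ • w' z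
    have hw''c : ContSection U' f w'' := (hw'c.mono hsub).smul
      (((hv'c.mono hsub).dForm C (hw'c.mono hsub)).inv₀ fun z hz => hz.2)
    refine ⟨U', Filter.inter_mem hT hne, fun z hz => hUS hz.1.1.1,
      fun z => Fin.snoc (α := fun _ => Model n) (p z) (v' z),
      fun z => Fin.snoc (α := fun _ => Model n) (q z) (w'' z), ?_, ?_, ?_⟩
    · intro i
      refine Fin.lastCases ?_ (fun i => ?_) i
      · simpa using hv'c.mono hsub
      · simpa using (hpqT.cont_p i).mono hsub
    · intro i
      refine Fin.lastCases ?_ (fun i => ?_) i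
      · simpa using hw''c
      · simpa using (hpqT.cont_q i).mono hsub
    · intro z hz
      have hbz := hpqT.basis z hz.1
      have hskew := (isSymplecticOn_xiSpace C (f z)).skew
      have hne' : dForm C (f z) (v' z) (w' z) ≠ 0 := hz.2
      refine hbz.snoc hskew (symplecticComplement_mem hbz (hvξ z hz.1.1.2))
        ((xiSpace C (f z)).smul_mem _ (symplecticComplement_mem hbz (hwξ z hz.1.2))) ?_
        (symplecticComplement_p hbz _) (symplecticComplement_q hbz _) ?_ ?_
      · change dForm C (f z) (v' z) ((dForm C (f z) (v' z) (w' z))⁻¹ • w' z) = 1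
        rw [map_smul, smul_eq_mul, inv_mul_cancel₀ hne']
      · intro j
        rw [map_smul, symplecticComplement_p hbz, smul_zero]
      · intro j
        rw [map_smul, LinearMap.smul_apply, symplecticComplement_q hbz, smul_zero]

variable (C) in
/-- The symplectic bundle `f^*ξ` is trivial over `S`. -/
def HasFrame (S : Set X) (f : X → M) : Prop := ∃ p q : X → Fin n → Model n, IsFrame C S f p q

theorem HasFrame.mono (h : HasFrame C S f) {T : Set X} (hT : T ⊆ S) : HasFrame C T f := by
  obtain ⟨p, q, h⟩ := h
  exact ⟨p, q, h.mono hT⟩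

/-- Frames over two closed sets can be glued if one of them retracts onto the intersection: the
transition matrix extends along the retraction. -/
theorem HasFrame.union {S T : Set X} (hS : IsClosed S) (hT : IsClosed T) (h : HasFrame C S f)
    (h' : HasFrame C T f) {ρ : X → X} (hρ : ContinuousOn ρ T) (hm : MapsTo ρ T (S ∩ T))
    (hid : ∀ z ∈ S ∩ T, ρ z = z) (hf : ContinuousOn f (S ∪ T)) : HasFrame C (S ∪ T) f := by
  classical
  obtain ⟨p, q, h⟩ := h
  obtain ⟨p', q', h'⟩ := h'
  have hfT : ContinuousOn f T := hf.mono subset_union_right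
  -- `τ u` is the vector field over `T` with constant coordinates along the fibres of `ρ`
  let τ : (X → Model n) → X → Model n := fun u z =>
    transferVec (dForm C (f (ρ z))) (p' (ρ z)) (q' (ρ z)) (p' z) (q' z) (u (ρ z))
  have hτc : ∀ u : X → Model n, ContSection S f u → ContSection T f (τ u) := fun u hu => by
    have hu' : ContSection (S ∩ T) f u := hu.mono inter_subset_left
    refine ContSection.sum _ hfT fun j _ => ContSection.add ?_ ?_
    · refine ContSection.smul ?_ (h'.cont_p j)
      exact (hu'.dForm C ((h'.cont_q j).mono inter_subset_right)).comp hρ hm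
    · refine ContSection.smul ?_ (h'.cont_q j)
      exact (((h'.cont_p j).mono inter_subset_right).dForm C hu').comp hρ hm
  have hτid : ∀ u : X → Model n, (∀ z ∈ S, u z ∈ xiSpace C (f z)) → ∀ z ∈ S ∩ T, τ u z = u z :=
    fun u hu z hz => by
      simp only [τ, hid z hz]
      exact ((h'.basis z hz.2).expand (isSymplecticOn_xiSpace C (f z)) (hu z hz.1)).symm
  let glue : (X → Model n) → X → Model n := fun u z => if z ∈ S then u z else τ u z
  have hglue : ∀ u : X → Model n, ContSection S f u → (∀ z ∈ S, u z ∈ xiSpace C (f z)) →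
      ContSection (S ∪ T) f (glue u) := fun u hu huξ => by
    refine ContinuousOn.union_of_isClosed ?_ ?_ hS hT
    · exact hu.congr (fun _ _ => rfl) fun z hz => if_pos hz
    · refine (hτc u hu).congr (fun _ _ => rfl) fun z hz => ?_
      by_cases hzS : z ∈ S
      · simp only [glue, if_pos hzS]
        exact (hτid u huξ z ⟨hzS, hz⟩).symm
      · simp only [glue, if_neg hzS]
  refine ⟨fun z i => glue (fun y => p y i) z, fun z i => glue (fun y => q y i) z, ?_, ?_, ?_⟩
  · exact fun i => hglue _ (h.cont_p i) fun z hz => (h.basis z hz).p_mem i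
  · exact fun i => hglue _ (h.cont_q i) fun z hz => (h.basis z hz).q_mem i
  · intro z hz
    by_cases hzS : z ∈ S
    · simp only [glue, if_pos hzS]
      exact h.basis z hzS
    · have hzT : z ∈ T := hz.resolve_left hzS
      have hρz := hm hzT
      have hb := h.basis _ hρz.1
      have hb' := h'.basis _ hρz.2
      have hbz := h'.basis _ hzT
      simp only [glue, if_neg hzS]
      have hmem : ∀ u, τ u z ∈ xiSpace C (f z) := fun u =>
        Submodule.sum_mem _ fun j _ => Submodule.add_mem _ (Submodule.smul_mem _ _ (hbz.p_mem j))
          (Submodule.smul_mem _ _ (hbz.q_mem j))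
      have hform : ∀ u v : X → Model n, u (ρ z) ∈ xiSpace C (f (ρ z)) →
          dForm C (f z) (τ u z) (τ v z) = dForm C (f (ρ z)) (u (ρ z)) (v (ρ z)) := fun u v hu =>
        transferVec_form (isSymplecticOn_xiSpace C (f (ρ z))) hb'
          (isSymplecticOn_xiSpace C (f z)).skew hbz hu
      have hpp := fun i j => (hform (fun y => p y i) (fun y => p y j) (hb.p_mem i)).trans
        (hb.p_p i j)
      have hqq := fun i j => (hform (fun y => q y i) (fun y => q y j) (hb.q_mem i)).trans
        (hb.q_q i j)
      have hpq := fun i j => (hform (fun y => p y i) (fun y => q y j) (hb.p_mem i)).trans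
        (hb.p_q i j)
      clear_value τ
      exact ⟨fun i => hmem _, fun i => hmem _, hpp, hqq, hpq⟩

/-- A property of intervals which is additive and holds for all intervals of a subdivision holds for
the whole interval. -/
theorem interval_subdivision {P : ℝ → ℝ → Prop} {N : ℕ} (hN : 0 < N)
    (hcell : ∀ i < N, P ((i : ℝ) / N) (((i : ℝ) + 1) / N))
    (hglue : ∀ a b c, a ≤ b → b ≤ c → P a b → P b c → P a c) : P 0 1 := by
  have hN' : (0 : ℝ) < N := by exact_mod_cast hN
  have key : ∀ m : ℕ, m + 1 ≤ N → P 0 (((m : ℝ) + 1) / N) := by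
    intro m
    induction m with
    | zero => intro _; simpa using hcell 0 hN
    | succ m ih =>
      intro hm
      have h1 := ih (by omega)
      have h2 := hcell (m + 1) (by omega)
      push_cast at h2 ⊢
      refine hglue _ _ _ (by positivity) ?_ h1 h2
      gcongr
      linarith
  have := key (N - 1) (by omega)
  rwa [Nat.cast_sub hN, Nat.cast_one, sub_add_cancel, div_self hN'.ne'] at this

/-- The unit cube. -/
def unitCube : Set (ℝ × ℝ × ℝ) := Icc 0 1 ×ˢ Icc 0 1 ×ˢ Icc 0 1

/-- Symplectic bundles over the cube are trivial. -/
theorem hasFrame_unitCube {f : ℝ × ℝ × ℝ → M} (hf : ContinuousOn f unitCube) :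
    HasFrame C unitCube f := by
  have hcpt : IsCompact unitCube := isCompact_Icc.prod (isCompact_Icc.prod isCompact_Icc)
  have hloc : ∀ z : unitCube, ∃ O : Set (ℝ × ℝ × ℝ), IsOpen O ∧ (z : ℝ × ℝ × ℝ) ∈ O ∧
      HasFrame C (O ∩ unitCube) f := fun z => by
    obtain ⟨U, hU, -, p, q, hpq⟩ := exists_isFrame_local (C := C) hf z.2 n le_rfl
    obtain ⟨O, hO, hzO, hOU⟩ := mem_nhdsWithin.1 hU
    exact ⟨O, hO, hzO, p, q, hpq.mono hOU⟩
  choose O hO hzO hframe using hloc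
  -- cells smaller than a Lebesgue number have frames
  obtain ⟨δ, hδ, hball⟩ := lebesgue_number_lemma_of_metric hcpt hO
    (fun z hz => mem_iUnion.2 ⟨⟨z, hz⟩, hzO ⟨z, hz⟩⟩)
  obtain ⟨N, hN⟩ := exists_nat_one_div_lt hδ
  have hN0 : (0 : ℝ) < (N + 1 : ℕ) := by positivity
  have hcell : ∀ i < N + 1, ∀ j < N + 1, ∀ l < N + 1, HasFrame C
      (Icc ((i : ℝ) / (N + 1 : ℕ)) (((i : ℝ) + 1) / (N + 1 : ℕ)) ×ˢ
        Icc ((j : ℝ) / (N + 1 : ℕ)) (((j : ℝ) + 1) / (N + 1 : ℕ)) ×ˢ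
        Icc ((l : ℝ) / (N + 1 : ℕ)) (((l : ℝ) + 1) / (N + 1 : ℕ))) f := by
    intro i hi j hj l hl
    have hsub : ∀ i < N + 1, Icc ((i : ℝ) / (N + 1 : ℕ)) (((i : ℝ) + 1) / (N + 1 : ℕ)) ⊆
        Icc (0 : ℝ) 1 := fun i hi => by
      apply Icc_subset_Icc
      · positivity
      · rw [div_le_one hN0]
        exact_mod_cast hi
    have hmem : ∀ i < N + 1, (i : ℝ) / (N + 1 : ℕ) ∈ Icc (0 : ℝ) 1 := fun i hi =>
      hsub i hi (left_mem_Icc.2 (by gcongr; linarith))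
    have hdist : ∀ i : ℕ, ∀ t ∈ Icc ((i : ℝ) / (N + 1 : ℕ)) (((i : ℝ) + 1) / (N + 1 : ℕ)),
        dist t ((i : ℝ) / (N + 1 : ℕ)) < δ := fun i t ht => by
      rw [Real.dist_eq, abs_of_nonneg (by linarith [ht.1])]
      have h2 := ht.2
      rw [add_div] at h2
      push_cast at h2 ⊢
      linarith
    obtain ⟨z, hz⟩ := hball ((i : ℝ) / (N + 1 : ℕ), (j : ℝ) / (N + 1 : ℕ), (l : ℝ) / (N + 1 : ℕ))
      ⟨hmem i hi, hmem j hj, hmem l hl⟩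
    refine (hframe z).mono ?_
    rintro ⟨x, y, t⟩ ⟨hx, hy, ht⟩
    refine ⟨hz ?_, hsub i hi hx, hsub j hj hy, hsub l hl ht⟩
    rw [Metric.mem_ball, Prod.dist_eq, Prod.dist_eq]
    exact max_lt (hdist i x hx) (max_lt (hdist j y hy) (hdist l t ht))
  have hNpos : 0 < N + 1 := Nat.succ_pos N
  -- glue the cells along the three coordinate directions
  refine interval_subdivision (P := fun a b => Icc a b ⊆ Icc 0 1 → HasFrame C
    (Icc a b ×ˢ Icc 0 1 ×ˢ Icc 0 1) f) hNpos (fun i hi hI => ?_) ?_ subset_rfl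
  · refine interval_subdivision (P := fun a b => Icc a b ⊆ Icc 0 1 → HasFrame C
      (Icc ((i : ℝ) / (N + 1 : ℕ)) (((i : ℝ) + 1) / (N + 1 : ℕ)) ×ˢ Icc a b ×ˢ Icc 0 1) f)
      hNpos (fun j hj hJ => ?_) ?_ subset_rfl
    · refine interval_subdivision (P := fun a b => Icc a b ⊆ Icc 0 1 → HasFrame C
        (Icc ((i : ℝ) / (N + 1 : ℕ)) (((i : ℝ) + 1) / (N + 1 : ℕ)) ×ˢ
          Icc ((j : ℝ) / (N + 1 : ℕ)) (((j : ℝ) + 1) / (N + 1 : ℕ)) ×ˢ Icc a b) f) hNpos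
        (fun l hl _ => hcell i hi j hj l hl) ?_ subset_rfl
      intro a b c hab hbc h1 h2 hac
      have hu : Icc a c = Icc a b ∪ Icc b c := (Icc_union_Icc_eq_Icc hab hbc).symm
      rw [hu, prod_union, prod_union]
      refine HasFrame.union (ρ := fun z => (z.1, z.2.1, b)) ?_ ?_
        (h1 ((Icc_subset_Icc_right hbc).trans hac)) (h2 ((Icc_subset_Icc_left hab).trans hac))
        (by fun_prop) ?_ ?_ ?_
      · exact isClosed_Icc.prod (isClosed_Icc.prod isClosed_Icc)
      · exact isClosed_Icc.prod (isClosed_Icc.prod isClosed_Icc)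
      · rintro ⟨x, y, z⟩ ⟨hx, hy, hz⟩
        exact ⟨⟨hx, hy, right_mem_Icc.2 hab⟩, hx, hy, left_mem_Icc.2 hbc⟩
      · rintro ⟨x, y, z⟩ ⟨⟨hx, hy, hz⟩, -, -, hz'⟩
        exact Prod.ext rfl (Prod.ext rfl (le_antisymm hz'.1 hz.2))
      · rw [← prod_union, ← prod_union, ← hu]
        exact hf.mono (prod_mono hI (prod_mono hJ hac))
    · intro a b c hab hbc h1 h2 hac
      have hu : Icc a c = Icc a b ∪ Icc b c := (Icc_union_Icc_eq_Icc hab hbc).symm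
      rw [hu, union_prod, prod_union]
      refine HasFrame.union (ρ := fun z => (z.1, b, z.2.2)) ?_ ?_
        (h1 ((Icc_subset_Icc_right hbc).trans hac)) (h2 ((Icc_subset_Icc_left hab).trans hac))
        (by fun_prop) ?_ ?_ ?_
      · exact isClosed_Icc.prod (isClosed_Icc.prod isClosed_Icc)
      · exact isClosed_Icc.prod (isClosed_Icc.prod isClosed_Icc)
      · rintro ⟨x, y, z⟩ ⟨hx, hy, hz⟩
        exact ⟨⟨hx, right_mem_Icc.2 hab, hz⟩, hx, left_mem_Icc.2 hbc, hz⟩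
      · rintro ⟨x, y, z⟩ ⟨⟨hx, hy, hz⟩, -, hy', -⟩
        exact Prod.ext rfl (Prod.ext (le_antisymm hy'.1 hy.2) rfl)
      · rw [← prod_union, ← union_prod, ← hu]
        exact hf.mono (prod_mono hI (prod_mono hac subset_rfl))
  · intro a b c hab hbc h1 h2 hac
    have hu : Icc a c = Icc a b ∪ Icc b c := (Icc_union_Icc_eq_Icc hab hbc).symm
    rw [hu, union_prod]
    refine HasFrame.union (ρ := fun z => (b, z.2.1, z.2.2)) ?_ ?_
      (h1 ((Icc_subset_Icc_right hbc).trans hac)) (h2 ((Icc_subset_Icc_left hab).trans hac))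
      (by fun_prop) ?_ ?_ ?_
    · exact isClosed_Icc.prod (isClosed_Icc.prod isClosed_Icc)
    · exact isClosed_Icc.prod (isClosed_Icc.prod isClosed_Icc)
    · rintro ⟨x, y, z⟩ ⟨hx, hy, hz⟩
      exact ⟨⟨right_mem_Icc.2 hab, hy, hz⟩, left_mem_Icc.2 hbc, hy, hz⟩
    · rintro ⟨x, y, z⟩ ⟨⟨hx, hy, hz⟩, hx', -, -⟩
      exact Prod.ext (le_antisymm hx'.1 hx.2) rfl
    · rw [← union_prod, ← hu]
      exact hf.mono (prod_mono hac subset_rfl)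

end Frames

/-! ### The phase of a Lagrangian section in a symplectic frame -/

/-- The vectors of a frame, as a basis in the model space. -/
theorem IsFrameOf.isBasisOf {n : ℕ} {M : Type u} [TopologicalSpace M]
    [ChartedSpace (Model n) M] {A : TangentSubspace n M}
    {e : Fin n → TangentBundle (𝓡 (2 * n + 1)) M}
    (h : IsFrameOf A e) : (∀ j, e j = ⟨A.1, (e j).2⟩) ∧
      IsBasisOf (V := Model n) (fun j => (e j).2) A.2 := by
  obtain ⟨v, he, hv, hs⟩ := h
  have h1 : ∀ j, ((e j).2 : Model n) = v j := fun j =>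
    congrArg (fun x : TangentBundle (𝓡 (2 * n + 1)) M => (x.2 : Model n)) (he j)
  have h2 : (fun j => ((e j).2 : Model n)) = v := funext h1
  refine ⟨fun j => (he j).trans ?_, ?_⟩
  · exact congrArg (fun x : Model n => (⟨A.1, x⟩ : TangentBundle (𝓡 (2 * n + 1)) M)) (h1 j).symm
  · rw [h2]
    exact ⟨hv, hs⟩

section Phase

variable {n : ℕ} {M : Type u} [TopologicalSpace M] [ChartedSpace (Model n) M]
  [IsManifold (𝓡 (2 * n + 1)) ∞ M] {C : ContactForm n M} {X : Type*} [TopologicalSpace X]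
  {S : Set X} {f : X → M}

theorem IsLagrangian.isLagrangianIn {A : TangentSubspace n M} (h : IsLagrangian C A) :
    IsLagrangianIn n (dForm C A.1) (xiSpace C A.1) A.2 := ⟨h.1, h.2.1, h.2.2⟩

theorem IsLagrangianSection.mono {A : X → TangentSubspace n M} (h : IsLagrangianSection C S f A)
    {T : Set X} (hT : T ⊆ S) : IsLagrangianSection C T f A :=
  ⟨fun x hx => h.1 x (hT hx), fun x hx => h.2.1 x (hT hx), fun x hx => by
    obtain ⟨U, hU, e, he⟩ := h.2.2 x (hT hx)
    exact ⟨U, nhdsWithin_mono x hT hU, e, he⟩⟩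

theorem IsLagrangianSection.comp {A : X → TangentSubspace n M} (h : IsLagrangianSection C S f A)
    {Y : Type*} [TopologicalSpace Y] {T : Set Y} {φ : Y → X} (hφ : ContinuousOn φ T)
    (hm : MapsTo φ T S) : IsLagrangianSection C T (fun y => f (φ y)) (fun y => A (φ y)) :=
  ⟨fun x hx => h.1 _ (hm hx), fun x hx => h.2.1 _ (hm hx), fun x hx => by
    obtain ⟨U, hU, e, he, heA⟩ := h.2.2 _ (hm hx)
    have hV : T ∩ φ ⁻¹' U ∈ 𝓝[T] x :=
      Filter.inter_mem self_mem_nhdsWithin ((hφ x hx).tendsto_nhdsWithin hm hU)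
    exact ⟨T ∩ φ ⁻¹' U, hV, fun y => e (φ y),
      he.comp (hφ.mono inter_subset_left) fun y hy => hy.2, fun y hy => heA _ hy.2⟩⟩

theorem IsLagrangianSection.congr {A B : X → TangentSubspace n M}
    (h : IsLagrangianSection C S f A) {g : X → M} (hg : ∀ x ∈ S, g x = f x)
    (hB : ∀ x ∈ S, B x = A x) : IsLagrangianSection C S g B :=
  ⟨fun x hx => by rw [hB x hx, hg x hx, h.1 x hx], fun x hx => by rw [hB x hx]; exact h.2.1 x hx,
    fun x hx => by
      obtain ⟨U, hU, e, he, heA⟩ := h.2.2 x hx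
      exact ⟨U ∩ S, Filter.inter_mem hU self_mem_nhdsWithin, e, he.mono inter_subset_left,
        fun y hy => by rw [hB y hy.2]; exact heA y hy.1⟩⟩

/-- Continuity of the squared phase of the determinant of continuous functionals on a section of
the Grassmannian bundle. -/
theorem circleOn_phaseOf {A : X → TangentSubspace n M} (hA : IsLagrangianSection C S f A)
    {Φ : X → Fin n → Model n →ₗ[ℝ] ℂ}
    (hΦ : ∀ U ⊆ S, ∀ v : X → Model n, ContSection U f v →
      ∀ i, ContinuousOn (fun z => Φ z i (v z)) U)
    (h0 : ∀ z ∈ S, ∀ v : Fin n → Model n, IsBasisOf v (A z).2 → (valueMatrix (Φ z) v).det ≠ 0) :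
    CircleOn (fun z => phaseOf (Φ z) ((A z).2 : Submodule ℝ (Model n))) S := by
  refine ⟨fun z hz => ?_, fun z hz => ?_⟩
  · obtain ⟨U, hU, e, he, heA⟩ := hA.2.2 z hz
    have hzU : z ∈ U := mem_of_mem_nhdsWithin hz hU
    let v : Fin n → X → Model n := fun j y => (e y j).2
    have hv : ∀ j, ContSection (U ∩ S) f (v j) := fun j => by
      have h1 : ContinuousOn (fun y => e y j) (U ∩ S) :=
        ((continuous_apply j).comp_continuousOn he).mono inter_subset_left
      refine h1.congr fun y hy => ?_
      refine Eq.trans ?_ ((heA y hy.1).isBasisOf.1 j).symm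
      rw [hA.1 y hy.2]
    have hdet : ContinuousOn (fun y => (valueMatrix (Φ y) (fun j => v j y)).det) (U ∩ S) := by
      refine continuousOn_iff_continuous_domRestrict.2 (Continuous.matrix_det ?_)
      refine continuous_matrix fun i j => ?_
      exact continuousOn_iff_continuous_domRestrict.1 (hΦ _ inter_subset_right _ (hv j) i)
    have hb : ∀ y ∈ U ∩ S, IsBasisOf (fun j => v j y) ((A y).2 : Submodule ℝ (Model n)) :=
      fun y hy => (heA y hy.1).isBasisOf.2
    have h1 : ContinuousWithinAt (fun y => sqPhase (valueMatrix (Φ y) (fun j => v j y)).det)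
        (U ∩ S) z :=
      ContinuousAt.comp_continuousWithinAt (g := sqPhase)
        (f := fun y => (valueMatrix (Φ y) (fun j => v j y)).det)
        (continuousAt_sqPhase (h0 z hz _ (hb z ⟨hzU, hz⟩))) (hdet z ⟨hzU, hz⟩)
    have h2 := h1.congr (fun y hy => (hb y hy).phaseOf_eq (Φ y)) ((hb z ⟨hzU, hz⟩).phaseOf_eq (Φ z))
    exact h2.mono_of_mem_nhdsWithin (Filter.inter_mem hU self_mem_nhdsWithin)
  · obtain ⟨v, hv⟩ := (hA.2.1 z hz).isLagrangianIn.exists_basis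
    beta_reduce
    rw [hv.phaseOf_eq]
    exact norm_sqPhase (h0 z hz v hv)

variable (C) in
/-- The phase `det²` of the Lagrangian subspace `A` in the symplectic basis `p, q`. -/
noncomputable def phaseAt (p q : Fin n → Model n) (A : TangentSubspace n M) : ℂ :=
  phaseOf (complexCoord (dForm C A.1) p q) A.2

theorem IsFrame.continuousOn_complexCoord {p q : X → Fin n → Model n} (h : IsFrame C S f p q)
    {U : Set X} (hU : U ⊆ S) {v : X → Model n} (hv : ContSection U f v) (i : Fin n) :
    ContinuousOn (fun z => complexCoord (dForm C (f z)) (p z) (q z) i (v z)) U := by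
  simp only [complexCoord_apply]
  have h1 := hv.dForm C ((h.cont_q i).mono hU)
  have h2 := ((h.cont_p i).mono hU).dForm C hv
  exact (Complex.continuous_ofReal.comp_continuousOn h1).add
    ((Complex.continuous_ofReal.comp_continuousOn h2).mul continuousOn_const)

theorem circleOn_phaseAt {A : X → TangentSubspace n M} (hA : IsLagrangianSection C S f A)
    {p q : X → Fin n → Model n} (h : IsFrame C S f p q) :
    CircleOn (fun z => phaseAt C (p z) (q z) (A z)) S := by
  have h1 := circleOn_phaseOf hA (Φ := fun z => complexCoord (dForm C (f z)) (p z) (q z))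
    (fun U hU v hv i => h.continuousOn_complexCoord hU hv i) fun z hz v hv => by
      have hL := (hA.2.1 z hz).isLagrangianIn
      rw [hA.1 z hz] at hL
      exact det_complexCoord_ne_zero (isSymplecticOn_xiSpace C (f z)) (h.basis z hz) hL hv
  have h2 : ∀ z ∈ S, phaseAt C (p z) (q z) (A z) =
      phaseOf (complexCoord (dForm C (f z)) (p z) (q z)) ((A z).2 : Submodule ℝ (Model n)) :=
    fun z hz => by rw [phaseAt, hA.1 z hz]
  exact ⟨h1.1.congr h2, fun z hz => by beta_reduce; rw [h2 z hz]; exact h1.2 z hz⟩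

theorem SymplecticFrame.isFrame {D : Set (ℝ × ℝ)} {w : ℝ × ℝ → M} (F : SymplecticFrame C D w) :
    IsFrame C D w F.p F.q :=
  ⟨F.continuousOn_p, F.continuousOn_q, fun z hz =>
    ⟨F.p_mem z hz, F.q_mem z hz, F.d_p_p z hz, F.d_q_q z hz, F.d_p_q z hz⟩⟩

theorem SymplecticFrame.IsPhase.eq_phaseAt {D : Set (ℝ × ℝ)} {w : ℝ × ℝ → M}
    {F : SymplecticFrame C D w} {z : ℝ × ℝ} {A : TangentSubspace n M} {ζ : ℂ}
    (h : F.IsPhase z A ζ) : ζ = phaseAt C (F.p z) (F.q z) A := by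
  obtain ⟨v, hv, rfl, Z, hZ, rfl⟩ := h
  have hb : IsBasisOf (V := Model n) v (Submodule.span ℝ (range v)) := ⟨hv, rfl⟩
  refine Eq.trans ?_ (hb.phaseOf_eq (complexCoord (dForm C (w z)) (F.p z) (F.q z))).symm
  have : Z = valueMatrix (complexCoord (dForm C (w z)) (F.p z) (F.q z)) v := by
    ext i j
    rw [hZ i j]
    exact (complexCoord_apply (Ω := dForm C (w z)) (p := F.p z) (q := F.q z) i (v j)).symm
  rw [this]
  rfl

theorem SymplecticFrame.isPhase_phaseAt {D : Set (ℝ × ℝ)} {w : ℝ × ℝ → M}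
    (F : SymplecticFrame C D w) {z : ℝ × ℝ} {A : TangentSubspace n M} (hA : A.1 = w z)
    (hL : IsLagrangian C A) : F.IsPhase z A (phaseAt C (F.p z) (F.q z) A) := by
  obtain ⟨x, L⟩ := A
  obtain rfl : x = w z := hA
  obtain ⟨v, hv⟩ := hL.isLagrangianIn.exists_basis
  refine ⟨v, hv.1, congrArg (Sigma.mk (w z)) hv.2.symm,
    valueMatrix (complexCoord (dForm C (w z)) (F.p z) (F.q z)) v,
    fun i j => complexCoord_apply (Ω := dForm C (w z)) (p := F.p z) (q := F.q z) i (v j), ?_⟩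
  exact hv.phaseOf_eq _

end Phase

/-! ### Change of frame and homotopy -/

section FrameChangePhase

variable {V : Type*} [AddCommGroup V] [Module ℝ V] {n : ℕ}
  {Ω : V →ₗ[ℝ] V →ₗ[ℝ] ℝ} {W L : Submodule ℝ V} {p q p' q' : Fin n → V}

theorem IsSymplecticBasis.isBasisOf_span (h : IsSymplecticBasis Ω W p q) :
    IsBasisOf p (Submodule.span ℝ (range p)) :=
  ⟨h.linearIndependent.comp Sum.inl Sum.inl_injective, rfl⟩

theorem IsSymplecticBasis.isLagrangianIn_span (h : IsSymplecticBasis Ω W p q) :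
    IsLagrangianIn n Ω W (Submodule.span ℝ (range p)) where
  finrank_eq := by rw [finrank_span_eq_card h.isBasisOf_span.1, Fintype.card_fin]
  le := Submodule.span_le.2 (by rintro _ ⟨i, rfl⟩; exact h.p_mem i)
  isotropic v hv w hw := by
    induction hv, hw using Submodule.span_induction₂ with
    | mem_mem x y hx hy =>
      obtain ⟨i, rfl⟩ := hx
      obtain ⟨j, rfl⟩ := hy
      exact h.p_p i j
    | zero_left => simp
    | zero_right => simp
    | add_left _ _ _ _ _ _ h1 h2 => simp [h1, h2]
    | add_right _ _ _ _ _ _ h1 h2 => simp [h1, h2]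
    | smul_left _ _ _ _ _ h1 => simp [h1]
    | smul_right _ _ _ _ _ h1 => simp [h1]

/-- The complex linear part of a change of symplectic basis is invertible. -/
theorem det_linearPart_ne_zero [FiniteDimensional ℝ V] (hΩ : IsSymplecticOn n Ω W)
    (h : IsSymplecticBasis Ω W p q) (h' : IsSymplecticBasis Ω W p' q') :
    (linearPart Ω p q p' q').det ≠ 0 := by
  have h1 := det_interpolatedCoord_ne_zero hΩ h h' h.isLagrangianIn_span h.isBasisOf_span
    (s := 0) (by simp)
  rw [valueMatrix_interpolatedCoord] at h1
  simp only [Complex.ofReal_zero, zero_smul, add_zero, Matrix.det_mul] at h1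
  exact left_ne_zero_of_mul h1

/-- For `s = 0` the interpolation multiplies the phase by that of `det α`. -/
theorem IsLagrangianIn.phaseOf_interpolatedCoord_zero [FiniteDimensional ℝ V]
    (hL : IsLagrangianIn n Ω W L) :
    phaseOf (interpolatedCoord Ω p q p' q' 0) L =
      sqPhase (linearPart Ω p q p' q').det * phaseOf (complexCoord Ω p q) L := by
  obtain ⟨v, hv⟩ := hL.exists_basis
  rw [hv.phaseOf_eq, hv.phaseOf_eq, valueMatrix_interpolatedCoord, ← sqPhase_mul]
  simp [Matrix.det_mul]

/-- For `s = 1` the interpolation yields the phase in the new basis. -/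
theorem IsLagrangianIn.phaseOf_interpolatedCoord_one [FiniteDimensional ℝ V]
    (hΩ : IsSymplecticOn n Ω W) (h : IsSymplecticBasis Ω W p q) (hL : IsLagrangianIn n Ω W L) :
    phaseOf (interpolatedCoord Ω p q p' q' 1) L = phaseOf (complexCoord Ω p' q') L := by
  obtain ⟨v, hv⟩ := hL.exists_basis
  rw [hv.phaseOf_eq, hv.phaseOf_eq]
  congr 2
  ext i j
  exact interpolatedCoord_one hΩ h (hL.le (hv.mem j)) i

end FrameChangePhase

section Transport

variable {n : ℕ} {M : Type u} [TopologicalSpace M] [ChartedSpace (Model n) M]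
  [IsManifold (𝓡 (2 * n + 1)) ∞ M] {C : ContactForm n M}

variable (C) in
/-- The variation of the phase of the path `A` of Lagrangian subspaces over the path `base`, with
respect to the frame `p, q`. -/
noncomputable def phaseVar {X : Type*} (p q : X → Fin n → Model n) (base : ℝ → X)
    (A : ℝ → TangentSubspace n M) : ℝ :=
  argVar (fun s => phaseAt C (p (base s)) (q (base s)) (A s)) 0 1

variable (C) in
/-- The variation of the phase along the interpolation from the frame `p, q` to `p', q'`. -/
noncomputable def interpolationVar (p q p' q' : Fin n → Model n) (A : TangentSubspace n M) : ℝ :=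
  argVar (fun σ => phaseOf (interpolatedCoord (dForm C A.1) p q p' q' σ) A.2) 0 1

theorem IsFrame.continuousOn_linearPart {X : Type*} [TopologicalSpace X] {S : Set X} {f : X → M}
    {p q p' q' : X → Fin n → Model n} (h : IsFrame C S f p q) (h' : IsFrame C S f p' q')
    (i j : Fin n) :
    ContinuousOn (fun z => linearPart (dForm C (f z)) (p z) (q z) (p' z) (q' z) i j) S :=
  ((h'.continuousOn_complexCoord subset_rfl (h.cont_p j) i).sub (continuousOn_const.mul
    (h'.continuousOn_complexCoord subset_rfl (h.cont_q j) i))).div_const 2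

theorem IsFrame.continuousOn_antilinearPart {X : Type*} [TopologicalSpace X] {S : Set X} {f : X → M}
    {p q p' q' : X → Fin n → Model n} (h : IsFrame C S f p q) (h' : IsFrame C S f p' q')
    (i j : Fin n) :
    ContinuousOn (fun z => antilinearPart (dForm C (f z)) (p z) (q z) (p' z) (q' z) i j) S :=
  ((h'.continuousOn_complexCoord subset_rfl (h.cont_p j) i).add (continuousOn_const.mul
    (h'.continuousOn_complexCoord subset_rfl (h.cont_q j) i))).div_const 2

theorem circleOn_det_linearPart {X : Type*} [TopologicalSpace X] {S : Set X} {f : X → M}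
    {p q p' q' : X → Fin n → Model n} (h : IsFrame C S f p q) (h' : IsFrame C S f p' q') :
    CircleOn (fun z => sqPhase (linearPart (dForm C (f z)) (p z) (q z) (p' z) (q' z)).det) S := by
  have h0 : ∀ z ∈ S, (linearPart (dForm C (f z)) (p z) (q z) (p' z) (q' z)).det ≠ 0 := fun z hz =>
    det_linearPart_ne_zero (isSymplecticOn_xiSpace C (f z)) (h.basis z hz) (h'.basis z hz)
  refine ⟨fun z hz => ?_, fun z hz => norm_sqPhase (h0 z hz)⟩
  have hdet : ContinuousOn
      (fun z => (linearPart (dForm C (f z)) (p z) (q z) (p' z) (q' z)).det) S := by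
    refine continuousOn_iff_continuous_domRestrict.2 (Continuous.matrix_det ?_)
    exact continuous_matrix fun i j =>
      continuousOn_iff_continuous_domRestrict.1 (h.continuousOn_linearPart h' i j)
  exact ContinuousAt.comp_continuousWithinAt (g := sqPhase) (continuousAt_sqPhase (h0 z hz))
    (hdet z hz)

theorem circleOn_interpolatedCoord {X : Type*} [TopologicalSpace X] {S : Set X} {f : X → M}
    {p q p' q' : X → Fin n → Model n} (h : IsFrame C S f p q) (h' : IsFrame C S f p' q')
    {A : X → TangentSubspace n M} (hA : IsLagrangianSection C S f A) {s : X → ℝ}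
    (hs : ContinuousOn s S) (hm : MapsTo s S (Icc 0 1)) :
    CircleOn (fun z => phaseOf (interpolatedCoord (dForm C (A z).1) (p z) (q z) (p' z) (q' z) (s z))
      ((A z).2 : Submodule ℝ (Model n))) S := by
  have h1 := circleOn_phaseOf hA (Φ := fun z =>
      interpolatedCoord (dForm C (f z)) (p z) (q z) (p' z) (q' z) (s z))
    (fun U hU v hv i => by
      simp only [interpolatedCoord_apply]
      refine continuousOn_finsetSum _ fun j _ => ?_
      have hc := h.continuousOn_complexCoord hU hv j
      refine (((h.continuousOn_linearPart h' i j).mono hU).mul hc).add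
        (((Complex.continuous_ofReal.comp_continuousOn (hs.mono hU)).mul
          ((h.continuousOn_antilinearPart h' i j).mono hU)).mul
          (Complex.continuous_conj.comp_continuousOn hc))) fun z hz v hv => by
      have hL := (hA.2.1 z hz).isLagrangianIn
      rw [hA.1 z hz] at hL
      exact det_interpolatedCoord_ne_zero (isSymplecticOn_xiSpace C (f z)) (h.basis z hz)
        (h'.basis z hz) hL hv (hm hz)
  have h2 : ∀ z ∈ S, phaseOf (interpolatedCoord (dForm C (A z).1) (p z) (q z) (p' z) (q' z) (s z))
      ((A z).2 : Submodule ℝ (Model n)) =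
      phaseOf (interpolatedCoord (dForm C (f z)) (p z) (q z) (p' z) (q' z) (s z))
      ((A z).2 : Submodule ℝ (Model n)) := fun z hz => by rw [hA.1 z hz]
  exact ⟨h1.1.congr h2, fun z hz => by beta_reduce; rw [h2 z hz]; exact h1.2 z hz⟩

/-- A change of symplectic frame over a rectangle changes the variation of the phase along a
path by the difference of the values of a function at its two ends. -/
theorem exists_phaseVar_frameChange {a b c d : ℝ} (hab : a ≤ b) (hcd : c ≤ d) {f : ℝ × ℝ → M}
    {p q p' q' : ℝ × ℝ → Fin n → Model n} (h : IsFrame C (Icc a b ×ˢ Icc c d) f p q)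
    (h' : IsFrame C (Icc a b ×ˢ Icc c d) f p' q') :
    ∃ T : ℝ × ℝ → TangentSubspace n M → ℝ, ∀ (base : ℝ → ℝ × ℝ) (A : ℝ → TangentSubspace n M),
      ContinuousOn base (Icc 0 1) → MapsTo base (Icc 0 1) (Icc a b ×ˢ Icc c d) →
      IsLagrangianSection C (Icc 0 1) (fun s => f (base s)) A →
      phaseVar C p' q' base A =
        phaseVar C p q base A + T (base 1) (A 1) - T (base 0) (A 0) := by
  obtain ⟨θ, hθ, hθz⟩ := exists_angle_on_rectangle hab hcd (circleOn_det_linearPart h h')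
  refine ⟨fun z A => θ z + interpolationVar C (p z) (q z) (p' z) (q' z) A,
    fun base A hb hm hA => ?_⟩
  have hF := h.comp hb hm
  have hF' := h'.comp hb hm
  have hsnd : MapsTo (fun z : ℝ × ℝ => z.2) (Icc (0 : ℝ) 1 ×ˢ Icc (0 : ℝ) 1) (Icc 0 1) :=
    fun z hz => hz.2
  -- the rectangle is the product of the interpolation and the path
  have key := argVar_rectangle zero_le_one zero_le_one
    (circleOn_interpolatedCoord (hF.comp continuousOn_snd hsnd) (hF'.comp continuousOn_snd hsnd)
      (hA.comp continuousOn_snd hsnd) (s := fun z : ℝ × ℝ => z.1) continuousOn_fst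
      (fun z hz => hz.1))
  beta_reduce at key
  have e0 : argVar (fun t => phaseOf (interpolatedCoord (dForm C (A t).1) (p (base t)) (q (base t))
      (p' (base t)) (q' (base t)) 0) ((A t).2 : Submodule ℝ (Model n))) 0 1 =
      θ (base 1) - θ (base 0) + phaseVar C p q base A := by
    have hdet : IsAngle (fun s => sqPhase (linearPart (dForm C (f (base s))) (p (base s))
        (q (base s)) (p' (base s)) (q' (base s))).det) 0 1 (fun s => θ (base s)) :=
      ⟨hθ.comp hb hm, fun s hs => hθz _ (hm hs)⟩
    rw [← hdet.argVar_eq zero_le_one, phaseVar, ← argVar_mul zero_le_one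
      (circleOn_det_linearPart hF hF') (circleOn_phaseAt hA hF)]
    refine argVar_congr fun s hs => ?_
    rw [(hA.2.1 s hs).isLagrangianIn.phaseOf_interpolatedCoord_zero, phaseAt, hA.1 s hs]
  have e1 : argVar (fun t => phaseOf (interpolatedCoord (dForm C (A t).1) (p (base t)) (q (base t))
      (p' (base t)) (q' (base t)) 1) ((A t).2 : Submodule ℝ (Model n))) 0 1 =
      phaseVar C p' q' base A := by
    refine argVar_congr fun s hs => ?_
    have hb := hF.basis s hs
    have hs1 : f (base s) = (A s).1 := (hA.1 s hs).symm
    rw [hs1] at hb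
    exact (hA.2.1 s hs).isLagrangianIn.phaseOf_interpolatedCoord_one
      (isSymplecticOn_xiSpace C (A s).1) hb
  rw [e0, e1] at key
  simp only [interpolationVar]
  linarith

theorem hasFrame_prism {c : ℝ} (hc : 0 < c) {K : ℝ × ℝ × ℝ → M}
    (hK : ContinuousOn K (Icc 0 1 ×ˢ (Icc 0 1 ×ˢ Icc 0 c))) :
    HasFrame C (Icc 0 1 ×ˢ (Icc 0 1 ×ˢ Icc 0 c)) K := by
  have hm : MapsTo (fun z : ℝ × ℝ × ℝ => (z.1, z.2.1, c * z.2.2)) unitCube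
      (Icc 0 1 ×ˢ (Icc 0 1 ×ˢ Icc 0 c)) := fun z hz =>
    ⟨hz.1, hz.2.1, by have := hz.2.2.1; positivity, by nlinarith [hz.2.2.2]⟩
  have hm' : MapsTo (fun z : ℝ × ℝ × ℝ => (z.1, z.2.1, z.2.2 / c))
      (Icc 0 1 ×ˢ (Icc 0 1 ×ˢ Icc 0 c)) unitCube := fun z hz =>
    ⟨hz.1, hz.2.1, div_nonneg hz.2.2.1 hc.le, (div_le_one hc).2 hz.2.2.2⟩
  obtain ⟨p, q, h⟩ := hasFrame_unitCube (C := C) (hK.comp (by fun_prop) hm)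
  refine ⟨_, _, (h.comp (φ := fun z : ℝ × ℝ × ℝ => (z.1, z.2.1, z.2.2 / c)) (by fun_prop)
    hm').congr fun z _ => ?_⟩
  simp [mul_div_cancel₀ _ hc.ne']

theorem hasFrame_rectangle {c : ℝ} (hc : 0 < c) {w : ℝ × ℝ → M}
    (hw : ContinuousOn w (Icc 0 1 ×ˢ Icc 0 c)) : HasFrame C (Icc 0 1 ×ˢ Icc 0 c) w := by
  obtain ⟨p, q, h⟩ := hasFrame_prism (C := C) hc (K := fun z => w z.2)
    (hw.comp continuousOn_snd fun z hz => hz.2)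
  exact ⟨_, _, h.comp (φ := fun z : ℝ × ℝ => ((0 : ℝ), z)) (by fun_prop) fun z hz => ⟨by simp, hz⟩⟩

/-- Along a homotopy of maps of a rectangle, with arbitrary frames at its two ends, the variation of
the phase along a path of Lagrangian subspaces over a path in the rectangle changes by the
difference of terms which depend only on its two end points and on what happens there. -/
theorem exists_phaseVar_homotopy {c : ℝ} (hc : 0 < c) {K : ℝ × ℝ × ℝ → M}
    (hK : ContinuousOn K (Icc 0 1 ×ˢ (Icc 0 1 ×ˢ Icc 0 c))) {p q p' q' : ℝ × ℝ → Fin n → Model n}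
    (h : IsFrame C (Icc 0 1 ×ˢ Icc 0 c) (fun z => K (0, z)) p q)
    (h' : IsFrame C (Icc 0 1 ×ˢ Icc 0 c) (fun z => K (1, z)) p' q') :
    ∃ T : ℝ × ℝ → (ℝ → TangentSubspace n M) → ℝ,
      (∀ z A B, (∀ r ∈ Icc (0 : ℝ) 1, A r = B r) → T z A = T z B) ∧
      ∀ (base : ℝ → ℝ × ℝ) (A : ℝ → ℝ → TangentSubspace n M),
        ContinuousOn base (Icc 0 1) → MapsTo base (Icc 0 1) (Icc 0 1 ×ˢ Icc 0 c) →
        IsLagrangianSection C (Icc (0 : ℝ) 1 ×ˢ Icc (0 : ℝ) 1) (fun z => K (z.1, base z.2))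
          (fun z => A z.1 z.2) →
        phaseVar C p' q' base (A 1) =
          phaseVar C p q base (A 0) +
            T (base 1) (fun r => A r 1) - T (base 0) (fun r => A r 0) := by
  obtain ⟨P, Q, hG⟩ := hasFrame_prism (C := C) hc hK
  have hslice : ∀ r ∈ Icc (0 : ℝ) 1, IsFrame C (Icc 0 1 ×ˢ Icc 0 c) (fun z => K (r, z))
      (fun z => P (r, z)) (fun z => Q (r, z)) := fun r hr =>
    hG.comp (φ := fun z : ℝ × ℝ => (r, z)) (by fun_prop) fun z hz => ⟨hr, hz⟩
  have h0 : (0 : ℝ) ∈ Icc (0 : ℝ) 1 := by simp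
  have h1 : (1 : ℝ) ∈ Icc (0 : ℝ) 1 := by simp
  -- change to a frame over the homotopy, follow the homotopy, and change to the other frame
  obtain ⟨T₀, hT₀⟩ := exists_phaseVar_frameChange zero_le_one hc.le h (hslice 0 h0)
  obtain ⟨T₁, hT₁⟩ := exists_phaseVar_frameChange zero_le_one hc.le (hslice 1 h1) h'
  refine ⟨fun z A => T₀ z (A 0) +
    argVar (fun r => phaseAt C (P (r, z)) (Q (r, z)) (A r)) 0 1 + T₁ z (A 1),
    fun z A B hAB => ?_, fun base A hb hm hA => ?_⟩
  · beta_reduce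
    rw [hAB 0 h0, hAB 1 h1, argVar_congr fun r hr => by rw [hAB r hr]]
  · have hsec : ∀ r ∈ Icc (0 : ℝ) 1,
        IsLagrangianSection C (Icc 0 1) (fun s => K (r, base s)) (A r) := fun r hr =>
      hA.comp (φ := fun s : ℝ => (r, s)) (by fun_prop) fun s hs => ⟨hr, hs⟩
    have e0 := hT₀ base (A 0) hb hm (hsec 0 h0)
    have e1 := hT₁ base (A 1) hb hm (hsec 1 h1)
    have hφ : ContinuousOn (fun z : ℝ × ℝ => (z.1, base z.2)) (Icc (0 : ℝ) 1 ×ˢ Icc (0 : ℝ) 1) :=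
      continuousOn_fst.prodMk (hb.comp continuousOn_snd fun z hz => hz.2)
    have key := argVar_rectangle zero_le_one zero_le_one
      (circleOn_phaseAt hA (hG.comp hφ fun z hz => ⟨hz.1, hm hz.2⟩))
    simp only [phaseVar] at *
    linarith

end Transport

/-! ### Lagrangian subspaces as graphs of symmetric matrices -/

section Graphs

variable {V : Type*} [AddCommGroup V] [Module ℝ V] {n : ℕ}
  {Ω : V →ₗ[ℝ] V →ₗ[ℝ] ℝ} {W L L₀ L₁ : Submodule ℝ V} {p q : Fin n → V}

/-- Two transversal Lagrangian subspaces are spanned by the two halves of a symplectic basis. -/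
theorem exists_adapted_basis [FiniteDimensional ℝ V] (hΩ : IsSymplecticOn n Ω W)
    (h₀ : IsLagrangianIn n Ω W L₀) (h₁ : IsLagrangianIn n Ω W L₁) (hd : L₁ ⊓ L₀ = ⊥) :
    ∃ p q : Fin n → V, IsSymplecticBasis Ω W p q ∧ IsBasisOf p L₀ ∧ IsBasisOf q L₁ := by
  obtain ⟨q, hq⟩ := h₁.exists_basis
  have hsup : L₀ ⊔ L₁ = W := by
    apply Submodule.eq_of_le_of_finrank_eq (sup_le h₀.le h₁.le)
    have := Submodule.finrank_sup_add_finrank_inf_eq L₀ L₁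
    rw [inf_comm, hd, finrank_bot, h₀.finrank_eq, h₁.finrank_eq] at this
    rw [hΩ.finrank_eq]
    omega
  let T : L₀ →ₗ[ℝ] (Fin n → ℝ) := LinearMap.pi fun j => Ω.flip (q j) ∘ₗ L₀.subtype
  have hT : ∀ v j, T v j = Ω v (q j) := fun v j => rfl
  have hinj : Function.Injective T := by
    rw [injective_iff_map_eq_zero]
    intro v hv
    have h1 : ∀ w ∈ L₁, Ω v w = 0 := fun w hw => by
      rw [← hq.2] at hw
      induction hw using Submodule.span_induction with
      | mem x hx => obtain ⟨j, rfl⟩ := hx; exact (hT v j).symm.trans (congrFun hv j)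
      | zero => simp
      | add x y _ _ hx hy => simp [hx, hy]
      | smul c x _ hx => simp [hx]
    refine Subtype.ext (hΩ.nondegenerate v (h₀.le v.2) fun w hw => ?_)
    rw [← hsup] at hw
    obtain ⟨w₀, hw₀, w₁, hw₁, rfl⟩ := Submodule.mem_sup.1 hw
    rw [map_add, h₀.isotropic v v.2 w₀ hw₀, h1 w₁ hw₁, add_zero]
  have hsurj : Function.Surjective T :=
    (LinearMap.injective_iff_surjective_of_finrank_eq_finrank (by
      rw [h₀.finrank_eq, Module.finrank_fin_fun])).1 hinj
  choose p hp using fun i => hsurj (Pi.single i 1)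
  have hpq : ∀ i j, Ω (p i) (q j) = if i = j then 1 else 0 := fun i j => by
    rw [← hT, hp, Pi.single_apply]
    simp only [eq_comm]
  have hbasis : IsSymplecticBasis Ω W (fun i => (p i : V)) q :=
    ⟨fun i => h₀.le (p i).2, fun i => h₁.le (hq.mem i),
      fun i j => h₀.isotropic _ (p i).2 _ (p j).2,
      fun i j => h₁.isotropic _ (hq.mem i) _ (hq.mem j),
      hpq⟩
  refine ⟨fun i => p i, q, hbasis, ⟨hbasis.isBasisOf_span.1, ?_⟩, hq⟩
  apply Submodule.eq_of_le_of_finrank_eq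
  · rw [Submodule.span_le]
    rintro _ ⟨i, rfl⟩
    exact (p i).2
  · rw [finrank_span_eq_card hbasis.isBasisOf_span.1, Fintype.card_fin, h₀.finrank_eq]

/-- The matrix of the coordinates `x_i = Ω(·, q_i)` of the vectors `v`. -/
def xMatrix (Ω : V →ₗ[ℝ] V →ₗ[ℝ] ℝ) (q v : Fin n → V) : Matrix (Fin n) (Fin n) ℝ :=
  Matrix.of fun i j => Ω (v j) (q i)

/-- The matrix of the coordinates `y_i = Ω(p_i, ·)` of the vectors `v`. -/
def yMatrix (Ω : V →ₗ[ℝ] V →ₗ[ℝ] ℝ) (p v : Fin n → V) : Matrix (Fin n) (Fin n) ℝ :=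
  Matrix.of fun i j => Ω (p i) (v j)

theorem valueMatrix_complexCoord (v : Fin n → V) : valueMatrix (complexCoord Ω p q) v =
    (xMatrix Ω q v).map (algebraMap ℝ ℂ) + Complex.I • (yMatrix Ω p v).map (algebraMap ℝ ℂ) := by
  ext i j
  simp [valueMatrix, complexCoord_apply, xMatrix, yMatrix, mul_comm]

theorem transpose_xMatrix_mul_yMatrix [FiniteDimensional ℝ V] (hΩ : IsSymplecticOn n Ω W)
    (h : IsSymplecticBasis Ω W p q) (hL : IsLagrangianIn n Ω W L) {v : Fin n → V}
    (hv : IsBasisOf v L) :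
    (xMatrix Ω q v).transpose * yMatrix Ω p v = (yMatrix Ω p v).transpose * xMatrix Ω q v := by
  ext j k
  have h1 := h.form_eq hΩ (hL.le (hv.mem j)) (w := v k)
  rw [hL.isotropic _ (hv.mem j) _ (hv.mem k), Finset.sum_sub_distrib] at h1
  simp only [Matrix.mul_apply, Matrix.transpose_apply, xMatrix, yMatrix, Matrix.of_apply]
  have h2 : ∀ i, Ω (p i) (v j) * Ω (q i) (v k) = -(Ω (p i) (v j) * Ω (v k) (q i)) := fun i => by
    rw [hΩ.skew (q i)]; ring
  have h3 : ∀ i, Ω (q i) (v j) * Ω (p i) (v k) = -(Ω (v j) (q i) * Ω (p i) (v k)) := fun i => by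
    rw [hΩ.skew (q i)]; ring
  simp only [h2, h3, Finset.sum_neg_distrib] at h1
  linarith

/-- A Lagrangian subspace transversal to `⟨p⟩` is a graph over `⟨q⟩`. -/
theorem det_yMatrix_ne_zero [FiniteDimensional ℝ V] (hΩ : IsSymplecticOn n Ω W)
    (h : IsSymplecticBasis Ω W p q) (hp : IsBasisOf p L₀) (hL : IsLagrangianIn n Ω W L)
    {v : Fin n → V} (hv : IsBasisOf v L) (hd : L ⊓ L₀ = ⊥) : (yMatrix Ω p v).det ≠ 0 := by
  intro hdet
  obtain ⟨c, hc, hc0⟩ := Matrix.exists_mulVec_eq_zero_iff.2 hdet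
  have hmem : ∑ j, c j • v j ∈ L := Submodule.sum_mem _ fun j _ => Submodule.smul_mem _ _ (hv.mem j)
  have hp0 : ∀ i, Ω (p i) (∑ j, c j • v j) = 0 := fun i => by
    have := congrFun hc0 i
    simp only [Matrix.mulVec, dotProduct, yMatrix, Matrix.of_apply, Pi.zero_apply] at this
    rw [← this, map_sum]
    exact Finset.sum_congr rfl fun j _ => by rw [map_smul, smul_eq_mul, mul_comm]
  have hmem' : ∑ j, c j • v j ∈ L₀ := by
    rw [h.expand hΩ (hL.le hmem)]
    refine Submodule.sum_mem _ fun i _ => ?_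
    rw [hp0 i, zero_smul, add_zero]
    exact Submodule.smul_mem _ _ (hp.mem i)
  have h0 : ∑ j, c j • v j = 0 := by
    have : ∑ j, c j • v j ∈ L ⊓ L₀ := ⟨hmem, hmem'⟩
    rwa [hd, Submodule.mem_bot] at this
  exact hc (funext fun j => Fintype.linearIndependent_iff.1 hv.1 c h0 j)

open Classical in
/-- The matrix `B` such that `L` is the graph `{x = B y}`. -/
noncomputable def graphMatrix (Ω : V →ₗ[ℝ] V →ₗ[ℝ] ℝ) (p q : Fin n → V) (L : Submodule ℝ V) :
    Matrix (Fin n) (Fin n) ℝ :=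
  if h : ∃ v : Fin n → V, IsBasisOf v L then
    xMatrix Ω q h.choose * (yMatrix Ω p h.choose)⁻¹ else 0

theorem xMatrix_sum_smul {v : Fin n → V} (g : Matrix (Fin n) (Fin n) ℝ) :
    xMatrix Ω q (fun j => ∑ i, g i j • v i) = xMatrix Ω q v * g := by
  ext i j
  simp [xMatrix, Matrix.mul_apply, mul_comm]

theorem yMatrix_sum_smul {v : Fin n → V} (g : Matrix (Fin n) (Fin n) ℝ) :
    yMatrix Ω p (fun j => ∑ i, g i j • v i) = yMatrix Ω p v * g := by
  ext i j
  simp [yMatrix, Matrix.mul_apply, mul_comm]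

theorem IsBasisOf.graphMatrix_eq {v : Fin n → V} (hv : IsBasisOf v L) :
    graphMatrix Ω p q L = xMatrix Ω q v * (yMatrix Ω p v)⁻¹ := by
  have h : ∃ v : Fin n → V, IsBasisOf v L := ⟨v, hv⟩
  obtain ⟨g, hg0, hg⟩ := h.choose_spec.exists_matrix hv
  rw [graphMatrix, dif_pos h, hg, xMatrix_sum_smul, yMatrix_sum_smul, Matrix.mul_inv_rev,
    Matrix.mul_assoc, ← Matrix.mul_assoc g, Matrix.mul_nonsing_inv g (isUnit_iff_ne_zero.2 hg0),
    Matrix.one_mul]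

theorem isSymm_mul_inv {n : ℕ} {X Y : Matrix (Fin n) (Fin n) ℝ}
    (h : X.transpose * Y = Y.transpose * X) (hY : Y.det ≠ 0) : (X * Y⁻¹).IsSymm := by
  have hu : IsUnit Y.det := isUnit_iff_ne_zero.2 hY
  have hu' : IsUnit Y.transpose.det := by rwa [Matrix.det_transpose]
  change (X * Y⁻¹).transpose = X * Y⁻¹
  calc (X * Y⁻¹).transpose = (Y.transpose)⁻¹ * (X.transpose * Y) * Y⁻¹ := by
        rw [Matrix.transpose_mul, Matrix.transpose_nonsing_inv, Matrix.mul_assoc, Matrix.mul_assoc,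
          Matrix.mul_nonsing_inv Y hu, Matrix.mul_one]
    _ = X * Y⁻¹ := by
        rw [h, ← Matrix.mul_assoc, Matrix.nonsing_inv_mul _ hu', Matrix.one_mul]

/-- For the graph `{x = B y}`, the phase is that of `det (B + i)`. -/
theorem phaseOf_eq_graphMatrix {v : Fin n → V} (hv : IsBasisOf v L)
    (hY : (yMatrix Ω p v).det ≠ 0) : phaseOf (complexCoord Ω p q) L =
      sqPhase ((graphMatrix Ω p q L).map (algebraMap ℝ ℂ) + Complex.I • 1).det := by
  have hu : IsUnit (yMatrix Ω p v).det := isUnit_iff_ne_zero.2 hY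
  have h1 : valueMatrix (complexCoord Ω p q) v =
      ((graphMatrix Ω p q L).map (algebraMap ℝ ℂ) + Complex.I • 1) *
        (yMatrix Ω p v).map (algebraMap ℝ ℂ) := by
    rw [valueMatrix_complexCoord, Matrix.add_mul, ← Matrix.map_mul, hv.graphMatrix_eq,
      Matrix.mul_assoc, Matrix.nonsing_inv_mul _ hu, Matrix.mul_one, Matrix.smul_mul,
      Matrix.one_mul]
  have hdet : ((yMatrix Ω p v).map (algebraMap ℝ ℂ)).det = (((yMatrix Ω p v).det : ℝ) : ℂ) := by
    rw [← RingHom.mapMatrix_apply, ← RingHom.map_det]; rfl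
  rw [hv.phaseOf_eq, h1, Matrix.det_mul, hdet, sqPhase_mul, sqPhase_real hY, mul_one]

end Graphs

section SymmetricMatrices

variable {n : ℕ}

theorem det_add_mul_det_sub (B : Matrix (Fin n) (Fin n) ℝ) :
    (B.map (algebraMap ℝ ℂ) + Complex.I • 1).det * (B.map (algebraMap ℝ ℂ) - Complex.I • 1).det =
      (((B * B + 1).det : ℝ) : ℂ) := by
  have h1 : (B.map (algebraMap ℝ ℂ) + Complex.I • 1) * (B.map (algebraMap ℝ ℂ) - Complex.I • 1) =
      (B * B + 1).map (algebraMap ℝ ℂ) := by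
    rw [Matrix.add_mul, Matrix.mul_sub, Matrix.mul_sub, Matrix.map_add _ (map_add _),
      Matrix.map_mul, Matrix.map_one _ (map_zero _) (map_one _)]
    simp only [Matrix.smul_mul, Matrix.mul_smul, Matrix.mul_one, Matrix.one_mul, smul_smul,
      Complex.I_mul_I, neg_smul, one_smul]
    abel
  rw [← Matrix.det_mul, h1, ← RingHom.mapMatrix_apply, ← RingHom.map_det]
  rfl

theorem det_sq_add_one_pos {B : Matrix (Fin n) (Fin n) ℝ} (hB : B.IsSymm) :
    0 < (B * B + 1).det := by
  have h1 : B.conjTranspose * B = B * B := by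
    rw [Matrix.conjTranspose_eq_transpose_of_trivial, hB.eq]
  rw [← h1]
  exact (Matrix.PosDef.posSemidef_add (Matrix.posSemidef_conjTranspose_mul_self B)
    Matrix.PosDef.one).det_pos

theorem det_add_I_ne_zero {B : Matrix (Fin n) (Fin n) ℝ} (hB : B.IsSymm) :
    (B.map (algebraMap ℝ ℂ) + Complex.I • 1).det ≠ 0 := by
  have h1 := det_add_mul_det_sub B
  intro h0
  rw [h0, zero_mul] at h1
  exact (det_sq_add_one_pos hB).ne' (Complex.ofReal_injective h1.symm)

variable (n) in
/-- The argument of `det (B + i)` is a continuous function of the symmetric matrix `B`. -/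
theorem exists_angle_det : ∃ Θ : Matrix (Fin n) (Fin n) ℝ → ℝ, Continuous Θ ∧
    ∀ B : Matrix (Fin n) (Fin n) ℝ, B.IsSymm →
      sqPhase (B.map (algebraMap ℝ ℂ) + Complex.I • 1).det =
        Complex.exp ((2 * Θ B : ℝ) * Complex.I) := by
  -- symmetrization extends `B ↦ det (B + i)` without zeros to all matrices
  let s : (Fin n → Fin n → ℝ) → Matrix (Fin n) (Fin n) ℝ := fun B =>
    (1 / 2 : ℝ) • (Matrix.of B + (Matrix.of B).transpose)
  have hs : ∀ B, (s B).IsSymm := fun B => by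
    rw [Matrix.IsSymm, Matrix.transpose_smul, Matrix.transpose_add, Matrix.transpose_transpose,
      add_comm]
  have hsc : Continuous s := by
    refine continuous_matrix fun i j => ?_
    simp only [s, Matrix.smul_apply, Matrix.add_apply, Matrix.transpose_apply, Matrix.of_apply]
    fun_prop
  have hid : ∀ B : Matrix (Fin n) (Fin n) ℝ, B.IsSymm → s B = B := fun B hB => by
    have h1 : s B = (1 / 2 : ℝ) • (B + B.transpose) := rfl
    rw [h1, hB.eq, ← two_smul ℝ B, smul_smul]
    norm_num
  obtain ⟨Θ, hΘ, hz⟩ := exists_angle_of_continuous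
    (g := fun B : Fin n → Fin n → ℝ => ((s B).map (algebraMap ℝ ℂ) + Complex.I • 1).det)
    (by
      refine Continuous.matrix_det (Continuous.add ?_ continuous_const)
      exact hsc.matrix_map (by exact Complex.continuous_ofReal))
    (fun B => det_add_I_ne_zero (hs B))
  refine ⟨Θ, hΘ, fun B hB => ?_⟩
  have h0 := det_add_I_ne_zero hB
  have h1 := hz B
  beta_reduce at h1
  rw [hid B hB] at h1
  have h2 : ((‖(B.map (algebraMap ℝ ℂ) + Complex.I • 1).det‖ : ℝ) : ℂ) ≠ 0 := by simpa using h0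
  rw [sqPhase]
  nth_rewrite 1 [h1]
  rw [mul_pow, ← Complex.exp_nat_mul]
  push_cast
  rw [mul_div_assoc, mul_comm, div_mul_cancel₀ _ (pow_ne_zero 2 h2)]
  congr 1
  ring

end SymmetricMatrices

/-! ### Phase variation of corner paths -/

section NegativeDefinite

variable {n : ℕ}

/-- The quadratic form of the matrix `S` is negative definite. -/
def IsNegDef (S : Matrix (Fin n) (Fin n) ℝ) : Prop :=
  ∀ c : Fin n → ℝ, c ≠ 0 → c ⬝ᵥ S.mulVec c < 0

theorem IsNegDef.det_ne_zero {S : Matrix (Fin n) (Fin n) ℝ} (h : IsNegDef S) : S.det ≠ 0 := by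
  intro h0
  obtain ⟨c, hc, hc0⟩ := Matrix.exists_mulVec_eq_zero_iff.2 h0
  have := h c hc
  rw [hc0, dotProduct_zero] at this
  exact lt_irrefl _ this

theorem isNegDef_neg_one : IsNegDef (-1 : Matrix (Fin n) (Fin n) ℝ) := fun c hc => by
  rw [Matrix.neg_mulVec, Matrix.one_mulVec, dotProduct_neg, neg_lt_zero]
  obtain ⟨i, hi⟩ := Function.ne_iff.1 hc
  exact Finset.sum_pos' (fun j _ => mul_self_nonneg (c j)) ⟨i, Finset.mem_univ i,
    mul_self_pos.2 hi⟩

theorem isOpen_isNegDef : IsOpen {S : Matrix (Fin n) (Fin n) ℝ | IsNegDef S} := by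
  have hiff : ∀ S : Matrix (Fin n) (Fin n) ℝ, IsNegDef S ↔
      ∀ c ∈ Metric.sphere (0 : Fin n → ℝ) 1, c ⬝ᵥ S.mulVec c < 0 := fun S => by
    refine ⟨fun h c hc => h c (by rintro rfl; simp at hc), fun h c hc => ?_⟩
    have hn : ‖c‖ ≠ 0 := norm_ne_zero_iff.2 hc
    have h1 := h (‖c‖⁻¹ • c) (by simp [norm_smul, hn])
    rw [Matrix.mulVec_smul, smul_dotProduct, dotProduct_smul, smul_smul, smul_eq_mul] at h1
    have h2 : 0 < ‖c‖⁻¹ * ‖c‖⁻¹ := by positivity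
    by_contra hcon
    exact absurd h1 (not_lt.2 (mul_nonneg h2.le (not_lt.1 hcon)))
  rw [isOpen_iff_mem_nhds]
  intro S hS
  have h1 := (isCompact_sphere (0 : Fin n → ℝ) 1).eventually_forall_of_forall_eventually (x₀ := S)
    (P := fun A c => c ⬝ᵥ A.mulVec c < 0) fun c hc => by
      have hcont : Continuous fun z : Matrix (Fin n) (Fin n) ℝ × (Fin n → ℝ) =>
          z.2 ⬝ᵥ z.1.mulVec z.2 := by
        exact continuous_snd.dotProduct (continuous_fst.matrix_mulVec continuous_snd)
      exact (hcont.continuousAt (x := (S, c))).eventually_lt continuousAt_const ((hiff S).1 hS c hc)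
  exact h1.mono fun A hA => (hiff A).2 hA

theorem continuousAt_matrix_inv {Y : Matrix (Fin n) (Fin n) ℝ} (hY : Y.det ≠ 0) :
    ContinuousAt (fun A : Matrix (Fin n) (Fin n) ℝ => A⁻¹) Y := by
  simp only [Matrix.inv_def, Ring.inverse_eq_inv']
  exact ((continuous_id.matrix_det).continuousAt.inv₀ hY).smul
    (continuous_id.matrix_adjugate).continuousAt

/-- From `S⁻¹ + i = i S⁻¹ (S - i)` and `det (S - i) det (S + i) > 0`. -/
theorem sqPhase_det_inv_mul {S : Matrix (Fin n) (Fin n) ℝ} (hS : S.IsSymm) (h0 : S.det ≠ 0) :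
    sqPhase ((S⁻¹).map (algebraMap ℝ ℂ) + Complex.I • 1).det *
      sqPhase (S.map (algebraMap ℝ ℂ) + Complex.I • 1).det = sqPhase (Complex.I ^ n) := by
  have hu : IsUnit S.det := isUnit_iff_ne_zero.2 h0
  have h1 : (S⁻¹).map (algebraMap ℝ ℂ) + Complex.I • 1 =
      (S⁻¹).map (algebraMap ℝ ℂ) * (Complex.I • (S.map (algebraMap ℝ ℂ) - Complex.I • 1)) := by
    rw [smul_sub, smul_smul, Complex.I_mul_I, Matrix.mul_sub, Matrix.mul_smul, ← Matrix.map_mul,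
      Matrix.nonsing_inv_mul _ hu, Matrix.map_one _ (map_zero _) (map_one _)]
    simp [add_comm]
  have hdet : ((S⁻¹).map (algebraMap ℝ ℂ)).det = (((S⁻¹).det : ℝ) : ℂ) := by
    rw [← RingHom.mapMatrix_apply, ← RingHom.map_det]; rfl
  have h0' : (S⁻¹).det ≠ 0 := by
    rw [Matrix.det_nonsing_inv, Ring.inverse_eq_inv']
    exact inv_ne_zero h0
  rw [h1, Matrix.det_mul, Matrix.det_smul, hdet, sqPhase_mul, sqPhase_mul, sqPhase_real h0',
    one_mul, mul_assoc, ← sqPhase_mul, mul_comm (Matrix.det _), det_add_mul_det_sub,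
    sqPhase_real (det_sq_add_one_pos hS).ne', mul_one, Fintype.card_fin]

/-- On negative definite matrices, the arguments of `det (S⁻¹ + i)` and `det (S + i)` add up to a
constant. -/
theorem angle_inv_add_angle {Θ : Matrix (Fin n) (Fin n) ℝ → ℝ} (hΘ : Continuous Θ)
    (h : ∀ B : Matrix (Fin n) (Fin n) ℝ, B.IsSymm →
      sqPhase (B.map (algebraMap ℝ ℂ) + Complex.I • 1).det =
        Complex.exp ((2 * Θ B : ℝ) * Complex.I))
    {S : Matrix (Fin n) (Fin n) ℝ} (hS : S.IsSymm) (hneg : IsNegDef S) :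
    Θ S⁻¹ + Θ S = 2 * Θ (-1) := by
  -- the sum of the arguments is constant along the segment from `-1`, which is its own inverse
  let P : ℝ → Matrix (Fin n) (Fin n) ℝ := fun s => (1 - s) • (-1) + s • S
  have hP : Continuous P := by fun_prop
  have hPs : ∀ s, (P s).IsSymm := fun s =>
    ((Matrix.isSymm_one.neg).smul (1 - s)).add (hS.smul s)
  have hPn : ∀ s ∈ Icc (0 : ℝ) 1, IsNegDef (P s) := fun s hs c hc => by
    have h1 := isNegDef_neg_one c hc
    have h2 := hneg c hc
    simp only [P, Matrix.add_mulVec, Matrix.smul_mulVec, dotProduct_add, dotProduct_smul,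
      smul_eq_mul]
    rcases hs.1.eq_or_lt with h0 | h0
    · subst h0; linarith
    · nlinarith [hs.2]
  have h1 : ∀ s ∈ Icc (0 : ℝ) 1, Complex.exp ((2 * Θ (P s)⁻¹ + 2 * Θ (P s) : ℝ) * Complex.I) =
      sqPhase (Complex.I ^ n) := fun s hs => by
    have h0 := (hPn s hs).det_ne_zero
    have hinv : ((P s)⁻¹).IsSymm := by
      rw [Matrix.IsSymm, Matrix.transpose_nonsing_inv, (hPs s).eq]
    rw [← sqPhase_det_inv_mul (hPs s) h0, h _ hinv, h _ (hPs s), ← Complex.exp_add]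
    push_cast
    ring_nf
  have hI : sqPhase (Complex.I ^ n) ≠ 0 := by
    rw [← norm_ne_zero_iff, norm_sqPhase (pow_ne_zero n Complex.I_ne_zero)]
    exact one_ne_zero
  have hc : ContinuousOn (fun s => Θ (P s)⁻¹) (Icc 0 1) := fun s hs =>
    (hΘ.continuousAt.comp ((continuousAt_matrix_inv (hPn s hs).det_ne_zero).comp
      (f := P) hP.continuousAt)).continuousWithinAt
  have hP0 : P 0 = -1 := by simp [P]
  have hP1 : P 1 = S := by simp [P]
  have hinv1 : (-1 : Matrix (Fin n) (Fin n) ℝ)⁻¹ = -1 := Matrix.inv_eq_right_inv (by simp)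
  have h2 := eq_of_exp_eq_one (f := fun s => 2 * Θ (P s)⁻¹ + 2 * Θ (P s) - 4 * Θ (-1)) zero_le_one
    (((continuousOn_const.mul hc).add (continuousOn_const.mul (hΘ.comp hP).continuousOn)).sub
      continuousOn_const) fun s hs => by
      have h3 := h1 0 (by simp)
      rw [hP0, hinv1] at h3
      rw [Complex.ofReal_sub, sub_mul, Complex.exp_sub, h1 s hs, ← h3, div_eq_one_iff_eq
        (Complex.exp_ne_zero _)]
      congr 2
      push_cast
      ring
  beta_reduce at h2
  rw [hP0, hP1, hinv1] at h2
  linarith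

end NegativeDefinite

section Corner

variable {V : Type*} [NormedAddCommGroup V] [NormedSpace ℝ V] {n : ℕ}
  {Ω : V →ₗ[ℝ] V →ₗ[ℝ] ℝ} {W L₀ : Submodule ℝ V} {p q : Fin n → V}

theorem dotProduct_transpose_mul_mulVec (X Y : Matrix (Fin n) (Fin n) ℝ) (c : Fin n → ℝ) :
    c ⬝ᵥ (X.transpose * Y).mulVec c = X.mulVec c ⬝ᵥ Y.mulVec c := by
  rw [← Matrix.mulVec_mulVec, Matrix.dotProduct_mulVec, Matrix.vecMul_transpose]

theorem xMatrix_mulVec (v : Fin n → V) (c : Fin n → ℝ) (i : Fin n) :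
    (xMatrix Ω q v).mulVec c i = Ω (∑ j, c j • v j) (q i) := by
  simp [xMatrix, Matrix.mulVec, dotProduct, mul_comm]

theorem yMatrix_mulVec (v : Fin n → V) (c : Fin n → ℝ) (i : Fin n) :
    (yMatrix Ω p v).mulVec c i = Ω (p i) (∑ j, c j • v j) := by
  simp [yMatrix, Matrix.mulVec, dotProduct, mul_comm]

variable [FiniteDimensional ℝ V]

/-- A curve of frames which leaves the Lagrangian subspace `⟨p⟩` in the negative direction spans,
for small positive times, graphs over `⟨p⟩` of negative definite matrices which tend to zero. -/
theorem eventually_isNegDef_graph (hΩ : IsSymplecticOn n Ω W) (h : IsSymplecticBasis Ω W p q)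
    (hL₀ : IsLagrangianIn n Ω W L₀) (hp : IsBasisOf p L₀) {e : ℝ → Fin n → V} {f : Fin n → V}
    (he0 : IsBasisOf (e 0) L₀)
    (he : ∀ j, HasDerivWithinAt (fun t => e t j) (f j) (Ici 0) 0)
    (hneg : ∀ c : Fin n → ℝ, c ≠ 0 → Ω (∑ j, c j • e 0 j) (∑ j, c j • f j) < 0) :
    Filter.Tendsto (fun t => yMatrix Ω p (e t) * (xMatrix Ω q (e t))⁻¹) (𝓝[>] 0) (𝓝 0) ∧
      ∀ᶠ t in 𝓝[>] (0 : ℝ), (xMatrix Ω q (e t)).det ≠ 0 ∧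
        IsNegDef (yMatrix Ω p (e t) * (xMatrix Ω q (e t))⁻¹) := by
  have hle : 𝓝[>] (0 : ℝ) ≤ 𝓝[≥] 0 := nhdsWithin_mono _ Ioi_subset_Ici_self
  have hX0 : (xMatrix Ω q (e 0)).det ≠ 0 := by
    obtain ⟨g, hg0, hg⟩ := he0.exists_matrix hp
    have h1 : xMatrix Ω q p = 1 := by
      ext i j
      simp [xMatrix, h.p_q, Matrix.one_apply, eq_comm]
    rw [hg, xMatrix_sum_smul, h1, Matrix.one_mul]
    exact hg0
  have hX : Filter.Tendsto (fun t => xMatrix Ω q (e t)) (𝓝[>] 0) (𝓝 (xMatrix Ω q (e 0))) := by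
    refine tendsto_pi_nhds.2 fun i => tendsto_pi_nhds.2 fun j => ?_
    have h1 : Continuous fun v => Ω.flip (q i) v := LinearMap.continuous_of_finiteDimensional _
    exact (h1.continuousAt.comp_continuousWithinAt (he j).continuousWithinAt).tendsto.mono_left hle
  have hY0 : yMatrix Ω p (e 0) = 0 := by
    ext i j
    exact hL₀.isotropic _ (hp.mem i) _ (he0.mem j)
  -- since `y` vanishes at the start, its derivative there is the limit of `y / t`
  have hslope : Filter.Tendsto (fun t => t⁻¹ • yMatrix Ω p (e t)) (𝓝[>] 0) (𝓝 (yMatrix Ω p f)) := by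
    refine tendsto_pi_nhds.2 fun i => tendsto_pi_nhds.2 fun j => ?_
    have h1 : HasDerivWithinAt (fun t => Ω (p i) (e t j)) (Ω (p i) (f j)) (Ici 0) 0 :=
      HasFDerivAt.comp_hasDerivWithinAt (l := fun v => Ω (p i) v) (0 : ℝ)
        (LinearMap.toContinuousLinearMap (Ω (p i))).hasFDerivAt (he j)
    rw [hasDerivWithinAt_iff_tendsto_slope, Ici_sdiff_left] at h1
    refine h1.congr fun t => ?_
    have h2 : Ω (p i) (e 0 j) = 0 := congrFun (congrFun hY0 i) j
    simp [slope, h2, yMatrix]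
  have hY : Filter.Tendsto (fun t => yMatrix Ω p (e t)) (𝓝[>] 0) (𝓝 0) := by
    have h1 : Filter.Tendsto (fun t : ℝ => t) (𝓝[>] 0) (𝓝 0) :=
      Filter.tendsto_id.mono_left nhdsWithin_le_nhds
    have h2 := h1.smul hslope
    rw [zero_smul] at h2
    refine h2.congr' ?_
    filter_upwards [self_mem_nhdsWithin] with t ht
    rw [smul_smul, mul_inv_cancel₀ (ne_of_gt ht), one_smul]
  have hXinv : Filter.Tendsto (fun t => (xMatrix Ω q (e t))⁻¹) (𝓝[>] 0)
      (𝓝 (xMatrix Ω q (e 0))⁻¹) := (continuousAt_matrix_inv hX0).tendsto.comp hX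
  refine ⟨?_, ?_⟩
  · have := hY.mul hXinv
    rwa [zero_mul] at this
  -- `xᵀ y / t` tends to the matrix of the given negative definite form, and `y x⁻¹` is congruent to
  -- `xᵀ y`
  · have hlim : Filter.Tendsto (fun t => t⁻¹ • ((xMatrix Ω q (e t)).transpose * yMatrix Ω p (e t)))
        (𝓝[>] 0) (𝓝 ((xMatrix Ω q (e 0)).transpose * yMatrix Ω p f)) := by
      have h1 : Filter.Tendsto (fun t => (xMatrix Ω q (e t)).transpose) (𝓝[>] 0)
          (𝓝 (xMatrix Ω q (e 0)).transpose) :=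
        (continuous_id.matrix_transpose.tendsto _).comp hX
      refine (h1.mul hslope).congr fun t => ?_
      rw [Matrix.mul_smul]
    have hN : IsNegDef ((xMatrix Ω q (e 0)).transpose * yMatrix Ω p f) := fun c hc => by
      rw [dotProduct_transpose_mul_mulVec]
      refine lt_of_eq_of_lt ?_ (hneg c hc)
      have hmem : ∑ j, c j • e 0 j ∈ L₀ :=
        Submodule.sum_mem _ fun j _ => Submodule.smul_mem _ _ (he0.mem j)
      conv_rhs => rw [h.expand hΩ (hL₀.le hmem)]
      rw [map_sum Ω, LinearMap.sum_apply]
      refine Finset.sum_congr rfl fun i _ => ?_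
      rw [xMatrix_mulVec, yMatrix_mulVec, hL₀.isotropic _ (hp.mem i) _ hmem, zero_smul, add_zero,
        map_smul, LinearMap.smul_apply, smul_eq_mul]
    filter_upwards [hlim.eventually (isOpen_isNegDef.mem_nhds hN),
      hX.eventually ((continuous_id.matrix_det).continuousAt.eventually_ne hX0),
      self_mem_nhdsWithin] with t ht hdet ht0
    refine ⟨hdet, fun c hc => ?_⟩
    have hu : IsUnit (xMatrix Ω q (e t)).det := isUnit_iff_ne_zero.2 hdet
    let d := (xMatrix Ω q (e t))⁻¹.mulVec c
    have hd : (xMatrix Ω q (e t)).mulVec d = c := by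
      rw [Matrix.mulVec_mulVec, Matrix.mul_nonsing_inv _ hu, Matrix.one_mulVec]
    have hd0 : d ≠ 0 := by
      intro h0
      rw [h0, Matrix.mulVec_zero] at hd
      exact hc hd.symm
    have h1 := ht d hd0
    rw [Matrix.smul_mulVec, dotProduct_smul, dotProduct_transpose_mul_mulVec, hd, smul_eq_mul] at h1
    rw [← Matrix.mulVec_mulVec]
    have ht0' : (0 : ℝ) < t⁻¹ := inv_pos.2 ht0
    by_contra hcon
    exact absurd h1 (not_lt.2 (mul_nonneg ht0'.le (not_lt.1 hcon)))

/-- The variation of the phase along a corner path depends on nothing but the dimension. For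
positive times, the path consists of the graphs of symmetric matrices `B`, and the phase is that of
`det (B + i)`. At the end, `B = 0`. Close to the start, `B⁻¹` is negative definite and tends to
zero. -/
theorem argVar_corner {Θ : Matrix (Fin n) (Fin n) ℝ → ℝ} (hΘ : Continuous Θ)
    (hΘB : ∀ B : Matrix (Fin n) (Fin n) ℝ, B.IsSymm →
      sqPhase (B.map (algebraMap ℝ ℂ) + Complex.I • 1).det =
        Complex.exp ((2 * Θ B : ℝ) * Complex.I))
    (hΩ : IsSymplecticOn n Ω W) (h : IsSymplecticBasis Ω W p q) {a : ℝ → Submodule ℝ V}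
    (hL : ∀ t ∈ Icc (0 : ℝ) 1, IsLagrangianIn n Ω W (a t))
    (hp : IsBasisOf p (a 0)) (hq : IsBasisOf q (a 1))
    (hcirc : CircleOn (fun t => phaseOf (complexCoord Ω p q) (a t)) (Icc 0 1))
    (hB : ContinuousOn (fun t => graphMatrix Ω p q (a t)) (Ioc 0 1))
    (htrans : ∀ t ∈ Ioc (0 : ℝ) 1, a t ⊓ a 0 = ⊥) {e : ℝ → Fin n → V} {f : Fin n → V}
    (hea : ∀ᶠ t in 𝓝[≥] (0 : ℝ), IsBasisOf (e t) (a t))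
    (he : ∀ j, HasDerivWithinAt (fun t => e t j) (f j) (Ici 0) 0)
    (hneg : ∀ c : Fin n → ℝ, c ≠ 0 → Ω (∑ j, c j • e 0 j) (∑ j, c j • f j) < 0) :
    argVar (fun t => phaseOf (complexCoord Ω p q) (a t)) 0 1 = 4 * (Θ 0 - Θ (-1)) := by
  obtain ⟨θ, hθ⟩ := exists_isAngle zero_le_one hcirc
  rw [hθ.argVar_eq zero_le_one]
  have hsymm : ∀ t ∈ Ioc (0 : ℝ) 1, ∀ v : Fin n → V, IsBasisOf v (a t) →
      (yMatrix Ω p v).det ≠ 0 ∧ (graphMatrix Ω p q (a t)).IsSymm := fun t ht v hv => by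
    have ht' : t ∈ Icc (0 : ℝ) 1 := ⟨ht.1.le, ht.2⟩
    have hy := det_yMatrix_ne_zero hΩ h hp (hL t ht') hv (htrans t ht)
    refine ⟨hy, ?_⟩
    rw [hv.graphMatrix_eq]
    exact isSymm_mul_inv (transpose_xMatrix_mul_yMatrix hΩ h (hL t ht') hv) hy
  have hB1 : graphMatrix Ω p q (a 1) = 0 := by
    rw [hq.graphMatrix_eq]
    have : xMatrix Ω q q = 0 := by
      ext i j
      exact h.q_q j i
    rw [this, Matrix.zero_mul]
  -- away from the start, `2 Θ (B t)` is an argument of the phase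
  have key : ∀ t ∈ Ioc (0 : ℝ) 1, θ 1 - θ t = 2 * Θ 0 - 2 * Θ (graphMatrix Ω p q (a t)) :=
    fun t ht => by
      have hsub : Icc t 1 ⊆ Ioc 0 1 := fun s hs => ⟨ht.1.trans_le hs.1, hs.2⟩
      have h1 : IsAngle (fun t => phaseOf (complexCoord Ω p q) (a t)) t 1 θ :=
        ⟨hθ.1.mono (hsub.trans Ioc_subset_Icc_self),
          fun s hs => hθ.2 s (Ioc_subset_Icc_self (hsub hs))⟩
      have h2 : IsAngle (fun t => phaseOf (complexCoord Ω p q) (a t)) t 1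
          (fun s => 2 * Θ (graphMatrix Ω p q (a s))) := by
        refine ⟨continuousOn_const.mul (hΘ.comp_continuousOn (hB.mono hsub)), fun s hs => ?_⟩
        obtain ⟨v, hv⟩ := (hL s (Ioc_subset_Icc_self (hsub hs))).exists_basis
        have h3 := hsymm s (hsub hs) v hv
        beta_reduce
        rw [phaseOf_eq_graphMatrix hv h3.1, hΘB _ h3.2]
      rw [← h1.argVar_eq ht.2, h2.argVar_eq ht.2, hB1]
  have hbase := hea.self_of_nhdsWithin (mem_Ici.2 le_rfl)
  obtain ⟨hlim, hev⟩ := eventually_isNegDef_graph hΩ h (hL 0 (by simp)) hp hbase he hneg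
  have hθ0 : Filter.Tendsto θ (𝓝[>] 0) (𝓝 (θ 0)) :=
    (hθ.1 0 (by simp)).tendsto.mono_left (by
      rw [← nhdsWithin_Ioc_eq_nhdsGT (zero_lt_one' ℝ)]
      exact nhdsWithin_mono _ Ioc_subset_Icc_self)
  have hR : Filter.Tendsto (fun t => 2 * Θ 0 - 4 * Θ (-1) +
      2 * Θ (yMatrix Ω p (e t) * (xMatrix Ω q (e t))⁻¹)) (𝓝[>] 0)
      (𝓝 (2 * Θ 0 - 4 * Θ (-1) + 2 * Θ 0)) :=
    tendsto_const_nhds.add (tendsto_const_nhds.mul ((hΘ.tendsto 0).comp hlim))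
  have hLlim : Filter.Tendsto (fun t => θ 1 - θ t) (𝓝[>] 0) (𝓝 (θ 1 - θ 0)) :=
    tendsto_const_nhds.sub hθ0
  -- near the start, express `Θ (B t)` by `Θ` of the inverse matrix, which tends to zero
  have heq : (fun t => θ 1 - θ t) =ᶠ[𝓝[>] 0] fun t => 2 * Θ 0 - 4 * Θ (-1) +
      2 * Θ (yMatrix Ω p (e t) * (xMatrix Ω q (e t))⁻¹) := by
    filter_upwards [hev, hea.filter_mono (nhdsWithin_mono _ Ioi_subset_Ici_self),
      Ioc_mem_nhdsGT (zero_lt_one' ℝ)] with t ht het ht1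
    have hy := (hsymm t ht1 _ het).1
    have hLt := hL t (Ioc_subset_Icc_self ht1)
    have hS := isSymm_mul_inv (transpose_xMatrix_mul_yMatrix hΩ h hLt het).symm ht.1
    have h1 := angle_inv_add_angle hΘ hΘB hS ht.2
    rw [Matrix.mul_inv_rev, Matrix.nonsing_inv_nonsing_inv _ (isUnit_iff_ne_zero.2 ht.1)] at h1
    rw [key t ht1, het.graphMatrix_eq]
    linarith
  have := tendsto_nhds_unique (hLlim.congr' heq) hR
  linarith

end Corner

section CornerPaths

variable {n : ℕ} {M : Type u} [TopologicalSpace M] [ChartedSpace (Model n) M]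
  [IsManifold (𝓡 (2 * n + 1)) ∞ M] {C : ContactForm n M}

theorem isFrame_const {X : Type*} [TopologicalSpace X] {S : Set X} {x : M} {p q : Fin n → Model n}
    (h : IsSymplecticBasis (dForm C x) (xiSpace C x) p q) :
    IsFrame C S (fun _ => x) (fun _ => p) (fun _ => q) :=
  ⟨fun _ => continuousOn_const, fun _ => continuousOn_const, fun _ _ => h⟩

/-- Where a Lagrangian path in a fixed symplectic space is transversal to `⟨p⟩`, the matrix of
which it is the graph is continuous. -/
theorem continuousOn_graphMatrix {S : Set ℝ} {x : M} {p q : Fin n → Model n}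
    (h : IsSymplecticBasis (dForm C x) (xiSpace C x) p q) {a : ℝ → Submodule ℝ (Model n)}
    (ha : IsLagrangianSection C S (fun _ => x) (fun t => ⟨x, a t⟩)) {L₀ : Submodule ℝ (Model n)}
    (hp : IsBasisOf p L₀) (htrans : ∀ t ∈ S, a t ⊓ L₀ = ⊥) :
    ContinuousOn (fun t => graphMatrix (dForm C x) p q (a t)) S := by
  intro t ht
  obtain ⟨U, hU, e, he, heA⟩ := ha.2.2 t ht
  have htU : t ∈ U := mem_of_mem_nhdsWithin ht hU
  let v : ℝ → Fin n → Model n := fun s j => (e s j).2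
  have hv : ∀ j, ContSection U (fun _ => x) (fun s => v s j) := fun j => by
    have h1 : ContinuousOn (fun s => e s j) U := (continuous_apply j).comp_continuousOn he
    exact h1.congr fun s hs => ((heA s hs).isBasisOf.1 j).symm
  have hb : ∀ s ∈ U, IsBasisOf (v s) (a s) := fun s hs => (heA s hs).isBasisOf.2
  have hc := fun j i => (isFrame_const (S := U) h).continuousOn_complexCoord subset_rfl (hv j) i
  have hX : ContinuousOn (fun s => xMatrix (dForm C x) q (v s)) U := by
    refine continuousOn_pi.2 fun i => continuousOn_pi.2 fun j => ?_
    refine (Complex.continuous_re.comp_continuousOn (hc j i)).congr fun s _ => ?_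
    simp [complexCoord_apply, xMatrix]
  have hY : ContinuousOn (fun s => yMatrix (dForm C x) p (v s)) U := by
    refine continuousOn_pi.2 fun i => continuousOn_pi.2 fun j => ?_
    refine (Complex.continuous_im.comp_continuousOn (hc j i)).congr fun s _ => ?_
    simp [complexCoord_apply, yMatrix]
  have hdet := det_yMatrix_ne_zero (isSymplecticOn_xiSpace C x) h hp
    ((ha.2.1 t ht).isLagrangianIn) (hb t htU) (htrans t ht)
  have hinv : ContinuousWithinAt (fun s => (yMatrix (dForm C x) p (v s))⁻¹) U t :=
    ContinuousAt.comp_continuousWithinAt (f := fun s => yMatrix (dForm C x) p (v s))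
      (continuousAt_matrix_inv hdet) (hY t htU)
  have h1 : ContinuousWithinAt (fun s => xMatrix (dForm C x) q (v s) *
      (yMatrix (dForm C x) p (v s))⁻¹) U t := (hX t htU).mul hinv
  exact (h1.congr (fun s hs => (hb s hs).graphMatrix_eq)
    (hb t htU).graphMatrix_eq).mono_of_mem_nhdsWithin hU

variable {R R' : LegendrianSubmanifold C} {γ : ReebChord R R'}

/-- In a symplectic basis which spans the start and the end of a corner path, its variation of the
phase is a constant. -/
theorem ReebChord.IsCornerPath.argVar_eq_of_adapted {Θ : Matrix (Fin n) (Fin n) ℝ → ℝ}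
    (hΘ : Continuous Θ)
    (hΘB : ∀ B : Matrix (Fin n) (Fin n) ℝ, B.IsSymm →
      sqPhase (B.map (algebraMap ℝ ℂ) + Complex.I • 1).det =
        Complex.exp ((2 * Θ B : ℝ) * Complex.I))
    {p q : Fin n → Model n}
    (h : IsSymplecticBasis (dForm C (γ.path 1)) (xiSpace C (γ.path 1)) p q)
    {a : ℝ → Submodule ℝ (TangentSpace (𝓡 (2 * n + 1)) (γ.path 1))} (ha : γ.IsCornerPath a)
    (hp : IsBasisOf p (a 0 : Submodule ℝ (Model n)))
    (hq : IsBasisOf q (a 1 : Submodule ℝ (Model n))) :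
    argVar (fun t => phaseAt C p q ⟨γ.path 1, a t⟩) 0 1 = 4 * (Θ 0 - Θ (-1)) := by
  have htrans : ∀ t ∈ Ioc (0 : ℝ) 1, a t ⊓ a 0 = ⊥ := fun t ht => by
    rw [ha.start]
    exact ha.transversal t ht
  obtain ⟨e, f, hea, he, hneg⟩ := ha.directed
  exact argVar_corner (V := Model n) hΘ hΘB (isSymplecticOn_xiSpace C (γ.path 1)) h (a := a)
    (fun t ht => (ha.isSection.2.1 t ht).isLagrangianIn) hp hq
    (circleOn_phaseAt ha.isSection (isFrame_const h))
    (continuousOn_graphMatrix h (ha.isSection.mono Ioc_subset_Icc_self) hp htrans) htrans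
    hea he hneg

/-- Any two corner paths of a chord have the same phase variation. -/
theorem ReebChord.IsCornerPath.argVar_eq {p q : Fin n → Model n}
    (h : IsSymplecticBasis (dForm C (γ.path 1)) (xiSpace C (γ.path 1)) p q)
    {a a' : ℝ → Submodule ℝ (TangentSpace (𝓡 (2 * n + 1)) (γ.path 1))} (ha : γ.IsCornerPath a)
    (ha' : γ.IsCornerPath a') :
    argVar (fun t => phaseAt C p q ⟨γ.path 1, a t⟩) 0 1 =
      argVar (fun t => phaseAt C p q ⟨γ.path 1, a' t⟩) 0 1 := by
  obtain ⟨Θ, hΘ, hΘB⟩ := exists_angle_det n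
  have h0 : a' 0 = a 0 := ha'.start.trans ha.start.symm
  have h1 : a' 1 = a 1 :=
    eq_of_heq (Sigma.mk.inj (ha'.finish.trans ha.finish.symm)).2
  obtain ⟨P, Q, hPQ, hP, hQ⟩ := exists_adapted_basis (V := Model n)
    (isSymplecticOn_xiSpace C (γ.path 1)) (ha.isSection.2.1 0 (by simp)).isLagrangianIn
    (ha.isSection.2.1 1 (by simp)).isLagrangianIn (by
      have := ha.transversal 1 (by simp)
      rw [← ha.start] at this
      exact this)
  obtain ⟨T, hT⟩ := exists_phaseVar_frameChange (zero_le_one' ℝ) (zero_le_one' ℝ)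
    (isFrame_const (S := Icc (0 : ℝ) 1 ×ˢ Icc (0 : ℝ) 1) hPQ) (isFrame_const h)
  have hm : MapsTo (fun _ : ℝ => ((0 : ℝ), (0 : ℝ))) (Icc 0 1) (Icc (0 : ℝ) 1 ×ˢ Icc (0 : ℝ) 1) :=
    fun _ _ => by simp
  have e1 := hT (fun _ => (0, 0)) (fun t => ⟨γ.path 1, a t⟩) continuousOn_const hm ha.isSection
  have e2 := hT (fun _ => (0, 0)) (fun t => ⟨γ.path 1, a' t⟩) continuousOn_const hm ha'.isSection
  have d1 := ha.argVar_eq_of_adapted hΘ hΘB hPQ hP hQ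
  have d2 := ha'.argVar_eq_of_adapted hΘ hΘB hPQ (by rw [h0]; exact hP) (by rw [h1]; exact hQ)
  rw [h0, h1] at e2
  simp only [phaseVar] at e1 e2
  linarith

end CornerPaths

/-! ### Loops of arcs -/

section Loops

/-- The variation of a continuous argument along a concatenation is the sum of the variations along
the pieces. -/
theorem sum_argVar_eq {N : ℕ} {ζ : Fin N → ℝ → ℂ} {θ : ℝ → ℝ} (hθ : ContinuousOn θ (Icc 0 (N : ℝ)))
    (h : ∀ j : Fin N, ∀ s ∈ Icc (0 : ℝ) 1, ζ j s = Complex.exp (θ ((j : ℕ) + s) * Complex.I)) :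
    ∑ j, argVar (ζ j) 0 1 = θ N - θ 0 := by
  have h1 : ∀ j : Fin N, argVar (ζ j) 0 1 = θ ((j : ℕ) + 1 : ℕ) - θ (j : ℕ) := fun j => by
    have h2 : IsAngle (ζ j) 0 1 (fun s => θ ((j : ℕ) + s)) := by
      refine ⟨hθ.comp (by fun_prop) fun s hs => ⟨add_nonneg (Nat.cast_nonneg _) hs.1, ?_⟩, h j⟩
      have : ((j : ℕ) : ℝ) + 1 ≤ N := by exact_mod_cast j.2
      linarith [hs.2]
    rw [h2.argVar_eq zero_le_one]
    simp
  rw [Finset.sum_congr rfl fun j _ => h1 j,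
    Fin.sum_univ_eq_sum_range (fun j => θ ((j : ℕ) + 1 : ℕ) - θ (j : ℕ)) N,
    Finset.sum_range_sub (fun j : ℕ => θ j)]
  simp

/-- Arguments of functions which match at the junctions can be concatenated. -/
theorem exists_concatenated_angle (N : ℕ) {ζ : ℕ → ℝ → ℂ}
    (h : ∀ j ≤ N, CircleOn (ζ j) (Icc 0 1)) (hj : ∀ j < N, ζ j 1 = ζ (j + 1) 0) :
    ∃ θ : ℝ → ℝ, ContinuousOn θ (Icc 0 ((N : ℝ) + 1)) ∧
      ∀ j ≤ N, ∀ s ∈ Icc (0 : ℝ) 1, ζ j s = Complex.exp (θ (j + s) * Complex.I) := by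
  induction N with
  | zero =>
    obtain ⟨θ, hθ⟩ := exists_isAngle zero_le_one (h 0 le_rfl)
    refine ⟨θ, by simpa using hθ.1, fun j hj0 s hs => ?_⟩
    obtain rfl := Nat.le_zero.1 hj0
    simpa using hθ.2 s hs
  | succ N ih =>
    obtain ⟨θ, hθ, hθz⟩ := ih (fun j hjN => h j (hjN.trans (Nat.le_succ N)))
      fun j hjN => hj j (hjN.trans (Nat.lt_succ_self N))
    obtain ⟨ψ, hψ⟩ := exists_isAngle zero_le_one (h (N + 1) le_rfl)
    have hmatch : Complex.exp (θ (N + 1) * Complex.I) = Complex.exp (ψ 0 * Complex.I) := by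
      rw [← hθz N le_rfl 1 (by simp), ← hψ.2 0 (by simp), hj N (Nat.lt_succ_self N)]
    let η : ℝ → ℝ := fun x => ψ (x - (N + 1)) + (θ (N + 1) - ψ 0)
    have hη : ContinuousOn η (Icc ((N : ℝ) + 1) (N + 1 + 1)) :=
      (hψ.1.comp (by fun_prop) fun x hx => ⟨by linarith [hx.1], by linarith [hx.2]⟩).add
        continuousOn_const
    have hηz : ∀ s ∈ Icc (0 : ℝ) 1, ζ (N + 1) s = Complex.exp (η (N + 1 + s) * Complex.I) :=
      fun s hs => by
        simp only [η, add_sub_cancel_left]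
        push_cast
        rw [add_mul, sub_mul, Complex.exp_add, Complex.exp_sub, hmatch, div_self
          (Complex.exp_ne_zero _), mul_one, ← hψ.2 s hs]
    have h0 : (0 : ℝ) ≤ N := Nat.cast_nonneg N
    refine ⟨fun x => if x ≤ N + 1 then θ x else η x, ?_, fun j hjN s hs => ?_⟩
    · push_cast
      have hu : Icc (0 : ℝ) (N + 1 + 1) = Icc 0 ((N : ℝ) + 1) ∪ Icc ((N : ℝ) + 1) (N + 1 + 1) :=
        (Icc_union_Icc_eq_Icc (by linarith) (by linarith)).symm
      rw [hu]
      refine ContinuousOn.union_of_isClosed ?_ ?_ isClosed_Icc isClosed_Icc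
      · exact hθ.congr fun x hx => if_pos hx.2
      · refine hη.congr fun x hx => ?_
        split_ifs with hle
        · obtain rfl : x = N + 1 := le_antisymm hle hx.1
          simp [η]
        · rfl
    · rcases Nat.lt_or_ge j (N + 1) with hlt | hge
      · have h1 : (j : ℝ) ≤ N := by exact_mod_cast Nat.lt_succ_iff.1 hlt
        beta_reduce
        rw [if_pos (by linarith [hs.2])]
        exact hθz j (Nat.lt_succ_iff.1 hlt) s hs
      · obtain rfl : j = N + 1 := le_antisymm hjN hge
        rw [hηz s hs]
        push_cast
        split_ifs with hle
        · obtain rfl : s = 0 := le_antisymm (by linarith) hs.1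
          simp [η]
        · rfl

variable {n : ℕ} {M : Type u} [TopologicalSpace M] [ChartedSpace (Model n) M]
  [IsManifold (𝓡 (2 * n + 1)) ∞ M] {C : ContactForm n M}

theorem phaseVar_congr {X : Type*} {p q p' q' : X → Fin n → Model n} {b b' : ℝ → X}
    {A A' : ℝ → TangentSubspace n M} (h : ∀ s ∈ Icc (0 : ℝ) 1, p (b s) = p' (b' s) ∧
      q (b s) = q' (b' s) ∧ A s = A' s) : phaseVar C p q b A = phaseVar C p' q' b' A' :=
  argVar_congr fun s hs => by rw [(h s hs).1, (h s hs).2.1, (h s hs).2.2]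

/-- An arc is admissible for the map `w` on `D`: it lies over `D` and is a continuous Lagrangian
section. -/
def IsArc (C : ContactForm n M) (D : Set (ℝ × ℝ)) (w : ℝ × ℝ → M) (a : Arc n M) : Prop :=
  ContinuousOn a.base (Icc 0 1) ∧ MapsTo a.base (Icc 0 1) D ∧
    IsLagrangianSection C (Icc (0 : ℝ) 1) (fun s => w (a.base s)) a.sub

variable {D : Set (ℝ × ℝ)} {w : ℝ × ℝ → M} {p q : ℝ × ℝ → Fin n → Model n}

theorem IsArc.circleOn {a : Arc n M} (ha : IsArc C D w a) (h : IsFrame C D w p q) :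
    CircleOn (fun s => phaseAt C (p (a.base s)) (q (a.base s)) (a.sub s)) (Icc 0 1) :=
  circleOn_phaseAt ha.2.2 (h.comp ha.1 ha.2.1)

theorem mapsTo_one_sub : MapsTo (fun s : ℝ => 1 - s) (Icc 0 1) (Icc 0 1) :=
  fun s hs => ⟨by linarith [hs.2], by linarith [hs.1]⟩

theorem IsArc.rev {a : Arc n M} (ha : IsArc C D w a) : IsArc C D w a.rev :=
  ⟨ha.1.comp (by fun_prop) mapsTo_one_sub, ha.2.1.comp mapsTo_one_sub,
    ha.2.2.comp (by fun_prop) mapsTo_one_sub⟩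

variable (C p q) in
/-- The sum of the variations of the phase along the arcs. -/
noncomputable def loopVar (arcs : List (Arc n M)) : ℝ :=
  (arcs.map fun a => phaseVar C p q a.base a.sub).sum

theorem phaseVar_rev {a : Arc n M} (ha : IsArc C D w a) (h : IsFrame C D w p q) :
    phaseVar C p q a.rev.base a.rev.sub = -phaseVar C p q a.base a.sub :=
  argVar_rev (ha.circleOn h)

/-- An index of a loop is the total variation of the phase, up to the factor `2π`. -/
theorem exists_loopVar_eq_of_isMaslovIndexOfLoop {arcs : List (Arc n M)} {m : ℤ}
    (h : IsMaslovIndexOfLoop C D w arcs m) : (∀ a ∈ arcs, IsArc C D w a) ∧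
      ∃ p q, IsFrame C D w p q ∧ loopVar C p q arcs = 2 * Real.pi * m := by
  obtain ⟨ha, F, θ, hθ, hz, hm⟩ := h
  refine ⟨ha, F.p, F.q, F.isFrame, ?_⟩
  rw [← hm, ← sum_argVar_eq hθ fun j s hs => ((hz j s hs).eq_phaseAt).symm]
  exact (Fin.sum_univ_fun_getElem arcs fun a => phaseVar C F.p F.q a.base a.sub).symm

/-- Conversely, an integer which gives the total variation of the phase is an index, provided that
the arcs match at the junctions. -/
theorem isMaslovIndexOfLoop_of_loopVar {arcs : List (Arc n M)} {m : ℤ} {N : ℕ}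
    (hN : arcs.length = N + 1) (ha : ∀ a ∈ arcs, IsArc C D w a) (h : IsFrame C D w p q)
    (hj : ∀ (j : ℕ) (hjN : j < N), (arcs[j].base 1, arcs[j].sub 1) =
      (arcs[j + 1].base 0, arcs[j + 1].sub 0))
    (hm : loopVar C p q arcs = 2 * Real.pi * m) : IsMaslovIndexOfLoop C D w arcs m := by
  let F : SymplecticFrame C D w :=
    { p := p, q := q, continuousOn_p := h.cont_p, continuousOn_q := h.cont_q
      p_mem := fun z hz => (h.basis z hz).p_mem
      q_mem := fun z hz => (h.basis z hz).q_mem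
      d_p_p := fun z hz => (h.basis z hz).p_p
      d_q_q := fun z hz => (h.basis z hz).q_q
      d_p_q := fun z hz => (h.basis z hz).p_q }
  let ζ : ℕ → ℝ → ℂ := fun j s => if hjN : j < arcs.length then
    phaseAt C (p (arcs[j].base s)) (q (arcs[j].base s)) (arcs[j].sub s) else 1
  have hζ : ∀ j (hjN : j < arcs.length), ζ j =
      fun s => phaseAt C (p (arcs[j].base s)) (q (arcs[j].base s)) (arcs[j].sub s) :=
    fun j hjN => funext fun s => dif_pos hjN
  obtain ⟨θ, hθ, hz⟩ := exists_concatenated_angle N (ζ := ζ) (fun j hjN => by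
      rw [hζ j (by omega)]
      exact (ha _ (List.getElem_mem _)).circleOn h) fun j hjN => by
      rw [hζ j (by omega), hζ (j + 1) (by omega)]
      have h1 := hj j hjN
      rw [Prod.mk.injEq] at h1
      beta_reduce
      rw [h1.1, h1.2]
  have hθ' : ContinuousOn θ (Icc 0 (arcs.length : ℝ)) := by
    rw [hN]
    push_cast
    exact hθ
  have hz' : ∀ j : Fin arcs.length, ∀ s ∈ Icc (0 : ℝ) 1,
      phaseAt C (p (arcs[j].base s)) (q (arcs[j].base s)) (arcs[j].sub s) =
        Complex.exp (θ ((j : ℕ) + s) * Complex.I) := fun j s hs => by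
    have h1 := hz j (by omega) s hs
    rw [hζ j j.2] at h1
    exact h1
  refine ⟨ha, F, θ, hθ', fun j s hs => ?_, ?_⟩
  · rw [← hz' j s hs]
    have hmem := ha _ (List.getElem_mem j.2)
    exact F.isPhase_phaseAt (hmem.2.2.1 s hs) (hmem.2.2.2.1 s hs)
  · rw [← hm, ← sum_argVar_eq hθ' hz']
    exact Fin.sum_univ_fun_getElem arcs fun a => phaseVar C p q a.base a.sub

end Loops

/-! ### Invariance of the index of a bounding square -/

section Squares

variable {n : ℕ} {M : Type u} [TopologicalSpace M] [ChartedSpace (Model n) M]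
  [IsManifold (𝓡 (2 * n + 1)) ∞ M] {C : ContactForm n M}
  {R R' : LegendrianSubmanifold C} {γ : ReebChord R R'} {ℓ : GradedBridge R R'}

/-- At time zero the flow is the identity at every point, by its initial condition or by its default
value. -/
theorem ContactForm.reebFlow_zero (C : ContactForm n M) : C.reebFlow 0 = id := by
  funext x
  rw [ContactForm.reebFlow]
  split_ifs with h
  · exact h.choose_spec.1
  · rfl

theorem ReebChord.transport_zero (γ : ReebChord R R') : γ.transport 0 = R.gauss (γ.path 0) := by
  have h0 : C.reebFlow (γ.period * 0) = id := by rw [mul_zero, C.reebFlow_zero]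
  have h1 : γ.transport 0 = ⟨C.reebFlow (γ.period * 0) (γ.path 0),
    (R.tangentAt (γ.path 0)).map
      (mfderiv (𝓡 (2 * n + 1)) (𝓡 (2 * n + 1)) (C.reebFlow (γ.period * 0)) (γ.path 0) :
        TangentSpace (𝓡 (2 * n + 1)) (γ.path 0) →ₗ[ℝ] _)⟩ := rfl
  rw [h1, h0, mfderiv_id]
  exact congrArg (Sigma.mk (γ.path 0)) (Submodule.map_id _)

/-- The value of the index of the square `w` in the frame `p, q`: the sum of the variations of the
phase along the five arcs, with signs. -/
noncomputable def BoundingSquare.phaseSum (w : BoundingSquare ℓ γ) (p q : ℝ × ℝ → Fin n → Model n)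
    (a : ℝ → Submodule ℝ (TangentSpace (𝓡 (2 * n + 1)) (γ.path 1))) : ℝ :=
  -phaseVar C p q (fun t => (0, t)) ℓ.grading +
    phaseVar C p q (fun τ => (τ, 0)) (fun τ => R.gauss (w.map (τ, 0))) +
    phaseVar C p q (fun t => (1, t)) γ.transport -
    phaseVar C p q (fun _ => (1, 1)) (fun t => ⟨γ.path 1, a t⟩) -
    phaseVar C p q (fun τ => (τ, 1)) (fun τ => R'.gauss (w.map (τ, 1)))

namespace BoundingSquare

variable (w : BoundingSquare ℓ γ)

theorem isArc_bridge : IsArc C unitSquare w.map ⟨fun t => (0, t), fun t => ℓ.grading t⟩ :=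
  ⟨by fun_prop, fun t ht => ⟨by simp, ht⟩, ℓ.isSection.congr w.left fun _ _ => rfl⟩

theorem isArc_bottom :
    IsArc C unitSquare w.map ⟨fun τ => (τ, 0), fun τ => R.gauss (w.map (τ, 0))⟩ :=
  ⟨by fun_prop, fun τ hτ => ⟨hτ, by simp⟩, R.isLagrangianSection_gauss
    (w.continuousOn_map.comp (by fun_prop) fun τ hτ => ⟨hτ, by simp⟩) w.bottom⟩

theorem isArc_chord (hγ : IsLagrangianSection C (Icc 0 1) γ.path γ.transport) :
    IsArc C unitSquare w.map ⟨fun t => (1, t), fun t => γ.transport t⟩ :=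
  ⟨by fun_prop, fun t ht => ⟨by simp, ht⟩, hγ.congr w.right fun _ _ => rfl⟩

theorem map_one_one : w.map (1, 1) = γ.path 1 := w.right 1 (by simp)

theorem isArc_corner {a : ℝ → Submodule ℝ (TangentSpace (𝓡 (2 * n + 1)) (γ.path 1))}
    (ha : γ.IsCornerPath a) :
    IsArc C unitSquare w.map ⟨fun _ => (1, 1), fun t => ⟨γ.path 1, a t⟩⟩ :=
  ⟨by fun_prop, fun t ht => ⟨by simp, by simp⟩,
    ha.isSection.congr (fun _ _ => w.map_one_one) fun _ _ => rfl⟩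

theorem isArc_top :
    IsArc C unitSquare w.map ⟨fun τ => (τ, 1), fun τ => R'.gauss (w.map (τ, 1))⟩ :=
  ⟨by fun_prop, fun τ hτ => ⟨hτ, by simp⟩, R'.isLagrangianSection_gauss
    (w.continuousOn_map.comp (by fun_prop) fun τ hτ => ⟨hτ, by simp⟩) w.top⟩

theorem isArc_of_mem_loop (hγ : IsLagrangianSection C (Icc 0 1) γ.path γ.transport)
    {a : ℝ → Submodule ℝ (TangentSpace (𝓡 (2 * n + 1)) (γ.path 1))} (ha : γ.IsCornerPath a) :
    ∀ b ∈ w.loop a, IsArc C unitSquare w.map b := by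
  simp only [loop, List.mem_cons, List.not_mem_nil, or_false]
  rintro b (rfl | rfl | rfl | rfl | rfl)
  exacts [w.isArc_bridge.rev, w.isArc_bottom, w.isArc_chord hγ, (w.isArc_corner ha).rev,
    w.isArc_top.rev]

theorem loopVar_loop
    {a : ℝ → Submodule ℝ (TangentSpace (𝓡 (2 * n + 1)) (γ.path 1))} (ha : γ.IsCornerPath a)
    {p q : ℝ × ℝ → Fin n → Model n} (h : IsFrame C unitSquare w.map p q) :
    loopVar C p q (w.loop a) = w.phaseSum p q a := by
  simp only [loopVar, loop, List.map_cons, List.map_nil, List.sum_cons, List.sum_nil,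
    phaseVar_rev w.isArc_bridge h, phaseVar_rev (w.isArc_corner ha) h, phaseVar_rev w.isArc_top h,
    phaseSum]
  ring

theorem phaseSum_corner {a a' : ℝ → Submodule ℝ (TangentSpace (𝓡 (2 * n + 1)) (γ.path 1))}
    (ha : γ.IsCornerPath a) (ha' : γ.IsCornerPath a') {p q : ℝ × ℝ → Fin n → Model n}
    (h : IsFrame C unitSquare w.map p q) : w.phaseSum p q a = w.phaseSum p q a' := by
  have hb := h.basis (1, 1) ⟨by simp, by simp⟩
  rw [w.map_one_one] at hb
  have h1 : phaseVar C p q (fun _ => ((1 : ℝ), (1 : ℝ))) (fun t => ⟨γ.path 1, a t⟩) =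
      phaseVar C p q (fun _ => ((1 : ℝ), (1 : ℝ))) (fun t => ⟨γ.path 1, a' t⟩) :=
    ha.argVar_eq hb ha'
  rw [phaseSum, phaseSum, h1]

/-- The terms at the corners, by which the variations along the arcs change under a homotopy and a
change of frame, cancel. -/
theorem phaseSum_of_homotopic {w w' : BoundingSquare ℓ γ} (hw : w.Homotopic w')
    (hγ : IsLagrangianSection C (Icc 0 1) γ.path γ.transport)
    {a : ℝ → Submodule ℝ (TangentSpace (𝓡 (2 * n + 1)) (γ.path 1))} (ha : γ.IsCornerPath a)
    {p q p' q' : ℝ × ℝ → Fin n → Model n} (h : IsFrame C unitSquare w.map p q)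
    (h' : IsFrame C unitSquare w'.map p' q') : w.phaseSum p q a = w'.phaseSum p' q' a := by
  obtain ⟨K, hK, hK0, hK1, hKr⟩ := hw
  obtain ⟨T, hTc, hT⟩ := exists_phaseVar_homotopy (zero_lt_one' ℝ) hK (h.congr hK0) (h'.congr hK1)
  have h0 : (0 : ℝ) ∈ Icc (0 : ℝ) 1 := by simp
  have h1 : (1 : ℝ) ∈ Icc (0 : ℝ) 1 := by simp
  have hleft : ∀ r ∈ Icc (0 : ℝ) 1, ∀ t ∈ Icc (0 : ℝ) 1, K (r, 0, t) = ℓ.path t :=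
    fun r hr t ht => by
      obtain ⟨v, hv⟩ := hKr r hr
      rw [hv (0, t) ⟨h0, ht⟩, v.left t ht]
  have hright : ∀ r ∈ Icc (0 : ℝ) 1, ∀ t ∈ Icc (0 : ℝ) 1, K (r, 1, t) = γ.path t :=
    fun r hr t ht => by
      obtain ⟨v, hv⟩ := hKr r hr
      rw [hv (1, t) ⟨h1, ht⟩, v.right t ht]
  have hbot : ∀ r ∈ Icc (0 : ℝ) 1, ∀ τ ∈ Icc (0 : ℝ) 1, K (r, τ, 0) ∈ R.points :=
    fun r hr τ hτ => by
      obtain ⟨v, hv⟩ := hKr r hr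
      rw [hv (τ, 0) ⟨hτ, h0⟩]
      exact v.bottom τ hτ
  have htop : ∀ r ∈ Icc (0 : ℝ) 1, ∀ τ ∈ Icc (0 : ℝ) 1, K (r, τ, 1) ∈ R'.points :=
    fun r hr τ hτ => by
      obtain ⟨v, hv⟩ := hKr r hr
      rw [hv (τ, 1) ⟨hτ, h1⟩]
      exact v.top τ hτ
  have hsnd : MapsTo (fun z : ℝ × ℝ => z.2) (Icc (0 : ℝ) 1 ×ˢ Icc (0 : ℝ) 1) (Icc 0 1) :=
    fun z hz => hz.2
  have eℓ := hT (fun t => (0, t)) (fun _ t => ℓ.grading t) (by fun_prop) (fun t ht => ⟨h0, ht⟩)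
    ((ℓ.isSection.comp continuousOn_snd hsnd).congr (fun z hz => hleft z.1 hz.1 z.2 hz.2)
      fun _ _ => rfl)
  have eb := hT (fun τ => (τ, 0)) (fun r τ => R.gauss (K (r, τ, 0))) (by fun_prop)
    (fun τ hτ => ⟨hτ, h0⟩) (R.isLagrangianSection_gauss
      (hK.comp (by fun_prop) fun z hz => ⟨hz.1, hz.2, h0⟩) fun z hz => hbot z.1 hz.1 z.2 hz.2)
  have eγ := hT (fun t => (1, t)) (fun _ t => γ.transport t) (by fun_prop) (fun t ht => ⟨h1, ht⟩)
    ((hγ.comp continuousOn_snd hsnd).congr (fun z hz => hright z.1 hz.1 z.2 hz.2)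
      fun _ _ => rfl)
  have ea := hT (fun _ => (1, 1)) (fun _ t => ⟨γ.path 1, a t⟩) (by fun_prop) (fun t ht => ⟨h1, h1⟩)
    ((ha.isSection.comp continuousOn_snd hsnd).congr (fun z hz => hright z.1 hz.1 1 h1)
      fun _ _ => rfl)
  have et := hT (fun τ => (τ, 1)) (fun r τ => R'.gauss (K (r, τ, 1))) (by fun_prop)
    (fun τ hτ => ⟨hτ, h1⟩) (R'.isLagrangianSection_gauss
      (hK.comp (by fun_prop) fun z hz => ⟨hz.1, hz.2, h1⟩) fun z hz => htop z.1 hz.1 z.2 hz.2)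
  -- the corners match
  have c00 : T (0, 0) (fun r => R.gauss (K (r, 0, 0))) = T (0, 0) (fun _ => ℓ.grading 0) :=
    hTc _ _ _ fun r hr => by rw [hleft r hr 0 h0, ℓ.grading_zero]
  have c10 : T (1, 0) (fun r => R.gauss (K (r, 1, 0))) = T (1, 0) (fun _ => γ.transport 0) :=
    hTc _ _ _ fun r hr => by rw [hright r hr 0 h0, γ.transport_zero]
  have c01 : T (0, 1) (fun r => R'.gauss (K (r, 0, 1))) = T (0, 1) (fun _ => ℓ.grading 1) :=
    hTc _ _ _ fun r hr => by rw [hleft r hr 1 h1, ℓ.grading_one]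
  have c11 : T (1, 1) (fun r => R'.gauss (K (r, 1, 1))) = T (1, 1) (fun _ => ⟨γ.path 1, a 0⟩) :=
    hTc _ _ _ fun r hr => by rw [hright r hr 1 h1, ha.start]; rfl
  have c11' : T (1, 1) (fun _ => ⟨γ.path 1, a 1⟩) = T (1, 1) (fun _ => γ.transport 1) :=
    hTc _ _ _ fun r hr => ha.finish
  have eb0 : phaseVar C p q (fun τ => (τ, 0)) (fun τ => R.gauss (K (0, τ, 0))) =
      phaseVar C p q (fun τ => (τ, 0)) (fun τ => R.gauss (w.map (τ, 0))) :=
    phaseVar_congr fun τ hτ => ⟨rfl, rfl, by rw [hK0 (τ, 0) ⟨hτ, h0⟩]⟩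
  have eb1 : phaseVar C p' q' (fun τ => (τ, 0)) (fun τ => R.gauss (K (1, τ, 0))) =
      phaseVar C p' q' (fun τ => (τ, 0)) (fun τ => R.gauss (w'.map (τ, 0))) :=
    phaseVar_congr fun τ hτ => ⟨rfl, rfl, by rw [hK1 (τ, 0) ⟨hτ, h0⟩]⟩
  have et0 : phaseVar C p q (fun τ => (τ, 1)) (fun τ => R'.gauss (K (0, τ, 1))) =
      phaseVar C p q (fun τ => (τ, 1)) (fun τ => R'.gauss (w.map (τ, 1))) :=
    phaseVar_congr fun τ hτ => ⟨rfl, rfl, by rw [hK0 (τ, 1) ⟨hτ, h1⟩]⟩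
  have et1 : phaseVar C p' q' (fun τ => (τ, 1)) (fun τ => R'.gauss (K (1, τ, 1))) =
      phaseVar C p' q' (fun τ => (τ, 1)) (fun τ => R'.gauss (w'.map (τ, 1))) :=
    phaseVar_congr fun τ hτ => ⟨rfl, rfl, by rw [hK1 (τ, 1) ⟨hτ, h1⟩]⟩
  simp only [phaseSum]
  linarith

theorem homotopic_refl (w : BoundingSquare ℓ γ) : w.Homotopic w :=
  ⟨fun z => w.map z.2, w.continuousOn_map.comp continuousOn_snd fun _ hz => hz.2,
    fun _ _ => rfl, fun _ _ => rfl, fun _ _ => ⟨w, fun _ _ => rfl⟩⟩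

theorem hasFrame (w : BoundingSquare ℓ γ) : HasFrame C unitSquare w.map :=
  hasFrame_rectangle zero_lt_one w.continuousOn_map

theorem phaseSum_eq {w w' : BoundingSquare ℓ γ}
    (hw : Quot.mk (BoundingSquare.Homotopic (ℓ := ℓ) (γ := γ)) w = Quot.mk _ w')
    (hγ : IsLagrangianSection C (Icc 0 1) γ.path γ.transport)
    {a : ℝ → Submodule ℝ (TangentSpace (𝓡 (2 * n + 1)) (γ.path 1))} (ha : γ.IsCornerPath a)
    {p q p' q' : ℝ × ℝ → Fin n → Model n} (h : IsFrame C unitSquare w.map p q)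
    (h' : IsFrame C unitSquare w'.map p' q') : w.phaseSum p q a = w'.phaseSum p' q' a := by
  have h1 := Quot.eqvGen_exact hw
  induction h1 generalizing p q p' q' with
  | rel _ _ hr => exact phaseSum_of_homotopic hr hγ ha h h'
  | refl x => exact phaseSum_of_homotopic x.homotopic_refl hγ ha h h'
  | symm x y hxy ih => exact (ih (Quot.eqvGen_sound hxy) h' h).symm
  | trans x y z hxy hyz ih ih' =>
    obtain ⟨P, Q, hPQ⟩ := y.hasFrame
    exact (ih (Quot.eqvGen_sound hxy) h hPQ).trans (ih' (Quot.eqvGen_sound hyz) hPQ h')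

end BoundingSquare

/-- The transported tangent spaces along a chord form a continuous Lagrangian path as soon as
some square of the chord has an index. -/
theorem SquareClass.IsMaslovIndex.isLagrangianSection_transport {c : SquareClass ℓ γ} {m : ℤ}
    (h : c.IsMaslovIndex m) : IsLagrangianSection C (Icc 0 1) γ.path γ.transport := by
  obtain ⟨w, -, a, -, hm⟩ := h
  have h1 := hm.1 ⟨fun t => (1, t), fun t => γ.transport t⟩ (by simp [BoundingSquare.loop])
  exact h1.2.2.congr (fun t ht => (w.right t ht).symm) fun _ _ => rfl

theorem SquareClass.IsMaslovIndex.exists_isCornerPath {c : SquareClass ℓ γ} {m : ℤ}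
    (h : c.IsMaslovIndex m) : ∃ a, γ.IsCornerPath a := by
  obtain ⟨w, -, a, ha, -⟩ := h
  exact ⟨a, ha⟩

/-- The index of a class of squares can be computed from any representative, any corner path and
any frame. -/
theorem SquareClass.IsMaslovIndex.phaseSum_eq {c : SquareClass ℓ γ} {m : ℤ}
    (h : c.IsMaslovIndex m) {w : BoundingSquare ℓ γ} (hw : Quot.mk _ w = c)
    {a : ℝ → Submodule ℝ (TangentSpace (𝓡 (2 * n + 1)) (γ.path 1))} (ha : γ.IsCornerPath a)
    {p q : ℝ × ℝ → Fin n → Model n} (hpq : IsFrame C unitSquare w.map p q) :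
    w.phaseSum p q a = 2 * Real.pi * m := by
  have hγ := h.isLagrangianSection_transport
  obtain ⟨w', hw', a', ha', hm⟩ := h
  obtain ⟨-, p', q', hpq', hsum⟩ := exists_loopVar_eq_of_isMaslovIndexOfLoop hm
  rw [← hsum, w'.loopVar_loop ha' hpq', w'.phaseSum_corner ha' ha hpq']
  exact BoundingSquare.phaseSum_eq (hw.trans hw'.symm) hγ ha hpq hpq'

theorem SquareClass.isMaslovIndex_of_phaseSum {w : BoundingSquare ℓ γ} {m : ℤ}
    (hγ : IsLagrangianSection C (Icc 0 1) γ.path γ.transport)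
    {a : ℝ → Submodule ℝ (TangentSpace (𝓡 (2 * n + 1)) (γ.path 1))} (ha : γ.IsCornerPath a)
    {p q : ℝ × ℝ → Fin n → Model n} (hpq : IsFrame C unitSquare w.map p q)
    (hm : w.phaseSum p q a = 2 * Real.pi * m) :
    SquareClass.IsMaslovIndex (Quot.mk _ w : SquareClass ℓ γ) m := by
  refine ⟨w, rfl, a, ha, isMaslovIndexOfLoop_of_loopVar (N := 4) rfl (w.isArc_of_mem_loop hγ ha)
    hpq ?_ ((w.loopVar_loop ha hpq).trans hm)⟩
  have h0 : (0 : ℝ) ∈ Icc (0 : ℝ) 1 := by simp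
  have h1 : (1 : ℝ) ∈ Icc (0 : ℝ) 1 := by simp
  intro j hj
  interval_cases j
  · refine Prod.ext (by simp [BoundingSquare.loop, Arc.rev]) ?_
    change ℓ.grading (1 - 1) = R.gauss (w.map (0, 0))
    rw [sub_self, ℓ.grading_zero, w.left 0 h0]
  · refine Prod.ext (by simp [BoundingSquare.loop, Arc.rev]) ?_
    change R.gauss (w.map (1, 0)) = γ.transport 0
    rw [γ.transport_zero, w.right 0 h0]
  · refine Prod.ext (by simp [BoundingSquare.loop, Arc.rev]) ?_
    change γ.transport 1 = ⟨γ.path 1, a (1 - 0)⟩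
    rw [sub_zero, ha.finish]
  · refine Prod.ext (by simp [BoundingSquare.loop, Arc.rev]) ?_
    change (⟨γ.path 1, a (1 - 1)⟩ : TangentSubspace n M) = R'.gauss (w.map (1 - 0, 1))
    rw [sub_self, sub_zero, ha.start, w.map_one_one]
    rfl

end Squares

/-! ### Invariance of the index of a polygon -/

section Telescope

/-- Telescoping of differences between odd and even vertices of the left side of the polygon. -/
theorem sum_sub_ite_eq {k : ℕ} (x l : Fin (k + 1) → ℝ)
    (h : ∀ j : Fin k, l j.succ = x j.castSucc) :
    ∑ i : Fin (k + 1), (x i - if 0 < (i : ℕ) then l i else 0) = x (Fin.last k) := by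
  rw [Finset.sum_sub_distrib, Fin.sum_univ_castSucc,
    Fin.sum_univ_succ (fun i : Fin (k + 1) => if 0 < (i : ℕ) then l i else 0)]
  simp [h]

end Telescope

section Polygons

variable {n k : ℕ} {M : Type u} [TopologicalSpace M] [ChartedSpace (Model n) M]
  [IsManifold (𝓡 (2 * n + 1)) ∞ M] {C : ContactForm n M}
  {R : Fin (k + 1) → LegendrianSubmanifold C}
  {γ : ∀ i : Fin k, ReebChord (R i.castSucc) (R i.succ)}
  {γ₀ : ReebChord (R 0) (R (Fin.last k))}

/-- The value of the index of the polygon `u` in the frame `p, q`: the sum of the variations of the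
phase along the arcs, with signs. -/
noncomputable def Polygon.phaseSum (u : Polygon R γ γ₀) (p q : ℝ × ℝ → Fin n → Model n)
    (a : ∀ i, ℝ → Submodule ℝ (TangentSpace (𝓡 (2 * n + 1)) ((γ i).path 1)))
    (a₀ : ℝ → Submodule ℝ (TangentSpace (𝓡 (2 * n + 1)) (γ₀.path 1))) : ℝ :=
  phaseVar C p q (fun τ => (τ, 0)) (fun τ => (R 0).gauss (u.map (τ, 0))) +
    phaseVar C p q (fun s => (1, (2 * (k : ℝ) - 1) * s)) γ₀.transport -
    phaseVar C p q (fun _ => (1, 2 * (k : ℝ) - 1)) (fun s => ⟨γ₀.path 1, a₀ s⟩) -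
    phaseVar C p q (fun τ => (τ, 2 * (k : ℝ) - 1))
      (fun τ => (R (Fin.last k)).gauss (u.map (τ, 2 * (k : ℝ) - 1))) +
    ∑ i : Fin k, (phaseVar C p q (fun _ => (0, 2 * ((i : ℕ) : ℝ) + 1))
        (fun s => ⟨(γ i).path 1, a i s⟩) -
      phaseVar C p q (fun s => (0, 2 * ((i : ℕ) : ℝ) + s)) (γ i).transport -
      if 0 < (i : ℕ) then phaseVar C p q (fun s => (0, 2 * ((i : ℕ) : ℝ) - 1 + s))
        (fun s => (R i.castSucc).gauss (u.map (0, 2 * ((i : ℕ) : ℝ) - 1 + s))) else 0)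

namespace Polygon

theorem cast_bound (i : Fin k) : 2 * ((i : ℕ) : ℝ) + 1 ≤ 2 * (k : ℝ) - 1 := by
  have : ((i : ℕ) : ℝ) + 1 ≤ k := by exact_mod_cast i.2
  linarith

theorem chord_mem (i : Fin k) {s : ℝ} (hs : s ∈ Icc (0 : ℝ) 1) :
    2 * ((i : ℕ) : ℝ) + s ∈ Icc 0 (2 * (k : ℝ) - 1) :=
  ⟨by have := hs.1; positivity, by linarith [hs.2, cast_bound i]⟩

theorem edge_mem (i : Fin k) (hi : 0 < (i : ℕ)) {s : ℝ} (hs : s ∈ Icc (0 : ℝ) 1) :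
    2 * ((i : ℕ) : ℝ) - 1 + s ∈ Icc 0 (2 * (k : ℝ) - 1) := by
  have h1 : (1 : ℝ) ≤ (i : ℕ) := by exact_mod_cast hi
  exact ⟨by linarith [hs.1], by linarith [hs.2, cast_bound i]⟩

theorem width_pos (hk : 1 ≤ k) : 0 < 2 * (k : ℝ) - 1 := by
  have : (1 : ℝ) ≤ k := by exact_mod_cast hk
  linarith

variable (u : Polygon R γ γ₀)

theorem isArc_top (hk : 1 ≤ k) : IsArc C (polygonDomain k) u.map ⟨fun τ => (τ, 2 * (k : ℝ) - 1),
    fun τ => (R (Fin.last k)).gauss (u.map (τ, 2 * (k : ℝ) - 1))⟩ := by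
  have hm : MapsTo (fun τ : ℝ => (τ, 2 * (k : ℝ) - 1)) (Icc 0 1) (polygonDomain k) :=
    fun τ hτ => ⟨hτ, (width_pos hk).le, le_rfl⟩
  exact ⟨by fun_prop, hm, (R (Fin.last k)).isLagrangianSection_gauss
    (u.continuousOn_map.comp (by fun_prop) hm) u.top⟩

theorem map_one_width : u.map (1, 2 * (k : ℝ) - 1) = γ₀.path 1 := by
  have := u.right 1 (by simp)
  rwa [mul_one] at this

theorem isArc_corner₀ (hk : 1 ≤ k)
    {a₀ : ℝ → Submodule ℝ (TangentSpace (𝓡 (2 * n + 1)) (γ₀.path 1))} (ha₀ : γ₀.IsCornerPath a₀) :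
    IsArc C (polygonDomain k) u.map
      ⟨fun _ => (1, 2 * (k : ℝ) - 1), fun s => ⟨γ₀.path 1, a₀ s⟩⟩ :=
  ⟨by fun_prop, fun _ _ => ⟨by simp, (width_pos hk).le, le_rfl⟩,
    ha₀.isSection.congr (fun _ _ => u.map_one_width) fun _ _ => rfl⟩

theorem map_left_corner (i : Fin k) : u.map (0, 2 * ((i : ℕ) : ℝ) + 1) = (γ i).path 1 :=
  u.left_chord i 1 (by simp)

theorem isArc_chord {i : Fin k}
    (hγ : IsLagrangianSection C (Icc 0 1) (γ i).path (γ i).transport) :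
    IsArc C (polygonDomain k) u.map
      ⟨fun s => (0, 2 * ((i : ℕ) : ℝ) + s), fun s => (γ i).transport s⟩ :=
  ⟨by fun_prop, fun _ hs => ⟨by simp, chord_mem i hs⟩,
    hγ.congr (u.left_chord i) fun _ _ => rfl⟩

theorem isArc_edge {i : Fin k} (hi : 0 < (i : ℕ)) : IsArc C (polygonDomain k) u.map
    ⟨fun s => (0, 2 * ((i : ℕ) : ℝ) - 1 + s),
      fun s => (R i.castSucc).gauss (u.map (0, 2 * ((i : ℕ) : ℝ) - 1 + s))⟩ := by
  have hm : MapsTo (fun s : ℝ => ((0 : ℝ), 2 * ((i : ℕ) : ℝ) - 1 + s)) (Icc 0 1)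
      (polygonDomain k) := fun s hs => ⟨by simp, edge_mem i hi hs⟩
  exact ⟨by fun_prop, hm, (R i.castSucc).isLagrangianSection_gauss
    (u.continuousOn_map.comp (by fun_prop) hm) (u.left_edge i hi)⟩

theorem loopVar_loop (hk : 1 ≤ k)
    (hγ : ∀ i, IsLagrangianSection C (Icc 0 1) (γ i).path (γ i).transport)
    {a : ∀ i, ℝ → Submodule ℝ (TangentSpace (𝓡 (2 * n + 1)) ((γ i).path 1))}
    {a₀ : ℝ → Submodule ℝ (TangentSpace (𝓡 (2 * n + 1)) (γ₀.path 1))}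
    (ha₀ : γ₀.IsCornerPath a₀)
    {p q : ℝ × ℝ → Fin n → Model n} (h : IsFrame C (polygonDomain k) u.map p q) :
    loopVar C p q (u.loop a a₀) = u.phaseSum p q a a₀ := by
  rw [loopVar, loop, List.map_append, List.sum_append, phaseSum, List.map_flatten, List.sum_flatten,
    List.map_reverse, List.map_reverse, List.sum_reverse, List.map_ofFn, List.map_ofFn,
    List.sum_ofFn]
  congr 1
  · simp only [List.map_cons, List.map_nil, List.sum_cons, List.sum_nil,
      phaseVar_rev (u.isArc_corner₀ hk ha₀) h, phaseVar_rev (u.isArc_top hk) h]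
    ring
  · refine Finset.sum_congr rfl fun i _ => ?_
    have h1 := phaseVar_rev (u.isArc_chord (hγ i)) h
    simp only [Function.comp_apply]
    split_ifs with hi
    · simp only [List.map_cons, List.map_nil, List.sum_cons, List.sum_nil, List.cons_append,
        List.nil_append, h1, phaseVar_rev (u.isArc_edge hi) h]
      ring
    · simp only [List.map_cons, List.map_nil, List.sum_cons, List.sum_nil, List.append_nil, h1]
      ring

theorem phaseSum_corner {a a' : ∀ i, ℝ → Submodule ℝ (TangentSpace (𝓡 (2 * n + 1)) ((γ i).path 1))}
    {a₀ a₀' : ℝ → Submodule ℝ (TangentSpace (𝓡 (2 * n + 1)) (γ₀.path 1))} (hk : 1 ≤ k)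
    (ha : ∀ i, (γ i).IsCornerPath (a i)) (ha' : ∀ i, (γ i).IsCornerPath (a' i))
    (ha₀ : γ₀.IsCornerPath a₀) (ha₀' : γ₀.IsCornerPath a₀')
    {p q : ℝ × ℝ → Fin n → Model n} (h : IsFrame C (polygonDomain k) u.map p q) :
    u.phaseSum p q a a₀ = u.phaseSum p q a' a₀' := by
  have hb := h.basis (1, 2 * (k : ℝ) - 1) ⟨by simp, (width_pos hk).le, le_rfl⟩
  rw [u.map_one_width] at hb
  have h1 : phaseVar C p q (fun _ => ((1 : ℝ), 2 * (k : ℝ) - 1)) (fun s => ⟨γ₀.path 1, a₀ s⟩) =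
      phaseVar C p q (fun _ => ((1 : ℝ), 2 * (k : ℝ) - 1)) (fun s => ⟨γ₀.path 1, a₀' s⟩) :=
    ha₀.argVar_eq hb ha₀'
  have h2 : ∀ i : Fin k, phaseVar C p q (fun _ => ((0 : ℝ), 2 * ((i : ℕ) : ℝ) + 1))
        (fun s => ⟨(γ i).path 1, a i s⟩) =
      phaseVar C p q (fun _ => ((0 : ℝ), 2 * ((i : ℕ) : ℝ) + 1))
        (fun s => ⟨(γ i).path 1, a' i s⟩) := fun i => by
    have hbi := h.basis (0, 2 * ((i : ℕ) : ℝ) + 1) ⟨by simp, chord_mem i (by simp)⟩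
    rw [u.map_left_corner i] at hbi
    exact (ha i).argVar_eq hbi (ha' i)
  simp only [phaseSum, h1, h2]

end Polygon

end Polygons

section PolygonClasses

variable {n k : ℕ} {M : Type u} [TopologicalSpace M] [ChartedSpace (Model n) M]
  [IsManifold (𝓡 (2 * n + 1)) ∞ M] {C : ContactForm n M}
  {R : Fin (k + 1) → LegendrianSubmanifold C}
  {γ : ∀ i : Fin k, ReebChord (R i.castSucc) (R i.succ)}
  {γ₀ : ReebChord (R 0) (R (Fin.last k))}

namespace Polygon

/-- The terms at the corners, by which the variations along the arcs change under a homotopy and a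
change of frame, cancel. -/
theorem phaseSum_of_homotopic (hk : 1 ≤ k) {u u' : Polygon R γ γ₀} (hu : u.Homotopic u')
    (hγ : ∀ i, IsLagrangianSection C (Icc 0 1) (γ i).path (γ i).transport)
    (hγ₀ : IsLagrangianSection C (Icc 0 1) γ₀.path γ₀.transport)
    {a : ∀ i, ℝ → Submodule ℝ (TangentSpace (𝓡 (2 * n + 1)) ((γ i).path 1))}
    {a₀ : ℝ → Submodule ℝ (TangentSpace (𝓡 (2 * n + 1)) (γ₀.path 1))}
    (ha : ∀ i, (γ i).IsCornerPath (a i)) (ha₀ : γ₀.IsCornerPath a₀)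
    {p q p' q' : ℝ × ℝ → Fin n → Model n} (h : IsFrame C (polygonDomain k) u.map p q)
    (h' : IsFrame C (polygonDomain k) u'.map p' q') :
    u.phaseSum p q a a₀ = u'.phaseSum p' q' a a₀ := by
  obtain ⟨K, hK, hK0, hK1, hKr⟩ := hu
  have hc := width_pos hk
  obtain ⟨T, hTc, hT⟩ := exists_phaseVar_homotopy hc hK (h.congr hK0) (h'.congr hK1)
  have h0 : (0 : ℝ) ∈ Icc (0 : ℝ) 1 := by simp
  have h1 : (1 : ℝ) ∈ Icc (0 : ℝ) 1 := by simp
  have hc0 : (0 : ℝ) ∈ Icc (0 : ℝ) (2 * (k : ℝ) - 1) := ⟨le_rfl, hc.le⟩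
  have hc1 : 2 * (k : ℝ) - 1 ∈ Icc (0 : ℝ) (2 * (k : ℝ) - 1) := ⟨hc.le, le_rfl⟩
  have hcs : ∀ s ∈ Icc (0 : ℝ) 1, (2 * (k : ℝ) - 1) * s ∈ Icc (0 : ℝ) (2 * (k : ℝ) - 1) :=
    fun s hs => ⟨mul_nonneg hc.le hs.1, mul_le_of_le_one_right hc.le hs.2⟩
  have hright : ∀ r ∈ Icc (0 : ℝ) 1, ∀ s ∈ Icc (0 : ℝ) 1,
      K (r, 1, (2 * (k : ℝ) - 1) * s) = γ₀.path s := fun r hr s hs => by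
    obtain ⟨v, hv⟩ := hKr r hr
    rw [hv (1, _) ⟨h1, hcs s hs⟩, v.right s hs]
  have hright0 : ∀ r ∈ Icc (0 : ℝ) 1, K (r, 1, 0) = γ₀.path 0 := fun r hr => by
    rw [← hright r hr 0 h0, mul_zero]
  have hright1 : ∀ r ∈ Icc (0 : ℝ) 1, K (r, 1, 2 * (k : ℝ) - 1) = γ₀.path 1 := fun r hr => by
    rw [← hright r hr 1 h1, mul_one]
  have hbot : ∀ r ∈ Icc (0 : ℝ) 1, ∀ τ ∈ Icc (0 : ℝ) 1, K (r, τ, 0) ∈ (R 0).points :=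
    fun r hr τ hτ => by
      obtain ⟨v, hv⟩ := hKr r hr
      rw [hv (τ, 0) ⟨hτ, hc0⟩]
      exact v.bottom τ hτ
  have htop : ∀ r ∈ Icc (0 : ℝ) 1, ∀ τ ∈ Icc (0 : ℝ) 1,
      K (r, τ, 2 * (k : ℝ) - 1) ∈ (R (Fin.last k)).points := fun r hr τ hτ => by
    obtain ⟨v, hv⟩ := hKr r hr
    rw [hv (τ, _) ⟨hτ, hc1⟩]
    exact v.top τ hτ
  have hleft : ∀ r ∈ Icc (0 : ℝ) 1, ∀ i : Fin k, ∀ s ∈ Icc (0 : ℝ) 1,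
      K (r, 0, 2 * ((i : ℕ) : ℝ) + s) = (γ i).path s := fun r hr i s hs => by
    obtain ⟨v, hv⟩ := hKr r hr
    rw [hv (0, _) ⟨h0, chord_mem i hs⟩, v.left_chord i s hs]
  have hedge : ∀ r ∈ Icc (0 : ℝ) 1, ∀ i : Fin k, 0 < (i : ℕ) → ∀ s ∈ Icc (0 : ℝ) 1,
      K (r, 0, 2 * ((i : ℕ) : ℝ) - 1 + s) ∈ (R i.castSucc).points := fun r hr i hi s hs => by
    obtain ⟨v, hv⟩ := hKr r hr
    rw [hv (0, _) ⟨h0, edge_mem i hi hs⟩]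
    exact v.left_edge i hi s hs
  have hsnd : MapsTo (fun z : ℝ × ℝ => z.2) (Icc (0 : ℝ) 1 ×ˢ Icc (0 : ℝ) 1) (Icc 0 1) :=
    fun z hz => hz.2
  have eb := hT (fun τ => (τ, 0)) (fun r τ => (R 0).gauss (K (r, τ, 0))) (by fun_prop)
    (fun τ hτ => ⟨hτ, hc0⟩) ((R 0).isLagrangianSection_gauss
      (hK.comp (by fun_prop) fun z hz => ⟨hz.1, hz.2, hc0⟩) fun z hz => hbot z.1 hz.1 z.2 hz.2)
  have eγ₀ := hT (fun s => (1, (2 * (k : ℝ) - 1) * s)) (fun _ s => γ₀.transport s) (by fun_prop)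
    (fun s hs => ⟨h1, hcs s hs⟩)
    ((hγ₀.comp continuousOn_snd hsnd).congr (fun z hz => hright z.1 hz.1 z.2 hz.2) fun _ _ => rfl)
  have ea₀ := hT (fun _ => (1, 2 * (k : ℝ) - 1)) (fun _ s => ⟨γ₀.path 1, a₀ s⟩) (by fun_prop)
    (fun s hs => ⟨h1, hc1⟩)
    ((ha₀.isSection.comp continuousOn_snd hsnd).congr (fun z hz => hright1 z.1 hz.1)
      fun _ _ => rfl)
  have et := hT (fun τ => (τ, 2 * (k : ℝ) - 1))
    (fun r τ => (R (Fin.last k)).gauss (K (r, τ, 2 * (k : ℝ) - 1))) (by fun_prop)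
    (fun τ hτ => ⟨hτ, hc1⟩) ((R (Fin.last k)).isLagrangianSection_gauss
      (hK.comp (by fun_prop) fun z hz => ⟨hz.1, hz.2, hc1⟩) fun z hz => htop z.1 hz.1 z.2 hz.2)
  have eγ := fun i : Fin k => hT (fun s => (0, 2 * ((i : ℕ) : ℝ) + s))
    (fun _ s => (γ i).transport s) (by fun_prop) (fun s hs => ⟨h0, chord_mem i hs⟩)
    (((hγ i).comp continuousOn_snd hsnd).congr (fun z hz => hleft z.1 hz.1 i z.2 hz.2)
      fun _ _ => rfl)
  have ea := fun i : Fin k => hT (fun _ => (0, 2 * ((i : ℕ) : ℝ) + 1))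
    (fun _ s => ⟨(γ i).path 1, a i s⟩) (by fun_prop) (fun s hs => ⟨h0, chord_mem i h1⟩)
    (((ha i).isSection.comp continuousOn_snd hsnd).congr (fun z hz => hleft z.1 hz.1 i 1 h1)
      fun _ _ => rfl)
  have ee := fun (i : Fin k) (hi : 0 < (i : ℕ)) => hT (fun s => (0, 2 * ((i : ℕ) : ℝ) - 1 + s))
    (fun r s => (R i.castSucc).gauss (K (r, 0, 2 * ((i : ℕ) : ℝ) - 1 + s))) (by fun_prop)
    (fun s hs => ⟨h0, edge_mem i hi hs⟩) ((R i.castSucc).isLagrangianSection_gauss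
      (hK.comp (by fun_prop) fun z hz => ⟨hz.1, h0, edge_mem i hi hz.2⟩)
      fun z hz => hedge z.1 hz.1 i hi z.2 hz.2)
  -- the corners match
  have c10 : T (1, 0) (fun r => (R 0).gauss (K (r, 1, 0))) = T (1, 0) (fun _ => γ₀.transport 0) :=
    hTc _ _ _ fun r hr => by rw [hright0 r hr, γ₀.transport_zero]
  have c11 : T (1, 2 * (k : ℝ) - 1) (fun r => (R (Fin.last k)).gauss (K (r, 1, 2 * (k : ℝ) - 1))) =
      T (1, 2 * (k : ℝ) - 1) (fun _ => ⟨γ₀.path 1, a₀ 0⟩) :=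
    hTc _ _ _ fun r hr => by rw [hright1 r hr, ha₀.start]; rfl
  have c11' : T (1, 2 * (k : ℝ) - 1) (fun _ => ⟨γ₀.path 1, a₀ 1⟩) =
      T (1, 2 * (k : ℝ) - 1) (fun _ => γ₀.transport 1) :=
    hTc _ _ _ fun r hr => ha₀.finish
  have cγ : ∀ i : Fin k, T (0, 2 * ((i : ℕ) : ℝ) + 1) (fun _ => ⟨(γ i).path 1, a i 1⟩) =
      T (0, 2 * ((i : ℕ) : ℝ) + 1) (fun _ => (γ i).transport 1) :=
    fun i => hTc _ _ _ fun r hr => (ha i).finish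
  -- the changes at the left side telescope
  let y : Fin k → ℝ := fun i => T (0, 2 * ((i : ℕ) : ℝ)) (fun _ => (γ i).transport 0)
  let x : Fin k → ℝ := fun i => T (0, 2 * ((i : ℕ) : ℝ) + 1) (fun _ => ⟨(γ i).path 1, a i 0⟩)
  let l : Fin k → ℝ := fun i => T (0, 2 * ((i : ℕ) : ℝ) - 1)
    (fun r => (R i.castSucc).gauss (K (r, 0, 2 * ((i : ℕ) : ℝ) - 1)))
  have hy : ∀ i : Fin k, 0 < (i : ℕ) → y i = T (0, 2 * ((i : ℕ) : ℝ) - 1 + 1)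
      (fun r => (R i.castSucc).gauss (K (r, 0, 2 * ((i : ℕ) : ℝ) - 1 + 1))) := fun i hi => by
    rw [sub_add_cancel]
    refine hTc _ _ _ fun r hr => ?_
    have h2 := hleft r hr i 0 h0
    rw [add_zero] at h2
    rw [h2, (γ i).transport_zero]
  have hterm : ∀ i : Fin k, phaseVar C p' q' (fun _ => ((0 : ℝ), 2 * ((i : ℕ) : ℝ) + 1))
        (fun s => ⟨(γ i).path 1, a i s⟩) -
      phaseVar C p' q' (fun s => ((0 : ℝ), 2 * ((i : ℕ) : ℝ) + s)) (γ i).transport -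
      (if 0 < (i : ℕ) then phaseVar C p' q' (fun s => ((0 : ℝ), 2 * ((i : ℕ) : ℝ) - 1 + s))
        (fun s => (R i.castSucc).gauss (u'.map (0, 2 * ((i : ℕ) : ℝ) - 1 + s))) else 0) =
      (phaseVar C p q (fun _ => ((0 : ℝ), 2 * ((i : ℕ) : ℝ) + 1))
        (fun s => ⟨(γ i).path 1, a i s⟩) -
      phaseVar C p q (fun s => ((0 : ℝ), 2 * ((i : ℕ) : ℝ) + s)) (γ i).transport -
      (if 0 < (i : ℕ) then phaseVar C p q (fun s => ((0 : ℝ), 2 * ((i : ℕ) : ℝ) - 1 + s))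
        (fun s => (R i.castSucc).gauss (u.map (0, 2 * ((i : ℕ) : ℝ) - 1 + s))) else 0)) +
      ((if (i : ℕ) = 0 then y i else 0) - (x i - if 0 < (i : ℕ) then l i else 0)) := fun i => by
    have e1 := eγ i
    have e2 := ea i
    simp only [add_zero] at e1
    rcases Nat.eq_zero_or_pos (i : ℕ) with hi | hi
    · have e3 := cγ i
      rw [if_neg hi.not_gt, if_neg hi.not_gt, if_neg hi.not_gt, if_pos hi]
      simp only [x, y]
      linarith
    · have e3 := cγ i
      have e4 := ee i hi
      have e5 := hy i hi
      simp only [add_zero] at e4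
      have eu0 : phaseVar C p q (fun s => ((0 : ℝ), 2 * ((i : ℕ) : ℝ) - 1 + s))
          (fun s => (R i.castSucc).gauss (K (0, 0, 2 * ((i : ℕ) : ℝ) - 1 + s))) =
          phaseVar C p q (fun s => ((0 : ℝ), 2 * ((i : ℕ) : ℝ) - 1 + s))
          (fun s => (R i.castSucc).gauss (u.map (0, 2 * ((i : ℕ) : ℝ) - 1 + s))) :=
        phaseVar_congr fun s hs => ⟨rfl, rfl, by rw [hK0 (0, _) ⟨h0, edge_mem i hi hs⟩]⟩
      have eu1 : phaseVar C p' q' (fun s => ((0 : ℝ), 2 * ((i : ℕ) : ℝ) - 1 + s))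
          (fun s => (R i.castSucc).gauss (K (1, 0, 2 * ((i : ℕ) : ℝ) - 1 + s))) =
          phaseVar C p' q' (fun s => ((0 : ℝ), 2 * ((i : ℕ) : ℝ) - 1 + s))
          (fun s => (R i.castSucc).gauss (u'.map (0, 2 * ((i : ℕ) : ℝ) - 1 + s))) :=
        phaseVar_congr fun s hs => ⟨rfl, rfl, by rw [hK1 (0, _) ⟨h0, edge_mem i hi hs⟩]⟩
      rw [if_pos hi, if_pos hi, if_pos hi, if_neg hi.ne']
      simp only [x, y, l] at e5 ⊢
      linarith
  have hsum : ∑ i : Fin k, ((if (i : ℕ) = 0 then y i else 0) -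
      (x i - if 0 < (i : ℕ) then l i else 0)) =
      T (0, 0) (fun r => (R 0).gauss (K (r, 0, 0))) -
        T (0, 2 * (k : ℝ) - 1) (fun r => (R (Fin.last k)).gauss (K (r, 0, 2 * (k : ℝ) - 1))) := by
    obtain ⟨k, rfl⟩ : ∃ k', k = k' + 1 := ⟨k - 1, by omega⟩
    rw [Finset.sum_sub_distrib, sum_sub_ite_eq x l fun j => ?_]
    · have ey : (∑ i : Fin (k + 1), if (i : ℕ) = 0 then y i else 0) = y 0 := by
        rw [Fin.sum_univ_succ]
        simp
      rw [ey]
      congr 1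
      · have e0 : (2 * (((0 : Fin (k + 1)) : ℕ) : ℝ)) = 0 := by simp
        simp only [y, e0]
        refine hTc _ _ _ fun r hr => ?_
        have h2 := hleft r hr 0 0 h0
        rw [e0, add_zero] at h2
        rw [h2, (γ 0).transport_zero]
        rfl
      · have e0 : (2 * ((Fin.last k : ℕ) : ℝ)) + 1 = 2 * ((k + 1 : ℕ) : ℝ) - 1 := by
          push_cast [Fin.val_last]; ring
        simp only [x]
        rw [e0]
        refine hTc _ _ _ fun r hr => ?_
        have h2 := hleft r hr (Fin.last k) 1 h1
        rw [e0] at h2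
        rw [h2, (ha (Fin.last k)).start]
        rfl
    · have e0 : (2 * ((j.succ : ℕ) : ℝ)) - 1 = 2 * ((j.castSucc : ℕ) : ℝ) + 1 := by
        push_cast [Fin.val_succ, Fin.val_castSucc]; ring
      simp only [x, l]
      rw [e0]
      refine hTc _ _ _ fun r hr => ?_
      have h2 := hleft r hr j.castSucc 1 h1
      rw [h2, (ha j.castSucc).start]
      rfl
  have eb0 : phaseVar C p q (fun τ => (τ, 0)) (fun τ => (R 0).gauss (K (0, τ, 0))) =
      phaseVar C p q (fun τ => (τ, 0)) (fun τ => (R 0).gauss (u.map (τ, 0))) :=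
    phaseVar_congr fun τ hτ => ⟨rfl, rfl, by rw [hK0 (τ, 0) ⟨hτ, hc0⟩]⟩
  have eb1 : phaseVar C p' q' (fun τ => (τ, 0)) (fun τ => (R 0).gauss (K (1, τ, 0))) =
      phaseVar C p' q' (fun τ => (τ, 0)) (fun τ => (R 0).gauss (u'.map (τ, 0))) :=
    phaseVar_congr fun τ hτ => ⟨rfl, rfl, by rw [hK1 (τ, 0) ⟨hτ, hc0⟩]⟩
  have et0 : phaseVar C p q (fun τ => (τ, 2 * (k : ℝ) - 1))
      (fun τ => (R (Fin.last k)).gauss (K (0, τ, 2 * (k : ℝ) - 1))) =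
      phaseVar C p q (fun τ => (τ, 2 * (k : ℝ) - 1))
        (fun τ => (R (Fin.last k)).gauss (u.map (τ, 2 * (k : ℝ) - 1))) :=
    phaseVar_congr fun τ hτ => ⟨rfl, rfl, by rw [hK0 (τ, _) ⟨hτ, hc1⟩]⟩
  have et1 : phaseVar C p' q' (fun τ => (τ, 2 * (k : ℝ) - 1))
      (fun τ => (R (Fin.last k)).gauss (K (1, τ, 2 * (k : ℝ) - 1))) =
      phaseVar C p' q' (fun τ => (τ, 2 * (k : ℝ) - 1))
        (fun τ => (R (Fin.last k)).gauss (u'.map (τ, 2 * (k : ℝ) - 1))) :=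
    phaseVar_congr fun τ hτ => ⟨rfl, rfl, by rw [hK1 (τ, _) ⟨hτ, hc1⟩]⟩
  simp only [mul_one, mul_zero] at eγ₀
  simp only [phaseSum]
  rw [Finset.sum_congr rfl fun i _ => hterm i, Finset.sum_add_distrib, hsum]
  linarith

theorem homotopic_refl (u : Polygon R γ γ₀) : u.Homotopic u :=
  ⟨fun z => u.map z.2, u.continuousOn_map.comp continuousOn_snd fun _ hz => hz.2,
    fun _ _ => rfl, fun _ _ => rfl, fun _ _ => ⟨u, fun _ _ => rfl⟩⟩

theorem phaseSum_eq (hk : 1 ≤ k) {u u' : Polygon R γ γ₀}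
    (hu : Quot.mk (Polygon.Homotopic (R := R) (γ := γ) (γ₀ := γ₀)) u = Quot.mk _ u')
    (hγ : ∀ i, IsLagrangianSection C (Icc 0 1) (γ i).path (γ i).transport)
    (hγ₀ : IsLagrangianSection C (Icc 0 1) γ₀.path γ₀.transport)
    {a : ∀ i, ℝ → Submodule ℝ (TangentSpace (𝓡 (2 * n + 1)) ((γ i).path 1))}
    {a₀ : ℝ → Submodule ℝ (TangentSpace (𝓡 (2 * n + 1)) (γ₀.path 1))}
    (ha : ∀ i, (γ i).IsCornerPath (a i)) (ha₀ : γ₀.IsCornerPath a₀)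
    {p q p' q' : ℝ × ℝ → Fin n → Model n} (h : IsFrame C (polygonDomain k) u.map p q)
    (h' : IsFrame C (polygonDomain k) u'.map p' q') :
    u.phaseSum p q a a₀ = u'.phaseSum p' q' a a₀ := by
  have h1 := Quot.eqvGen_exact hu
  induction h1 generalizing p q p' q' with
  | rel _ _ hr => exact phaseSum_of_homotopic hk hr hγ hγ₀ ha ha₀ h h'
  | refl x => exact phaseSum_of_homotopic hk x.homotopic_refl hγ hγ₀ ha ha₀ h h'
  | symm x y hxy ih => exact (ih (Quot.eqvGen_sound hxy) h' h).symm
  | trans x y z hxy hyz ih ih' =>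
    obtain ⟨P, Q, hPQ⟩ := hasFrame_rectangle (C := C) (width_pos hk) y.continuousOn_map
    exact (ih (Quot.eqvGen_sound hxy) h hPQ).trans (ih' (Quot.eqvGen_sound hyz) hPQ h')

end Polygon

theorem PolygonClass.IsMaslovIndex.isLagrangianSection_transport {B : PolygonClass R γ γ₀} {m : ℤ}
    (h : B.IsMaslovIndex m) : IsLagrangianSection C (Icc 0 1) γ₀.path γ₀.transport := by
  obtain ⟨u, -, a, a₀, -, -, hm⟩ := h
  have h1 := hm.1 ⟨fun s => (1, (2 * (k : ℝ) - 1) * s), fun s => γ₀.transport s⟩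
    (by simp [Polygon.loop])
  exact h1.2.2.congr (fun t ht => (u.right t ht).symm) fun _ _ => rfl

theorem PolygonClass.IsMaslovIndex.exists_isCornerPath {B : PolygonClass R γ γ₀} {m : ℤ}
    (h : B.IsMaslovIndex m) : ∃ a₀, γ₀.IsCornerPath a₀ := by
  obtain ⟨u, -, a, a₀, -, ha₀, -⟩ := h
  exact ⟨a₀, ha₀⟩

/-- The index of a class of polygons can be computed from any representative, any corner paths and
any frame. -/
theorem PolygonClass.IsMaslovIndex.phaseSum_eq (hk : 1 ≤ k) {B : PolygonClass R γ γ₀} {m : ℤ}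
    (h : B.IsMaslovIndex m)
    (hγ : ∀ i, IsLagrangianSection C (Icc 0 1) (γ i).path (γ i).transport)
    {u : Polygon R γ γ₀} (hu : Quot.mk _ u = B)
    {a : ∀ i, ℝ → Submodule ℝ (TangentSpace (𝓡 (2 * n + 1)) ((γ i).path 1))}
    {a₀ : ℝ → Submodule ℝ (TangentSpace (𝓡 (2 * n + 1)) (γ₀.path 1))}
    (ha : ∀ i, (γ i).IsCornerPath (a i)) (ha₀ : γ₀.IsCornerPath a₀)
    {p q : ℝ × ℝ → Fin n → Model n} (hpq : IsFrame C (polygonDomain k) u.map p q) :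
    u.phaseSum p q a a₀ = 2 * Real.pi * m := by
  have hγ₀ := h.isLagrangianSection_transport
  obtain ⟨u', hu', a', a₀', ha', ha₀', hm⟩ := h
  obtain ⟨-, p', q', hpq', hsum⟩ := exists_loopVar_eq_of_isMaslovIndexOfLoop hm
  rw [← hsum, u'.loopVar_loop hk hγ ha₀' hpq', u'.phaseSum_corner hk ha' ha ha₀' ha₀ hpq']
  exact Polygon.phaseSum_eq hk (hu.trans hu'.symm) hγ hγ₀ ha ha₀ hpq hpq'

end PolygonClasses

/-! ### The glued square -/

section Subdivision

theorem argVar_shift {ζ : ℝ → ℂ} {d : ℝ} (h : CircleOn ζ (Icc d (d + 1))) :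
    argVar (fun s => ζ (d + s)) 0 1 = argVar ζ d (d + 1) := by
  have h1 := argVar_comp_affine (ζ := ζ) (a := 0) (b := 1) (c := 1) (d := d) zero_le_one zero_le_one
    (by rw [mul_zero, mul_one, zero_add, add_comm]; exact h)
  rw [mul_zero, mul_one, zero_add, add_comm 1 d] at h1
  rw [← h1]
  exact argVar_congr fun s _ => by rw [one_mul, add_comm]

/-- The left side of the polygon consists of the intervals `[2i, 2i + 1]` and, for `i > 0`, the
intervals `[2i - 1, 2i]`. -/
theorem argVar_subdivision (k : ℕ) {ζ : ℝ → ℂ} (h : CircleOn ζ (Icc 0 (2 * (k : ℝ) + 1))) :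
    argVar ζ 0 (2 * (k : ℝ) + 1) =
      ∑ i : Fin (k + 1), (argVar (fun s => ζ (2 * ((i : ℕ) : ℝ) + s)) 0 1 +
        if 0 < (i : ℕ) then argVar (fun s => ζ (2 * ((i : ℕ) : ℝ) - 1 + s)) 0 1 else 0) := by
  induction k with
  | zero => simp
  | succ k ih =>
    have hk : (0 : ℝ) ≤ k := Nat.cast_nonneg k
    push_cast at h ⊢
    rw [Fin.sum_univ_castSucc]
    simp only [Fin.val_castSucc, Fin.val_last, Nat.succ_pos, if_true]
    rw [← ih (h.mono (Icc_subset_Icc_right (by linarith))),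
      argVar_add (b := 2 * (k : ℝ) + 1) (by linarith) (by linarith) h,
      argVar_add (a := 2 * (k : ℝ) + 1) (b := 2 * ((k : ℝ) + 1)) (by linarith) (by linarith)
        (h.mono (Icc_subset_Icc_left (by linarith)))]
    push_cast
    rw [argVar_shift (h.mono (Icc_subset_Icc (by linarith) le_rfl)),
      argVar_shift (h.mono (Icc_subset_Icc (by linarith) (by linarith)))]
    rw [show 2 * ((k : ℝ) + 1) - 1 + 1 = 2 * ((k : ℝ) + 1) by ring,
      show 2 * ((k : ℝ) + 1) - 1 = 2 * (k : ℝ) + 1 by ring]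
    ring

/-- Subdivision into the three thirds of the unit interval. -/
theorem argVar_thirds {ζ : ℝ → ℂ} (h : CircleOn ζ (Icc 0 1)) :
    argVar ζ 0 1 = argVar (fun σ => ζ (σ / 3)) 0 1 + argVar (fun σ => ζ ((σ + 1) / 3)) 0 1 +
      argVar (fun σ => ζ ((σ + 2) / 3)) 0 1 := by
  have h1 : ∀ d : ℝ, 0 ≤ d → d ≤ 2 / 3 →
      argVar (fun σ => ζ (1 / 3 * σ + d)) 0 1 = argVar ζ d (1 / 3 + d) := fun d hd hd' => by
    have := argVar_comp_affine (ζ := ζ) (a := 0) (b := 1) (c := 1 / 3) (d := d) zero_le_one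
      (by norm_num) (h.mono (Icc_subset_Icc (by linarith) (by linarith)))
    rwa [mul_zero, mul_one, zero_add] at this
  have e0 := h1 0 le_rfl (by norm_num)
  have e1 := h1 (1 / 3) (by norm_num) (by norm_num)
  have e2 := h1 (2 / 3) (by norm_num) le_rfl
  rw [argVar_add (b := 1 / 3) (by norm_num) (by norm_num) h,
    argVar_add (a := 1 / 3) (b := 2 / 3) (by norm_num) (by norm_num)
      (h.mono (Icc_subset_Icc_left (by norm_num)))]
  norm_num at e0 e1 e2
  rw [← e0, ← e1, ← e2, ← add_assoc]
  congr 1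
  · congr 1
    · exact argVar_congr fun s _ => by ring_nf
    · exact argVar_congr fun s _ => by ring_nf
  · exact argVar_congr fun s _ => by ring_nf

end Subdivision

section Gluing

/-- The bookkeeping of the gluing: the contributions `co i` and `ch i` of the corner paths and the
chords cancel, and the contributions `t i` and `b i` of the tops and bottoms of the squares are
matched along the strips between them. -/
theorem sum_glue {k : ℕ} {b t l e eu : Fin (k + 1) → ℝ}
    (hV : ∀ i : Fin (k + 1), 0 < (i : ℕ) → l i + eu i = e i + b i)
    (hT : ∀ j : Fin k, l j.succ = t j.castSucc) (br co ch : Fin (k + 1) → ℝ) :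
    ∑ i : Fin (k + 1), (co i - ch i - if 0 < (i : ℕ) then eu i else 0) +
      ∑ i, (-br i + b i + ch i - co i - t i) =
    b 0 - t (Fin.last k) - ∑ i : Fin (k + 1), (br i + if 0 < (i : ℕ) then e i else 0) := by
  have h0 : ∑ i : Fin (k + 1), (if 0 < (i : ℕ) then 0 else b i) = b 0 := by
    rw [Fin.sum_univ_succ]
    simp
  rw [← sum_sub_ite_eq t l hT, ← h0, ← Finset.sum_add_distrib, ← Finset.sum_sub_distrib,
    ← Finset.sum_sub_distrib]
  refine Finset.sum_congr rfl fun i _ => ?_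
  split_ifs with hi
  · linarith [hV i hi]
  · ring

variable {n k : ℕ} {M : Type u} [TopologicalSpace M] [ChartedSpace (Model n) M]
  [IsManifold (𝓡 (2 * n + 1)) ∞ M] {C : ContactForm n M}

/-- In a frame over the glued square, the value of the index of the square is the sum of the values
for the polygon and for the attached squares: the contributions of the chords and corner paths along
which the pieces are glued cancel, the Lagrangian loops over the strips which interpolate between
the attached squares are contractible, and so is the one over the homotopy of graded paths. -/
theorem phaseSum_glue (E : GradedBridgedLink C (k + 1))
    {γ : ∀ i : Fin (k + 1), ReebChord (E.R i.castSucc) (E.R i.succ)}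
    {γ₀ : ReebChord (E.R 0) (E.R (Fin.last (k + 1)))}
    {w : ∀ i : Fin (k + 1), BoundingSquare (E.bridge i.castSucc i.succ) (γ i)}
    {u : Polygon E.R γ γ₀} {g : BoundingSquare (E.bridge 0 (Fin.last (k + 1))) γ₀}
    {V H : ℝ × ℝ → M} {A : ℝ × ℝ → TangentSubspace n M} (hV : IsAttachment E w u V)
    (hH : IsGradedHomotopy E V H A) {c : ℝ} (hc : c = 2 * ((k + 1 : ℕ) : ℝ) - 1)
    (hg : ∀ σ ∈ Icc (0 : ℝ) 1, ∀ s ∈ Icc (0 : ℝ) 1, g.map (σ / 3, s) = H (σ, c * s) ∧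
      g.map ((σ + 1) / 3, s) = V (σ, c * s) ∧ g.map ((σ + 2) / 3, s) = u.map (σ, c * s))
    (a : ∀ i, ℝ → Submodule ℝ (TangentSpace (𝓡 (2 * n + 1)) ((γ i).path 1)))
    (a₀ : ℝ → Submodule ℝ (TangentSpace (𝓡 (2 * n + 1)) (γ₀.path 1)))
    {P Q : ℝ × ℝ → Fin n → Model n} (hPQ : IsFrame C unitSquare g.map P Q) :
    IsFrame C (polygonDomain (k + 1)) u.map (fun z => P ((z.1 + 2) / 3, z.2 / c))
      (fun z => Q ((z.1 + 2) / 3, z.2 / c)) ∧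
    (∀ i : Fin (k + 1), IsFrame C unitSquare (w i).map
      (fun z => P ((z.1 + 1) / 3, (2 * ((i : ℕ) : ℝ) + z.2) / c))
      (fun z => Q ((z.1 + 1) / 3, (2 * ((i : ℕ) : ℝ) + z.2) / c))) ∧
    g.phaseSum P Q a₀ = u.phaseSum (fun z => P ((z.1 + 2) / 3, z.2 / c))
      (fun z => Q ((z.1 + 2) / 3, z.2 / c)) a a₀ +
      ∑ i : Fin (k + 1), (w i).phaseSum (fun z => P ((z.1 + 1) / 3, (2 * ((i : ℕ) : ℝ) + z.2) / c))
        (fun z => Q ((z.1 + 1) / 3, (2 * ((i : ℕ) : ℝ) + z.2) / c)) (a i) := by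
  have hc0 : 0 < c := by rw [hc]; exact Polygon.width_pos (Nat.succ_pos k)
  have hc' : c = 2 * (k : ℝ) + 1 := by rw [hc]; push_cast; ring
  have hD : polygonDomain (k + 1) = Icc 0 1 ×ˢ Icc 0 c := by rw [polygonDomain, hc]
  have h0 : (0 : ℝ) ∈ Icc (0 : ℝ) 1 := by simp
  have h1 : (1 : ℝ) ∈ Icc (0 : ℝ) 1 := by simp
  have hdiv : ∀ t ∈ Icc 0 c, t / c ∈ Icc (0 : ℝ) 1 := fun t ht =>
    ⟨div_nonneg ht.1 hc0.le, (div_le_one hc0).2 ht.2⟩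
  have hcancel : ∀ t, c * (t / c) = t := fun t => mul_div_cancel₀ t hc0.ne'
  have hmem : ∀ i : Fin (k + 1), ∀ s ∈ Icc (0 : ℝ) 1, 2 * ((i : ℕ) : ℝ) + s ∈ Icc 0 c :=
    fun i s hs => by rw [hc]; exact Polygon.chord_mem i hs
  have hmem' : ∀ i : Fin (k + 1), 0 < (i : ℕ) → ∀ s ∈ Icc (0 : ℝ) 1,
      2 * ((i : ℕ) : ℝ) - 1 + s ∈ Icc 0 c := fun i hi s hs => by
    rw [hc]; exact Polygon.edge_mem i hi hs
  -- the contributions of the arcs; `br`, `b`, `t`, `ch`, `co` belong to the bridges, bottoms, tops,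
  -- chords and corners of the attached squares, `eu` to the edges of the polygon, and `e`, `l` to
  -- the left sides and the bottoms of the strips between the squares
  obtain ⟨br, h_br⟩ : ∃ br : Fin (k + 1) → ℝ, ∀ i : Fin (k + 1), br i =
      phaseVar C (fun z => P ((z.1 + 1) / 3, (2 * ((i : ℕ) : ℝ) + z.2) / c))
        (fun z => Q ((z.1 + 1) / 3, (2 * ((i : ℕ) : ℝ) + z.2) / c)) (fun t => ((0 : ℝ), t))
        (E.bridge i.castSucc i.succ).grading :=
    ⟨_, fun _ => rfl⟩
  obtain ⟨b, h_b⟩ : ∃ b : Fin (k + 1) → ℝ, ∀ i : Fin (k + 1), b i =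
      phaseVar C (fun z => P ((z.1 + 1) / 3, (2 * ((i : ℕ) : ℝ) + z.2) / c))
        (fun z => Q ((z.1 + 1) / 3, (2 * ((i : ℕ) : ℝ) + z.2) / c)) (fun τ => (τ, (0 : ℝ)))
        (fun τ => (E.R i.castSucc).gauss ((w i).map (τ, 0))) :=
    ⟨_, fun _ => rfl⟩
  obtain ⟨t, h_t⟩ : ∃ t : Fin (k + 1) → ℝ, ∀ i : Fin (k + 1), t i =
      phaseVar C (fun z => P ((z.1 + 1) / 3, (2 * ((i : ℕ) : ℝ) + z.2) / c))
        (fun z => Q ((z.1 + 1) / 3, (2 * ((i : ℕ) : ℝ) + z.2) / c)) (fun τ => (τ, (1 : ℝ)))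
        (fun τ => (E.R i.succ).gauss ((w i).map (τ, 1))) :=
    ⟨_, fun _ => rfl⟩
  obtain ⟨ch, h_ch⟩ : ∃ ch : Fin (k + 1) → ℝ, ∀ i : Fin (k + 1), ch i =
      phaseVar C (fun z => P ((z.1 + 1) / 3, (2 * ((i : ℕ) : ℝ) + z.2) / c))
        (fun z => Q ((z.1 + 1) / 3, (2 * ((i : ℕ) : ℝ) + z.2) / c)) (fun t => ((1 : ℝ), t))
        (γ i).transport :=
    ⟨_, fun _ => rfl⟩
  obtain ⟨co, h_co⟩ : ∃ co : Fin (k + 1) → ℝ, ∀ i : Fin (k + 1), co i =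
      phaseVar C (fun z => P ((z.1 + 1) / 3, (2 * ((i : ℕ) : ℝ) + z.2) / c))
        (fun z => Q ((z.1 + 1) / 3, (2 * ((i : ℕ) : ℝ) + z.2) / c)) (fun _ => ((1 : ℝ), (1 : ℝ)))
        (fun s => ⟨(γ i).path 1, a i s⟩) :=
    ⟨_, fun _ => rfl⟩
  obtain ⟨eu, h_eu⟩ : ∃ eu : Fin (k + 1) → ℝ, ∀ i : Fin (k + 1), eu i =
      phaseVar C (fun z => P ((z.1 + 2) / 3, z.2 / c))
        (fun z => Q ((z.1 + 2) / 3, z.2 / c)) (fun s => ((0 : ℝ), 2 * ((i : ℕ) : ℝ) - 1 + s))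
        (fun s => (E.R i.castSucc).gauss (u.map (0, 2 * ((i : ℕ) : ℝ) - 1 + s))) :=
    ⟨_, fun _ => rfl⟩
  obtain ⟨e, h_e⟩ : ∃ e : Fin (k + 1) → ℝ, ∀ i : Fin (k + 1), e i =
      argVar (fun s => phaseAt C
        (P (((0 : ℝ) + 1) / 3, (2 * ((i : ℕ) : ℝ) - 1 + s) / c))
        (Q (((0 : ℝ) + 1) / 3, (2 * ((i : ℕ) : ℝ) - 1 + s) / c))
        ((E.R i.castSucc).gauss (V (0, 2 * ((i : ℕ) : ℝ) - 1 + s)))) 0 1 :=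
    ⟨_, fun _ => rfl⟩
  obtain ⟨l, h_l⟩ : ∃ l : Fin (k + 1) → ℝ, ∀ i : Fin (k + 1), l i =
      argVar (fun σ => phaseAt C (P ((σ + 1) / 3, (2 * ((i : ℕ) : ℝ) - 1) / c))
        (Q ((σ + 1) / 3, (2 * ((i : ℕ) : ℝ) - 1) / c))
        ((E.R i.castSucc).gauss (V (σ, 2 * ((i : ℕ) : ℝ) - 1)))) 0 1 :=
    ⟨_, fun _ => rfl⟩
  -- the frame restricted to the three parts
  have hFH : IsFrame C (Icc 0 1 ×ˢ Icc 0 c) H (fun z => P (z.1 / 3, z.2 / c))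
      (fun z => Q (z.1 / 3, z.2 / c)) := by
    refine (hPQ.comp (φ := fun z : ℝ × ℝ => (z.1 / 3, z.2 / c)) (by fun_prop) fun z hz =>
      ⟨⟨by linarith [hz.1.1], by linarith [hz.1.2]⟩, hdiv _ hz.2⟩).congr fun z hz => ?_
    rw [(hg z.1 hz.1 _ (hdiv _ hz.2)).1, hcancel]
  have hFV : IsFrame C (Icc 0 1 ×ˢ Icc 0 c) V (fun z => P ((z.1 + 1) / 3, z.2 / c))
      (fun z => Q ((z.1 + 1) / 3, z.2 / c)) := by
    refine (hPQ.comp (φ := fun z : ℝ × ℝ => ((z.1 + 1) / 3, z.2 / c)) (by fun_prop) fun z hz =>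
      ⟨⟨by linarith [hz.1.1], by linarith [hz.1.2]⟩, hdiv _ hz.2⟩).congr fun z hz => ?_
    rw [(hg z.1 hz.1 _ (hdiv _ hz.2)).2.1, hcancel]
  have hFu : IsFrame C (Icc 0 1 ×ˢ Icc 0 c) u.map (fun z => P ((z.1 + 2) / 3, z.2 / c))
      (fun z => Q ((z.1 + 2) / 3, z.2 / c)) := by
    refine (hPQ.comp (φ := fun z : ℝ × ℝ => ((z.1 + 2) / 3, z.2 / c)) (by fun_prop) fun z hz =>
      ⟨⟨by linarith [hz.1.1], by linarith [hz.1.2]⟩, hdiv _ hz.2⟩).congr fun z hz => ?_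
    rw [(hg z.1 hz.1 _ (hdiv _ hz.2)).2.2, hcancel]
  refine ⟨by rw [hD]; exact hFu, fun i => ?_, ?_⟩
  · refine (hFV.comp (φ := fun z : ℝ × ℝ => (z.1, 2 * ((i : ℕ) : ℝ) + z.2)) (by fun_prop)
      fun z hz => ⟨hz.1, hmem i _ hz.2⟩).congr fun z hz => ?_
    exact (hV.on_square i z.1 hz.1 z.2 hz.2).symm
  -- the homotopy of graded paths
  have hAH : IsLagrangianSection C (Icc 0 1 ×ˢ Icc 0 c) H A := by
    rw [← hD]; exact hH.isSection
  have hZH := circleOn_phaseAt hAH hFH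
  have rH := argVar_rectangle zero_le_one hc0.le hZH
  have rH_left : argVar (fun t => phaseAt C (P ((0 : ℝ) / 3, t / c)) (Q ((0 : ℝ) / 3, t / c))
      (A (0, t))) 0 c =
      phaseVar C P Q (fun t => (0, t)) (E.bridge 0 (Fin.last (k + 1))).grading := by
    have e := argVar_comp_affine (ζ := fun t => phaseAt C (P ((0 : ℝ) / 3, t / c))
      (Q ((0 : ℝ) / 3, t / c)) (A (0, t))) (a := 0) (b := 1) (c := c) (d := 0) zero_le_one hc0.le
      (by
        rw [mul_zero, mul_one, add_zero, add_zero]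
        exact hZH.comp (φ := fun t : ℝ => ((0 : ℝ), t)) (by fun_prop) fun t ht => ⟨h0, ht⟩)
    rw [mul_zero, mul_one, add_zero, add_zero] at e
    rw [← e]
    refine argVar_congr fun s hs => ?_
    have e1 := (hH.left s hs).2
    rw [← hc] at e1
    rw [add_zero, zero_div, mul_div_cancel_left₀ _ hc0.ne', e1]
  have rH_right : argVar (fun t => phaseAt C (P ((1 : ℝ) / 3, t / c)) (Q ((1 : ℝ) / 3, t / c))
      (A (1, t))) 0 c = ∑ i : Fin (k + 1), (br i + if 0 < (i : ℕ) then e i else 0) := by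
    have hcirc : CircleOn (fun t => phaseAt C (P ((1 : ℝ) / 3, t / c)) (Q ((1 : ℝ) / 3, t / c))
        (A (1, t))) (Icc 0 c) :=
      hZH.comp (φ := fun t : ℝ => ((1 : ℝ), t)) (by fun_prop) fun t ht => ⟨h1, ht⟩
    have r := argVar_subdivision k (hc' ▸ hcirc)
    rw [← hc'] at r
    refine r.trans (Finset.sum_congr rfl fun i _ => ?_)
    congr 1
    · rw [h_br]
      refine argVar_congr fun s hs => ?_
      rw [hH.right_bridge i s hs]
      beta_reduce
      rw [zero_add]
    · split_ifs with hi
      · rw [h_e]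
        refine argVar_congr fun s hs => ?_
        rw [hH.right_edge i hi s hs, zero_add]
      · rfl
  -- the strips between the attached squares
  have rV : ∀ i : Fin (k + 1), 0 < (i : ℕ) → l i + eu i = e i + b i := fun i hi => by
    have hφ : ContinuousOn (fun z : ℝ × ℝ => (z.1, 2 * ((i : ℕ) : ℝ) - 1 + z.2))
      (Icc (0 : ℝ) 1 ×ˢ Icc (0 : ℝ) 1) := by fun_prop
    have hm : MapsTo (fun z : ℝ × ℝ => (z.1, 2 * ((i : ℕ) : ℝ) - 1 + z.2))
      (Icc (0 : ℝ) 1 ×ˢ Icc (0 : ℝ) 1) (Icc 0 1 ×ˢ Icc 0 c) := fun z hz =>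
        ⟨hz.1, hmem' i hi _ hz.2⟩
    have hVc : ContinuousOn V (Icc 0 1 ×ˢ Icc 0 c) := by rw [← hD]; exact hV.continuousOn
    have r := argVar_rectangle zero_le_one zero_le_one (circleOn_phaseAt
      ((E.R i.castSucc).isLagrangianSection_gauss
        (f := fun z : ℝ × ℝ => V (z.1, 2 * ((i : ℕ) : ℝ) - 1 + z.2)) (hVc.comp hφ hm)
        fun z hz => hV.on_edge i hi z.1 hz.1 z.2 hz.2) (hFV.comp hφ hm))
    beta_reduce at r
    simp only [add_zero] at r
    have e1 : eu i =
      argVar (fun s => phaseAt C (P (((1 : ℝ) + 1) / 3, (2 * ((i : ℕ) : ℝ) - 1 + s) / c))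
        (Q (((1 : ℝ) + 1) / 3, (2 * ((i : ℕ) : ℝ) - 1 + s) / c))
        ((E.R i.castSucc).gauss (V (1, 2 * ((i : ℕ) : ℝ) - 1 + s)))) 0 1 := by
      refine (h_eu i).trans (argVar_congr fun s hs => ?_)
      have e2 := hV.right (2 * ((i : ℕ) : ℝ) - 1 + s) (by rw [← hc]; exact hmem' i hi s hs)
      beta_reduce
      rw [e2, zero_add, one_add_one_eq_two]
    have e3 : b i =
      argVar (fun τ => phaseAt C (P ((τ + 1) / 3, (2 * ((i : ℕ) : ℝ) - 1 + 1) / c))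
        (Q ((τ + 1) / 3, (2 * ((i : ℕ) : ℝ) - 1 + 1) / c))
        ((E.R i.castSucc).gauss (V (τ, 2 * ((i : ℕ) : ℝ) - 1 + 1)))) 0 1 := by
      refine (h_b i).trans (argVar_congr fun τ hτ => ?_)
      beta_reduce
      rw [← hV.on_square i τ hτ 0 h0, sub_add_cancel, add_zero]
    rw [e1, e3, h_l, h_e]
    exact r
  -- the bottom of a strip is the top of the square below it
  have rT : ∀ j : Fin k, l j.succ = t j.castSucc := fun j => by
    rw [h_l, h_t]
    refine argVar_congr fun τ hτ => ?_
    have e0 : (2 * ((j.succ : ℕ) : ℝ)) - 1 = 2 * ((j.castSucc : ℕ) : ℝ) + 1 := by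
      push_cast [Fin.val_succ, Fin.val_castSucc]; ring
    rw [e0, hV.on_square j.castSucc τ hτ 1 h1]
    rfl
  -- bottom and top of the glued square
  have hbot : phaseVar C P Q (fun τ => (τ, 0)) (fun τ => (E.R 0).gauss (g.map (τ, 0))) =
      argVar (fun σ => phaseAt C (P (σ / 3, 0 / c)) (Q (σ / 3, 0 / c)) (A (σ, 0))) 0 1 +
      b 0 +
      phaseVar C (fun z => P ((z.1 + 2) / 3, z.2 / c)) (fun z => Q ((z.1 + 2) / 3, z.2 / c))
        (fun τ => (τ, (0 : ℝ))) (fun τ => (E.R 0).gauss (u.map (τ, 0))) := by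
    refine (argVar_thirds (g.isArc_bottom.circleOn hPQ)).trans
      (congrArg₂ (· + ·) (congrArg₂ (· + ·) ?_ ?_) ?_)
    · refine argVar_congr fun σ hσ => ?_
      dsimp only
      rw [(hH.bottom σ hσ).2, (hg σ hσ 0 h0).1, mul_zero, zero_div]
    · refine (argVar_congr fun σ hσ => ?_).trans (h_b 0).symm
      have e0 : 2 * (((0 : Fin (k + 1)) : ℕ) : ℝ) + 0 = 0 := by simp
      have e1 := hV.on_square 0 σ hσ 0 h0
      rw [e0] at e1
      dsimp only
      rw [← e1, (hg σ hσ 0 h0).2.1, mul_zero, e0, zero_div]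
      rfl
    · refine argVar_congr fun σ hσ => ?_
      dsimp only
      rw [(hg σ hσ 0 h0).2.2, mul_zero, zero_div]
  have htop : phaseVar C P Q (fun τ => (τ, 1))
        (fun τ => (E.R (Fin.last (k + 1))).gauss (g.map (τ, 1))) =
      argVar (fun σ => phaseAt C (P (σ / 3, c / c)) (Q (σ / 3, c / c)) (A (σ, c))) 0 1 +
      t (Fin.last k) +
      phaseVar C (fun z => P ((z.1 + 2) / 3, z.2 / c)) (fun z => Q ((z.1 + 2) / 3, z.2 / c))
        (fun τ => (τ, c)) (fun τ => (E.R (Fin.last (k + 1))).gauss (u.map (τ, c))) := by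
    refine (argVar_thirds (g.isArc_top.circleOn hPQ)).trans
      (congrArg₂ (· + ·) (congrArg₂ (· + ·) ?_ ?_) ?_)
    · refine argVar_congr fun σ hσ => ?_
      have e1 := (hH.top σ hσ).2
      rw [← hc] at e1
      dsimp only
      rw [e1, (hg σ hσ 1 h1).1, mul_one, div_self hc0.ne']
    · refine (argVar_congr fun σ hσ => ?_).trans (h_t (Fin.last k)).symm
      have e0 : 2 * (((Fin.last k : Fin (k + 1)) : ℕ) : ℝ) + 1 = c := by rw [hc', Fin.val_last]
      have e1 := hV.on_square (Fin.last k) σ hσ 1 h1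
      rw [e0] at e1
      dsimp only
      rw [← e1, (hg σ hσ 1 h1).2.1, mul_one, e0, div_self hc0.ne']
      rfl
    · refine argVar_congr fun σ hσ => ?_
      dsimp only
      rw [(hg σ hσ 1 h1).2.2, mul_one, div_self hc0.ne']
  -- right side of the glued square
  have hright : phaseVar C (fun z => P ((z.1 + 2) / 3, z.2 / c))
      (fun z => Q ((z.1 + 2) / 3, z.2 / c)) (fun s => ((1 : ℝ), c * s)) γ₀.transport =
      phaseVar C P Q (fun t => (1, t)) γ₀.transport := by
    refine argVar_congr fun s _ => ?_
    dsimp only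
    rw [mul_div_cancel_left₀ _ hc0.ne', show ((1 : ℝ) + 2) / 3 = 1 by norm_num]
  have hcorner : phaseVar C (fun z => P ((z.1 + 2) / 3, z.2 / c))
      (fun z => Q ((z.1 + 2) / 3, z.2 / c)) (fun _ => ((1 : ℝ), c))
      (fun s => ⟨γ₀.path 1, a₀ s⟩) =
      phaseVar C P Q (fun _ => (1, 1)) (fun s => ⟨γ₀.path 1, a₀ s⟩) := by
    refine argVar_congr fun s _ => ?_
    dsimp only
    rw [div_self hc0.ne', show ((1 : ℝ) + 2) / 3 = 1 by norm_num]
  -- the chords along which the squares are glued to the polygon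
  have hchord : ∀ i : Fin (k + 1), phaseVar C (fun z => P ((z.1 + 2) / 3, z.2 / c))
        (fun z => Q ((z.1 + 2) / 3, z.2 / c))
        (fun s => ((0 : ℝ), 2 * ((i : ℕ) : ℝ) + s)) (γ i).transport = ch i := fun i => by
    rw [h_ch]
    refine argVar_congr fun s _ => ?_
    dsimp only
    rw [zero_add, one_add_one_eq_two]
  have hcorners : ∀ i : Fin (k + 1), phaseVar C (fun z => P ((z.1 + 2) / 3, z.2 / c))
        (fun z => Q ((z.1 + 2) / 3, z.2 / c))
        (fun _ => ((0 : ℝ), 2 * ((i : ℕ) : ℝ) + 1)) (fun s => ⟨(γ i).path 1, a i s⟩) = co i :=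
    fun i => by
      rw [h_co]
      refine argVar_congr fun s _ => ?_
      dsimp only
      rw [zero_add, one_add_one_eq_two]
  have hu : u.phaseSum (fun z => P ((z.1 + 2) / 3, z.2 / c))
      (fun z => Q ((z.1 + 2) / 3, z.2 / c)) a a₀ =
      phaseVar C (fun z => P ((z.1 + 2) / 3, z.2 / c)) (fun z => Q ((z.1 + 2) / 3, z.2 / c))
        (fun τ => (τ, (0 : ℝ))) (fun τ => (E.R 0).gauss (u.map (τ, 0))) +
      phaseVar C P Q (fun t => (1, t)) γ₀.transport -
      phaseVar C P Q (fun _ => (1, 1)) (fun s => ⟨γ₀.path 1, a₀ s⟩) -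
      phaseVar C (fun z => P ((z.1 + 2) / 3, z.2 / c)) (fun z => Q ((z.1 + 2) / 3, z.2 / c))
        (fun τ => (τ, c)) (fun τ => (E.R (Fin.last (k + 1))).gauss (u.map (τ, c))) +
      ∑ i : Fin (k + 1), (co i - ch i - if 0 < (i : ℕ) then eu i else 0) := by
    rw [Polygon.phaseSum, ← hc, hright, hcorner]
    congr 1
    refine Finset.sum_congr rfl fun i _ => ?_
    rw [hchord, hcorners, h_eu]
  have hw : ∀ i : Fin (k + 1), (w i).phaseSum
        (fun z => P ((z.1 + 1) / 3, (2 * ((i : ℕ) : ℝ) + z.2) / c))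
        (fun z => Q ((z.1 + 1) / 3, (2 * ((i : ℕ) : ℝ) + z.2) / c)) (a i) =
      -br i + b i + ch i - co i - t i := fun i => by
    rw [BoundingSquare.phaseSum, h_br, h_b, h_ch, h_co, h_t]
  have hsum := sum_glue rV rT br co ch
  rw [← rH_right] at hsum
  rw [hu, Finset.sum_congr rfl fun i _ => hw i, BoundingSquare.phaseSum, hbot, htop, ← rH_left]
  linarith [rH, hsum]

end Gluing

section Additivity

variable {n k : ℕ} {M : Type u} [TopologicalSpace M] [ChartedSpace (Model n) M]
  [IsManifold (𝓡 (2 * n + 1)) ∞ M] {C : ContactForm n M}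

/-- In a frame over the glued square the index is a sum; the invariance of the value of the index
under a change of frame, representative and corner path then gives the assertion for the classes. -/
theorem IsGluing.isMaslovIndex_iff (E : GradedBridgedLink C (k + 1))
    {γ : ∀ i : Fin (k + 1), ReebChord (E.R i.castSucc) (E.R i.succ)}
    {γ₀ : ReebChord (E.R 0) (E.R (Fin.last (k + 1)))}
    {c : ∀ i : Fin (k + 1), SquareClass (E.bridge i.castSucc i.succ) (γ i)}
    {B : PolygonClass E.R γ γ₀} {c₀ : SquareClass (E.bridge 0 (Fin.last (k + 1))) γ₀}
    (hglue : IsGluing E c B c₀) {μ : Fin (k + 1) → ℤ} (hμ : ∀ i, (c i).IsMaslovIndex (μ i))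
    {μB : ℤ} (hμB : B.IsMaslovIndex μB) (m : ℤ) :
    c₀.IsMaslovIndex m ↔ m = μB + ∑ i, μ i := by
  obtain ⟨w, u, g, V, H, A, hw, hu, hg₀, hV, hH, hg⟩ := hglue
  have hγ := fun i => (hμ i).isLagrangianSection_transport
  choose a ha using fun i => (hμ i).exists_isCornerPath
  obtain ⟨a₀, ha₀⟩ := hμB.exists_isCornerPath
  obtain ⟨P, Q, hPQ⟩ := g.hasFrame
  obtain ⟨hFu, hFw, hsum⟩ := phaseSum_glue E hV hH rfl hg a a₀ hPQ
  rw [hμB.phaseSum_eq (Nat.succ_pos k) hγ hu ha ha₀ hFu,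
    Finset.sum_congr rfl fun i _ => (hμ i).phaseSum_eq (hw i) (ha i) (hFw i),
    ← Finset.mul_sum, ← mul_add] at hsum
  constructor
  · intro h
    have e := (h.phaseSum_eq hg₀ ha₀ hPQ).symm.trans hsum
    exact_mod_cast mul_left_cancel₀ Real.two_pi_pos.ne' e
  · rintro rfl
    rw [← hg₀]
    refine SquareClass.isMaslovIndex_of_phaseSum hμB.isLagrangianSection_transport ha₀ hPQ ?_
    rw [hsum]
    push_cast
    rfl

end Additivity

end ContactLink

theorem mainTheorem9 {n k : ℕ} (hk : 1 ≤ k) {M : Type*} [TopologicalSpace M] [T2Space M]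
    [ChartedSpace (EuclideanSpace ℝ (Fin (2 * n + 1))) M] [IsManifold (𝓡 (2 * n + 1)) ∞ M]
    (C : ContactForm n M) (E : GradedBridgedLink C k)
    (γ : ∀ i : Fin k, ReebChord (E.R i.castSucc) (E.R i.succ))
    (γ₀ : ReebChord (E.R 0) (E.R (Fin.last k)))
    (hγ : ∀ i, (γ i).Nondegenerate) (hγ₀ : γ₀.Nondegenerate)
    (c : ∀ i : Fin k, SquareClass (E.bridge i.castSucc i.succ) (γ i))
    (B : PolygonClass E.R γ γ₀)
    (c₀ : SquareClass (E.bridge 0 (Fin.last k)) γ₀)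
    (hglue : IsGluing E c B c₀)
    (μ : Fin k → ℤ) (hμ : ∀ i, (c i).IsMaslovIndex (μ i))
    (μB : ℤ) (hμB : B.IsMaslovIndex μB) :
    ∀ m : ℤ, c₀.IsMaslovIndex m ↔ m = μB + ∑ i, μ i := by
  obtain ⟨k, rfl⟩ := Nat.exists_eq_add_of_le' hk
  exact hglue.isMaslovIndex_iff E hμ hμB
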